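/- Let $\mathbb{S}^1=\mathbb{R}/\mathbb{Z}$, identified with $\mathbb{RP}^1$ by sending $t$ to the line of angle $\pi t$, so that $\mathrm{PSL}(2,\mathbb{R})$ acts on $\mathbb{S}^1$. For $a,b\in\mathbb{S}^1$, $(a,b)$ and $[a,b]$ denote the open and closed arcs going from $a$ to $b$ in the positive direction. Let $\mathbb{F}_3=\langle a,b,c\rangle$ be the fundamental group of the twice punctured torus $T$, the generators being chosen so that $\delta_1=abc$ and $\delta_2=cba$ are represented by simple loops around the two omitted points. Let $\rho_1:\mathbb{F}_3\to\mathrm{PSL}(2,\mathbb{R})$ be the holonomy of a complete hyperbolic structure on $T$ for which all neighbourhoods of the omitted points have infinite area, and let $L\subset\mathbb{S}^1$ be the limit set of $\rho_1(\mathbb{F}_3)$, i.e. its minimal non-empty closed invariant set. Let $N,S\in\mathbb{S}^1$ be fixed points of $\rho_1(\delta_1)$ such that $(N,S)$ is a connected component of $\mathbb{S}^1\setminus L$. Let $f$ be a smooth ($C^\infty$) orientation preserving diffeomorphism of $\mathbb{S}^1$ that is equal to $\rho_1(\delta_1)$ on $[S,N]$ and has exactly one fixed point in $(N,S)$. Let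 $\rho_2:\mathbb{F}_3\to\mathrm{Diff}(\mathbb{S}^1)$ be the representation defined by $\rho_2(a)=\rho_1(a)$, $\rho_2(b)=\rho_1(b)$ and $\rho_2(\delta_1)=f$. Let $h:\mathbb{S}^1\to\mathbb{S}^1$ be non decreasing of degree one, i.e. non constant and admitting a non decreasing lift $\tilde h:\mathbb{R}\to\mathbb{R}$ with $\tilde h(t+1)=\tilde h(t)+1$, such that $h(x)=x$ for all $x\in L$ and $\rho_2(\gamma)\circ h=h\circ\rho_1(\gamma)$ for all $\gamma\in\mathbb{F}_3$. Let $G(h)$ be the graph of $h$ completed by the vertical segments $\{x\}\times[h_l(x),h_r(x)]$ between the left and right limits of $h$, and let $M_h=(\mathbb{S}^1\times\mathbb{S}^1)\setminus G(h)$. A continuous volume form on $M_h$ is a form $\omega(x,y)\,dx\wedge dy$ with $\omega$ continuous and nowhere zero on $M_h$. Let $\omega_2$ be a continuous volume form on $M_h$ that is preserved by $(\rho_1,\rho_2)$ at the points of $(L\times\mathbb{S}^1\cup\mathbb{S}^1\times L)\cap M_h$, i.e. for all $\gamma\in\mathbb{F}_3$ and all $(x,y)\in M_h$ with $x\in L$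 or $y\in L$, $$\omega_2(\rho_1(\gamma)(x),\rho_2(\gamma)(y))\,\rho_1(\gamma)'(x)\,\rho_2(\gamma)'(y)=\omega_2(x,y).$$ Then there is a continuous volume form $\omega$ on $M_h$ that is preserved by $(\rho_1,\rho_2)$ at every point of $M_h$, i.e. $$\omega(\rho_1(\gamma)(x),\rho_2(\gamma)(y))\,\rho_1(\gamma)'(x)\,\rho_2(\gamma)'(y)=\omega(x,y)\quad\text{for all }\gamma\in\mathbb{F}_3\text{ and all }(x,y)\in M_h,$$ and that is equal to $\omega_2$ on $(L\times\mathbb{S}^1\cup\mathbb{S}^1\times L)\cap M_h$. -/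

import Mathlib

open Set Filter Topology MeasureTheory
open scoped MatrixGroups LinearAlgebra.Projectivization UpperHalfPlane

noncomputable section

namespace AreaPreserving

/-! ### The circle, its projective structure and its diffeomorphisms -/

/-- The circle `ℝ / ℤ`, with its cyclic order and its coordinate form `dx`. -/
abbrev S1 : Type := UnitAddCircle

/-- The direction vector of the line of angle `π t`. -/
def dirVec (t : ℝ) : Fin 2 → ℝ := ![Real.cos (Real.pi * t), Real.sin (Real.pi * t)]

theorem dirVec_ne_zero (t : ℝ) : dirVec t ≠ 0 := by
  intro h
  have h0 : Real.cos (Real.pi * t) = 0 := by simpa [dirVec] using congrFun h 0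
  have h1 : Real.sin (Real.pi * t) = 0 := by simpa [dirVec] using congrFun h 1
  have := Real.sin_sq_add_cos_sq (Real.pi * t)
  rw [h0, h1] at this
  norm_num at this

/-- The line of angle `π t`, a point of `ℝP¹`. -/
def lineOfReal (t : ℝ) : ℙ ℝ (Fin 2 → ℝ) := Projectivization.mk ℝ (dirVec t) (dirVec_ne_zero t)

theorem lineOfReal_periodic : Function.Periodic lineOfReal 1 := by
  intro t
  unfold lineOfReal
  rw [Projectivization.mk_eq_mk_iff']
  refine ⟨-1, ?_⟩
  ext i
  fin_cases i <;> simp [dirVec, mul_add, Real.cos_add_pi, Real.sin_add_pi]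

/-- The map `ℝ / ℤ → ℝP¹` sending `t` to the line of angle `π t`. -/
def lineOfCircle : S1 → ℙ ℝ (Fin 2 → ℝ) := lineOfReal_periodic.lift

theorem lineOfCircle_bijective : Function.Bijective lineOfCircle := by
  constructor
  · intro x y
    induction x using QuotientAddGroup.induction_on with | H s => ?_
    induction y using QuotientAddGroup.induction_on with | H t => ?_
    intro h
    change lineOfReal s = lineOfReal t at h
    unfold lineOfReal at h
    rw [Projectivization.mk_eq_mk_iff'] at h
    obtain ⟨a, ha⟩ := h
    have h0 : a * Real.cos (Real.pi * t) = Real.cos (Real.pi * s) := by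
      simpa [dirVec] using congrFun ha 0
    have h1 : a * Real.sin (Real.pi * t) = Real.sin (Real.pi * s) := by
      simpa [dirVec] using congrFun ha 1
    have h2 : Real.sin (Real.pi * (s - t)) = 0 := by
      rw [mul_sub, Real.sin_sub, ← h0, ← h1]; ring
    obtain ⟨n, hn⟩ := Real.sin_eq_zero_iff.1 h2
    have h3 : s - t = n := by
      have : Real.pi * (s - t - n) = 0 := by linarith
      rcases mul_eq_zero.1 this with h | h
      · exact absurd h Real.pi_ne_zero
      · linarith
    have h4 : ((s - t : ℝ) : S1) = 0 := by
      rw [AddCircle.coe_eq_zero_iff]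
      exact ⟨n, by simp [h3]⟩
    rw [AddCircle.coe_sub] at h4
    exact sub_eq_zero.1 h4
  · intro l
    induction l using Projectivization.ind with | h v hv => ?_
    set z : ℂ := ⟨v 0, v 1⟩ with hz
    refine ⟨((Complex.arg z / Real.pi : ℝ) : S1), ?_⟩
    change lineOfReal _ = _
    unfold lineOfReal
    rw [Projectivization.mk_eq_mk_iff']
    have hz0 : z ≠ 0 := by
      intro h
      apply hv
      have h0 : v 0 = 0 := by simpa [hz] using congrArg Complex.re h
      have h1 : v 1 = 0 := by simpa [hz] using congrArg Complex.im h
      ext i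
      fin_cases i <;> simp [h0, h1]
    have hn : ‖z‖ ≠ 0 := norm_ne_zero_iff.2 hz0
    have hpi : Real.pi * (Complex.arg z / Real.pi) = Complex.arg z :=
      mul_div_cancel₀ _ Real.pi_ne_zero
    refine ⟨‖z‖⁻¹, ?_⟩
    ext i
    fin_cases i
    · change ‖z‖⁻¹ * z.re = Real.cos (Real.pi * (Complex.arg z / Real.pi))
      rw [hpi, Complex.cos_arg hz0, div_eq_inv_mul]
    · change ‖z‖⁻¹ * z.im = Real.sin (Real.pi * (Complex.arg z / Real.pi))
      rw [hpi, Complex.sin_arg, div_eq_inv_mul]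

/-- The identification of the circle with the projective line. -/
def circleEquiv : S1 ≃ ℙ ℝ (Fin 2 → ℝ) := Equiv.ofBijective lineOfCircle lineOfCircle_bijective

/-- The projective action of `PSL(2, ℝ)` on the circle. -/
def circleAction : PSL(2, ℝ) →* Equiv.Perm S1 :=
  (circleEquiv.symm.permCongrHom).toMonoidHom.comp Projectivization.PSLAction.toPermHom

/-- `φ` is a smooth (orientation preserving) diffeomorphism of the circle. -/
def IsSmoothDiffeo (φ : Equiv.Perm S1) : Prop :=
  ∃ F : ℝ → ℝ, ContDiff ℝ ((⊤ : ℕ∞) : WithTop ℕ∞) F ∧ (∀ t, 0 < deriv F t) ∧ (∀ t, F (t + 1) = F t + 1) ∧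
    ∀ t : ℝ, φ (t : S1) = (F t : S1)

/-- The derivative of a circle map at `x` with respect to the coordinate of `ℝ / ℤ`; the
displacement `φ (x + s) - φ x` is represented by a real number in `[-1/2, 1/2)`. -/
def circleDeriv (φ : S1 → S1) (x : S1) : ℝ :=
  deriv (fun s : ℝ => (AddCircle.equivIco (1 : ℝ) (-1 / 2) (φ (x + (s : S1)) - φ x) : ℝ)) 0

/-! ### Monotone maps of degree one and the complement of their graph -/

/-- `H` is a non decreasing lift of `h` commuting with the unit translation. -/
def IsMonotoneLift (H : ℝ → ℝ) (h : S1 → S1) : Prop :=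
  Monotone H ∧ (∀ t, H (t + 1) = H t + 1) ∧ ∀ t : ℝ, h (t : S1) = (H t : S1)

/-- `h` is non decreasing of degree one. -/
def IsNondecreasingDegreeOne (h : S1 → S1) : Prop :=
  (¬ ∃ c, ∀ x, h x = c) ∧ ∃ H : ℝ → ℝ, IsMonotoneLift H h

/-- The graph of `h` completed by the vertical segments at its discontinuities. -/
def filledGraph (h : S1 → S1) : Set (S1 × S1) :=
  {p | ∃ H : ℝ → ℝ, IsMonotoneLift H h ∧ ∃ t u : ℝ, p = ((t : S1), (u : S1)) ∧
    Function.leftLim H t ≤ u ∧ u ≤ Function.rightLim H t}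

/-- The surface `M_h`, complement of the completed graph in the torus. -/
def surfaceM (h : S1 → S1) : Set (S1 × S1) := (filledGraph h)ᶜ

/-- `ω(x, y) dx ∧ dy` is a continuous volume form on the set `U`. -/
def IsContinuousVolumeForm (U : Set (S1 × S1)) (ω : S1 × S1 → ℝ) : Prop :=
  ContinuousOn ω U ∧ ∀ p ∈ U, ω p ≠ 0

/-- The form `ω(x, y) dx ∧ dy` is preserved, at the points of `A`, by all the maps
`(x, y) ↦ (r₁ γ x, r₂ γ y)`. -/
def IsPreservedAt {Γ : Type*} [Group Γ] (r₁ r₂ : Γ →* Equiv.Perm S1) (A : Set (S1 × S1))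
    (ω : S1 × S1 → ℝ) : Prop :=
  ∀ γ : Γ, ∀ p ∈ A,
    ω (r₁ γ p.1, r₂ γ p.2) * (circleDeriv (r₁ γ) p.1 * circleDeriv (r₂ γ) p.2) = ω p

/-- `(r₁, r₂, h)` is a semi conjugate triple. -/
def IsSemiConjugateTriple {Γ : Type*} [Group Γ] (r₁ r₂ : Γ →* Equiv.Perm S1) (h : S1 → S1) :
    Prop :=
  IsNondecreasingDegreeOne h ∧ ∀ γ : Γ, ∀ x, r₂ γ (h x) = h (r₁ γ x)

/-- The smallest non-empty closed invariant set. For an action with no finite orbit it is the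
unique minimal closed invariant set; for a non-elementary Fuchsian group it is the limit set. -/
def limitSet {Γ : Type*} [Group Γ] (r : Γ →* Equiv.Perm S1) : Set S1 :=
  ⋂₀ {K : Set S1 | IsClosed K ∧ K.Nonempty ∧ ∀ γ : Γ, ∀ x ∈ K, r γ x ∈ K}

/-! ### Hyperbolic structures on the twice punctured torus -/

theorem center_le_ker_toPermHom :
    Subgroup.center SL(2, ℝ) ≤ (MulAction.toPermHom SL(2, ℝ) ℍ).ker := by
  intro A hA
  rw [Matrix.SpecialLinearGroup.mem_center_iff] at hA
  obtain ⟨r, hr, hA⟩ := hA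
  have hr0 : r ≠ 0 := by
    rintro rfl
    simp at hr
  have h00 : A 0 0 = r := by rw [← hA]; simp
  have h01 : A 0 1 = 0 := by rw [← hA]; simp
  have h10 : A 1 0 = 0 := by rw [← hA]; simp
  have h11 : A 1 1 = r := by rw [← hA]; simp
  rw [MonoidHom.mem_ker]
  ext1 z
  rw [MulAction.toPermHom_apply, MulAction.toPerm_apply, Equiv.Perm.one_apply]
  apply UpperHalfPlane.ext
  have hc : (r : ℂ) ≠ 0 := by exact_mod_cast hr0
  rw [UpperHalfPlane.coe_specialLinearGroup_apply, h00, h01, h10, h11]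
  simp [mul_div_cancel_left₀ _ hc]

/-- The action of `PSL(2, ℝ)` on the hyperbolic plane by Möbius transformations. -/
def planeAction : PSL(2, ℝ) →* Equiv.Perm ℍ :=
  QuotientGroup.lift _ (MulAction.toPermHom SL(2, ℝ) ℍ) center_le_ker_toPermHom

/-- The torus `ℝ² / ℤ²`. -/
abbrev Torus : Type := UnitAddCircle × UnitAddCircle

/-- The free group on three generators. -/
abbrev F3 : Type := FreeGroup (Fin 3)

/-- The generator `a`. -/
def genA : F3 := FreeGroup.of 0

/-- The generator `b`. -/
def genB : F3 := FreeGroup.of 1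

/-- The generator `c`. -/
def genC : F3 := FreeGroup.of 2

/-- `δ₁ = abc`. -/
def delta1 : F3 := genA * genB * genC

/-- `δ₂ = cba`. -/
def delta2 : F3 := genC * genB * genA

/-- `q` presents the torus with the points `p₁ ≠ p₂` removed as the quotient of the hyperbolic
plane by a free and properly discontinuous action of `𝔽₃` through `ρ`. In other words `q` is the
universal covering of the twice punctured torus endowed with a complete hyperbolic structure, and
`ρ` is its holonomy, the fundamental group being identified with `𝔽₃`. -/
structure IsUniformization (ρ : F3 →* PSL(2, ℝ)) (q : ℍ → Torus) (p₁ p₂ : Torus) : Prop where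
  ne : p₁ ≠ p₂
  continuous : Continuous q
  isOpenMap : IsOpenMap q
  range_eq : range q = {p₁, p₂}ᶜ
  fiber : ∀ z w : ℍ, q z = q w ↔ ∃ γ : F3, planeAction (ρ γ) z = w
  free : ∀ γ : F3, ∀ z : ℍ, planeAction (ρ γ) z = z → γ = 1
  properlyDiscontinuous : ∀ K : Set ℍ, IsCompact K →
    {γ : F3 | (planeAction (ρ γ) '' K ∩ K).Nonempty}.Finite

/-- `δ` is represented by a simple loop around the omitted point `p`: there is a disc `e` around
`p`, and a lift `σ` to the hyperbolic plane of the polar coordinates `(s, r)` of the punctured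
disc, such that going once around `p` amounts to applying `δ`. -/
def IsLoopAround (ρ : F3 →* PSL(2, ℝ)) (q : ℍ → Torus) (p : Torus) (δ : F3) : Prop :=
  ∃ e : OpenPartialHomeomorph ℂ Torus, e.source = Metric.ball 0 1 ∧ e 0 = p ∧
    ∃ σ : ℝ × ℝ → ℍ, ContinuousOn σ (univ ×ˢ Ioo 0 1) ∧
      ∀ s : ℝ, ∀ r ∈ Ioo (0 : ℝ) 1,
        q (σ (s, r)) = e ((r : ℂ) * Complex.exp (2 * Real.pi * s * Complex.I)) ∧
        σ (s + 1, r) = planeAction (ρ δ) (σ (s, r))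

/-- The hyperbolic area of `V` in the quotient surface: the supremum of the areas of the
measurable sets of the hyperbolic plane that `q` maps injectively into `V`. -/
def quotientArea (q : ℍ → Torus) (V : Set Torus) : ENNReal :=
  ⨆ B ∈ {B : Set ℍ | MeasurableSet B ∧ MapsTo q B V ∧ InjOn q B}, volume B

/-- `ρ` is the holonomy of a complete hyperbolic structure on the twice punctured torus for which
the neighbourhoods of the omitted points have infinite area, the fundamental group being
identified with `𝔽₃ = ⟨a, b, c⟩` in such a way that `δ₁ = abc` and `δ₂ = cba` are represented by
simple loops around the omitted points. -/
def IsTwicePuncturedTorusHolonomy (ρ : F3 →* PSL(2, ℝ)) : Prop :=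
  ∃ (q : ℍ → Torus) (p₁ p₂ : Torus), IsUniformization ρ q p₁ p₂ ∧
    IsLoopAround ρ q p₁ delta1 ∧ IsLoopAround ρ q p₂ delta2 ∧
    (∀ V ∈ 𝓝 p₁, quotientArea q V = ⊤) ∧ (∀ V ∈ 𝓝 p₂, quotientArea q V = ⊤)

/-! ### The pair of representations -/

/-- The projective action on the circle given by a representation in `PSL(2, ℝ)`. -/
def projRep (ρ : F3 →* PSL(2, ℝ)) : F3 →* Equiv.Perm S1 := circleAction.comp ρ

/-- The representation that agrees with `r` on `a` and `b` and sends `δ₁ = abc` to `f`. -/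
def deformedRep (r : F3 →* Equiv.Perm S1) (f : Equiv.Perm S1) : F3 →* Equiv.Perm S1 :=
  FreeGroup.lift ![r genA, r genB, (r genA * r genB)⁻¹ * f]

theorem deformedRep_genA (r : F3 →* Equiv.Perm S1) (f : Equiv.Perm S1) :
    deformedRep r f genA = r genA := by
  simp [deformedRep, genA]

theorem deformedRep_genB (r : F3 →* Equiv.Perm S1) (f : Equiv.Perm S1) :
    deformedRep r f genB = r genB := by
  simp [deformedRep, genB]

theorem deformedRep_delta1 (r : F3 →* Equiv.Perm S1) (f : Equiv.Perm S1) :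
    deformedRep r f delta1 = f := by
  have hC : deformedRep r f genC = (r genA * r genB)⁻¹ * f := by simp [deformedRep, genC]
  rw [delta1, map_mul, map_mul, deformedRep_genA, deformedRep_genB, hC, mul_inv_cancel_left]

/-- The arc `(N, S)` is a connected component of the complement of `L`. -/
def IsGap (L : Set S1) (N S : S1) : Prop :=
  ∃ x ∈ Lᶜ, cIoo N S = connectedComponentIn Lᶜ x

/-- `f` is an admissible modification of the diffeomorphism `g`, which fixes `N` and `S`: it is a
smooth diffeomorphism that is equal to `g` on `[S, N]` and has exactly one fixed point
in `(N, S)`. -/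
def IsModificationOn (N S : S1) (g f : Equiv.Perm S1) : Prop :=
  IsSmoothDiffeo f ∧ (∀ x ∈ cIcc S N, f x = g x) ∧ ∃! P, P ∈ cIoo N S ∧ f P = P

end AreaPreserving

end

open AreaPreserving

/-! The prescribed density has to be extended from the points lying over `L` into the rectangles
whose sides are gaps of `L`. Let K and W be the lifts of `L` and of the density, W living on the
strip between the graph of a lift of h and its translate by one. For α, β in K, consider W(α, t)
W(s, β) / W(α, β) (`cornerForm`). It only involves W over K. Under the group the Jacobian factors at
α and β cancel, so it transforms like an invariant density at (s, t), and it equals W(s, t) as soon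
as α = s or β = t. The solution `interp` is a weighted mean of the four such expressions in which α
and β are ends of the gaps of s and t. It does not vanish, because W has constant sign on the strip
(`mul_pos_of_strip`).

The weights must be invariant, continuous off K, zero when a corner leaves the strip, and
concentrated on the nearer end close to the ends of a gap (`IsGapWeight`). The first coordinate is
moved by projective maps, and a truncated cross ratio of the ends of the gap, of s, and of t rounded
up to K is suitable (`crossWeight`): the two actions agree on K, so all four points move
projectively. The same weight serves for the second coordinate outside the orbit of (N, S), where
the two actions coincide. On that orbit the second action is not projective, and the weight is built
from W itself: with c < d the ends of the gap of t and x in K obtained from s, the ratio W(c, d)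
W(x, t) / (W(c, t) W(x, d)) is invariant because all Jacobians cancel (`ratioWeight`).

This ratio is 1 at t = d; it must also drop to 0 inside the gap, and here the unique fixed point P
of f intervenes. The multipliers of a hyperbolic map at N and S are μ and its inverse, with μ ≠ 1,
so the displacement of f has the same sign on both sides of P and f has derivative 1 at P. The
points (N, P) and (S, P) are thus fixed with Jacobian different from 1 and cannot lie in M_h, which
forces h = P on (N, S). Moreover W(N, t) is multiplied by a factor close to μ under each iterate
near P, and it blows up as t decreases to P (`tendsto_atTop_of_expanding`, `isSplitGap_of_fixed`);
hence the ratio tends to 0. Equivariance transports this to every gap of the orbit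
(`IsSplitGap.of_map`). -/

noncomputable section

namespace AreaPreserving

/-! ### Gaps of a periodic closed set without isolated points -/

/-- A non-empty closed subset of `ℝ`, invariant by the unit translation, without isolated
points. -/
structure IsPerfectPeriodic (K : Set ℝ) : Prop where
  closed : IsClosed K
  add_one : ∀ z, z + 1 ∈ K ↔ z ∈ K
  nonempty : K.Nonempty
  acc : ∀ z ∈ K, ∀ ε > 0, ∃ w ∈ K, w ≠ z ∧ |w - z| < ε

/-- `z` is a limit from the left of points of `K`. -/
def LAcc (K : Set ℝ) (z : ℝ) : Prop := ∀ ε > 0, ∃ w ∈ K, z - ε < w ∧ w < z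

/-- `z` is a limit from the right of points of `K`. -/
def RAcc (K : Set ℝ) (z : ℝ) : Prop := ∀ ε > 0, ∃ w ∈ K, z < w ∧ w < z + ε

/-- The largest point of `K` to the left of `t`. -/
def gapLeft (K : Set ℝ) (t : ℝ) : ℝ := sSup (K ∩ Iic t)

/-- The smallest point of `K` to the right of `t`. -/
def gapRight (K : Set ℝ) (t : ℝ) : ℝ := sInf (K ∩ Ici t)

namespace IsPerfectPeriodic

variable {K : Set ℝ} (hK : IsPerfectPeriodic K)
include hK

theorem add_int (k : ℤ) (z : ℝ) : z + k ∈ K ↔ z ∈ K := by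
  induction k using Int.induction_on with
  | zero => simp
  | succ i ih => rw [← ih, ← hK.add_one (z + ((i : ℤ) : ℝ))]; push_cast; rw [add_assoc]
  | pred i ih => rw [← ih, ← hK.add_one (z + ((-(i : ℤ) - 1 : ℤ) : ℝ))]; push_cast; ring_nf

theorem sub_one (z : ℝ) : z - 1 ∈ K ↔ z ∈ K := by
  rw [← hK.add_one]; ring_nf

theorem exists_le (t : ℝ) : ∃ z ∈ K, z ≤ t := by
  obtain ⟨z, hz⟩ := hK.nonempty
  refine ⟨z + (⌊t - z⌋ : ℤ), (hK.add_int _ _).2 hz, ?_⟩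
  linarith [Int.floor_le (t - z)]

theorem exists_ge (t : ℝ) : ∃ z ∈ K, t ≤ z := by
  obtain ⟨z, hz⟩ := hK.nonempty
  refine ⟨z + (⌈t - z⌉ : ℤ), (hK.add_int _ _).2 hz, ?_⟩
  linarith [Int.le_ceil (t - z)]

theorem gapLeft_mem (t : ℝ) : gapLeft K t ∈ K := by
  obtain ⟨z, hz, hzt⟩ := hK.exists_le t
  exact ((hK.closed.inter isClosed_Iic).csSup_mem ⟨z, hz, hzt⟩ ⟨t, fun _ h => h.2⟩).1

theorem gapRight_mem (t : ℝ) : gapRight K t ∈ K := by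
  obtain ⟨z, hz, hzt⟩ := hK.exists_ge t
  exact ((hK.closed.inter isClosed_Ici).csInf_mem ⟨z, hz, hzt⟩ ⟨t, fun _ h => h.2⟩).1

theorem gapLeft_le (t : ℝ) : gapLeft K t ≤ t := by
  obtain ⟨z, hz, hzt⟩ := hK.exists_le t
  exact csSup_le ⟨z, hz, hzt⟩ fun _ h => h.2

theorem le_gapRight (t : ℝ) : t ≤ gapRight K t := by
  obtain ⟨z, hz, hzt⟩ := hK.exists_ge t
  exact le_csInf ⟨z, hz, hzt⟩ fun _ h => h.2

omit hK in
theorem le_gapLeft {t z : ℝ} (hz : z ∈ K) (h : z ≤ t) : z ≤ gapLeft K t :=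
  le_csSup ⟨t, fun _ h => h.2⟩ ⟨hz, h⟩

omit hK in
theorem gapRight_le {t z : ℝ} (hz : z ∈ K) (h : t ≤ z) : gapRight K t ≤ z :=
  csInf_le ⟨t, fun _ h => h.2⟩ ⟨hz, h⟩

theorem gapLeft_eq {t : ℝ} (h : t ∈ K) : gapLeft K t = t :=
  le_antisymm (hK.gapLeft_le t) (le_gapLeft h le_rfl)

theorem gapRight_eq {t : ℝ} (h : t ∈ K) : gapRight K t = t :=
  le_antisymm (gapRight_le h le_rfl) (hK.le_gapRight t)

theorem gapLeft_lt {t : ℝ} (h : t ∉ K) : gapLeft K t < t :=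
  lt_of_le_of_ne (hK.gapLeft_le t) fun e => h (e ▸ hK.gapLeft_mem t)

theorem lt_gapRight {t : ℝ} (h : t ∉ K) : t < gapRight K t :=
  lt_of_le_of_ne (hK.le_gapRight t) fun e => h (e ▸ hK.gapRight_mem t)

omit hK in
theorem notMem_of_mem_gap {t s : ℝ} (h1 : gapLeft K t < s) (h2 : s < gapRight K t) : s ∉ K := by
  intro hs
  rcases le_total s t with h | h
  · exact absurd (le_gapLeft hs h) (not_le.2 h1)
  · exact absurd (gapRight_le hs h) (not_le.2 h2)

theorem gapLeft_eq_of_mem {t s : ℝ} (h1 : gapLeft K t < s) (h2 : s < gapRight K t) :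
    gapLeft K s = gapLeft K t := by
  apply le_antisymm
  · by_contra! h
    exact notMem_of_mem_gap h ((hK.gapLeft_le s).trans_lt h2) (hK.gapLeft_mem s)
  · exact le_gapLeft (hK.gapLeft_mem t) h1.le

theorem gapRight_eq_of_mem {t s : ℝ} (h1 : gapLeft K t < s) (h2 : s < gapRight K t) :
    gapRight K s = gapRight K t := by
  apply le_antisymm
  · exact gapRight_le (hK.gapRight_mem t) h2.le
  · by_contra! h
    exact notMem_of_mem_gap (h1.trans_le (hK.le_gapRight s)) h (hK.gapRight_mem s)

theorem gapLeft_eq_of_Ioo {a b s : ℝ} (ha : a ∈ K) (h : ∀ x ∈ Ioo a b, x ∉ K)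
    (hs : s ∈ Ioo a b) : gapLeft K s = a := by
  apply le_antisymm
  · by_contra! h'
    exact h _ ⟨h', (hK.gapLeft_le s).trans_lt hs.2⟩ (hK.gapLeft_mem s)
  · exact le_gapLeft ha hs.1.le

theorem gapRight_eq_of_Ioo {a b s : ℝ} (hb : b ∈ K) (h : ∀ x ∈ Ioo a b, x ∉ K)
    (hs : s ∈ Ioo a b) : gapRight K s = b := by
  apply le_antisymm
  · exact gapRight_le hb hs.2.le
  · by_contra! h'
    exact h _ ⟨hs.1.trans_le (hK.le_gapRight s), h'⟩ (hK.gapRight_mem s)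

theorem eventually_gap {t : ℝ} (h : t ∉ K) :
    ∀ᶠ s in 𝓝 t, s ∉ K ∧ gapLeft K s = gapLeft K t ∧ gapRight K s = gapRight K t := by
  filter_upwards [Ioo_mem_nhds (hK.gapLeft_lt h) (hK.lt_gapRight h)] with s hs
  exact ⟨notMem_of_mem_gap hs.1 hs.2, hK.gapLeft_eq_of_mem hs.1 hs.2,
    hK.gapRight_eq_of_mem hs.1 hs.2⟩

/-- A gap of full length one would leave in `K` only the translates of a single isolated point. This
strict bound keeps the sines in the cross ratios positive and lets circle points determine real ones
inside a closed gap. -/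
theorem gapRight_lt (t : ℝ) : gapRight K t < gapLeft K t + 1 := by
  by_cases h : t ∈ K
  · rw [hK.gapLeft_eq h, hK.gapRight_eq h]; linarith
  have h1 : ∀ w ∈ K, gapLeft K t < w → gapRight K t ≤ w := by
    intro w hw hlt
    by_contra! h'
    exact notMem_of_mem_gap hlt h' hw
  obtain ⟨w, hw, hne, habs⟩ := hK.acc _ (hK.gapLeft_mem t) 1 one_pos
  rw [abs_lt] at habs
  rcases lt_or_gt_of_ne hne with h2 | h2
  · have := h1 _ ((hK.add_one w).2 hw) (by linarith)
    linarith
  · have := h1 _ hw h2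
    linarith

/-- The end of a gap is not isolated in `K` and has no neighbour on the side of the gap, so points
of `K` accumulate from the other side. -/
theorem lAcc_gapLeft {t : ℝ} (h : t ∉ K) : LAcc K (gapLeft K t) := by
  intro ε hε
  have hlr : 0 < gapRight K t - gapLeft K t := by
    linarith [hK.gapLeft_lt h, hK.lt_gapRight h]
  obtain ⟨w, hw, hne, habs⟩ := hK.acc _ (hK.gapLeft_mem t) _ (lt_min hε hlr)
  rw [abs_lt] at habs
  have h1 := min_le_left ε (gapRight K t - gapLeft K t)
  have h2 := min_le_right ε (gapRight K t - gapLeft K t)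
  refine ⟨w, hw, by linarith, ?_⟩
  by_contra! h3
  exact notMem_of_mem_gap (lt_of_le_of_ne h3 hne.symm) (by linarith) hw

theorem rAcc_gapRight {t : ℝ} (h : t ∉ K) : RAcc K (gapRight K t) := by
  intro ε hε
  have hlr : 0 < gapRight K t - gapLeft K t := by
    linarith [hK.gapLeft_lt h, hK.lt_gapRight h]
  obtain ⟨w, hw, hne, habs⟩ := hK.acc _ (hK.gapRight_mem t) _ (lt_min hε hlr)
  rw [abs_lt] at habs
  have h1 := min_le_left ε (gapRight K t - gapLeft K t)
  have h2 := min_le_right ε (gapRight K t - gapLeft K t)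
  refine ⟨w, hw, ?_, by linarith⟩
  by_contra! h3
  exact notMem_of_mem_gap (by linarith) (lt_of_le_of_ne h3 hne) hw

theorem lAcc_add_one {z : ℝ} : LAcc K (z + 1) ↔ LAcc K z := by
  constructor
  · intro h ε hε
    obtain ⟨w, hw, h1, h2⟩ := h ε hε
    exact ⟨w - 1, (hK.sub_one w).2 hw, by linarith, by linarith⟩
  · intro h ε hε
    obtain ⟨w, hw, h1, h2⟩ := h ε hε
    exact ⟨w + 1, (hK.add_one w).2 hw, by linarith, by linarith⟩

theorem rAcc_add_one {z : ℝ} : RAcc K (z + 1) ↔ RAcc K z := by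
  constructor
  · intro h ε hε
    obtain ⟨w, hw, h1, h2⟩ := h ε hε
    exact ⟨w - 1, (hK.sub_one w).2 hw, by linarith, by linarith⟩
  · intro h ε hε
    obtain ⟨w, hw, h1, h2⟩ := h ε hε
    exact ⟨w + 1, (hK.add_one w).2 hw, by linarith, by linarith⟩

/-- A point that is not a limit from the right is the left end of a gap. -/
theorem exists_gap_right {a : ℝ} (ha : a ∈ K) (h : ¬ RAcc K a) :
    LAcc K a ∧ ∃ b, b ∈ K ∧ a < b ∧ b < a + 1 ∧ (∀ x ∈ Ioo a b, x ∉ K) ∧ RAcc K b := by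
  simp only [RAcc, not_forall, not_exists, not_and, not_lt] at h
  obtain ⟨ε, hε, h⟩ := h
  have hs : a + ε / 2 ∉ K := fun h' => by
    have := h _ h' (by linarith); linarith
  have hl : gapLeft K (a + ε / 2) = a := by
    refine hK.gapLeft_eq_of_Ioo (b := a + ε) ha (fun x hx hxK => ?_) ⟨by linarith, by linarith⟩
    have := h _ hxK hx.1
    linarith [hx.2]
  have h1 := hK.lAcc_gapLeft hs
  have h2 := hK.rAcc_gapRight hs
  rw [hl] at h1
  have h3 := hK.gapRight_lt (a + ε / 2)
  have h4 := hK.lt_gapRight hs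
  refine ⟨h1, gapRight K (a + ε / 2), hK.gapRight_mem _, by linarith, by linarith, ?_, h2⟩
  intro x hx
  exact notMem_of_mem_gap (by rw [hl]; exact hx.1) hx.2

/-- A point that is not a limit from the left is the right end of a gap. -/
theorem exists_gap_left {b : ℝ} (hb : b ∈ K) (h : ¬ LAcc K b) :
    RAcc K b ∧ ∃ a, a ∈ K ∧ a < b ∧ b < a + 1 ∧ (∀ x ∈ Ioo a b, x ∉ K) ∧ LAcc K a := by
  simp only [LAcc, not_forall, not_exists, not_and, not_lt] at h
  obtain ⟨ε, hε, h⟩ := h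
  have hs : b - ε / 2 ∉ K := fun h' => by
    have := h _ h' (by linarith); linarith
  have hl : gapRight K (b - ε / 2) = b := by
    refine hK.gapRight_eq_of_Ioo (a := b - ε) hb (fun x hx hxK => ?_) ⟨by linarith, by linarith⟩
    have := h _ hxK hx.1
    linarith [hx.2]
  have h1 := hK.lAcc_gapLeft hs
  have h2 := hK.rAcc_gapRight hs
  rw [hl] at h2
  have h3 := hK.gapRight_lt (b - ε / 2)
  have h4 := hK.gapLeft_lt hs
  refine ⟨h2, gapLeft K (b - ε / 2), hK.gapLeft_mem _, by linarith, by linarith, ?_, h1⟩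
  intro x hx
  exact notMem_of_mem_gap hx.1 (by rw [hl]; exact hx.2)

theorem tendsto_gapRight {z : ℝ} (hz : RAcc K z) : Tendsto (gapRight K) (𝓝 z) (𝓝 z) := by
  rw [Metric.tendsto_nhds]
  intro ε hε
  obtain ⟨w, hw, h1, h2⟩ := hz ε hε
  filter_upwards [Ioo_mem_nhds (show z - ε < z by linarith) h1] with s hs
  have h3 := gapRight_le hw hs.2.le
  have h4 := hK.le_gapRight s
  rw [Real.dist_eq, abs_lt]
  constructor <;> linarith [hs.1]

theorem tendsto_gapLeft {z : ℝ} (hz : LAcc K z) : Tendsto (gapLeft K) (𝓝 z) (𝓝 z) := by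
  rw [Metric.tendsto_nhds]
  intro ε hε
  obtain ⟨w, hw, h1, h2⟩ := hz ε hε
  filter_upwards [Ioo_mem_nhds h2 (show z < z + ε by linarith)] with s hs
  have h3 := le_gapLeft hw hs.1.le
  have h4 := hK.gapLeft_le s
  rw [Real.dist_eq, abs_lt]
  constructor <;> linarith [hs.2]

theorem tendsto_gapRight_Iic {z : ℝ} (hz : z ∈ K) :
    Tendsto (gapRight K) (𝓝[≤] z) (𝓝 z) := by
  refine tendsto_of_tendsto_of_tendsto_of_le_of_le' (tendsto_id.mono_left nhdsWithin_le_nhds)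
    tendsto_const_nhds (Eventually.of_forall hK.le_gapRight) ?_
  filter_upwards [self_mem_nhdsWithin] with s hs using gapRight_le hz hs

theorem tendsto_gapLeft_Ici {z : ℝ} (hz : z ∈ K) :
    Tendsto (gapLeft K) (𝓝[≥] z) (𝓝 z) := by
  refine tendsto_of_tendsto_of_tendsto_of_le_of_le' tendsto_const_nhds
    (tendsto_id.mono_left nhdsWithin_le_nhds) ?_ (Eventually.of_forall hK.gapLeft_le)
  filter_upwards [self_mem_nhdsWithin] with s hs using le_gapLeft hz hs

theorem tendsto_gapRight_of_le {t t' : ℝ} (ht : t ∉ K) (h1 : gapLeft K t < t')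
    (h2 : t' ≤ gapRight K t) : Tendsto (gapRight K) (𝓝 t') (𝓝 (gapRight K t)) := by
  rcases h2.lt_or_eq with h | h
  · refine tendsto_const_nhds.congr' ?_
    filter_upwards [Ioo_mem_nhds h1 h] with s hs
    exact (hK.gapRight_eq_of_mem hs.1 hs.2).symm
  · rw [h]; exact hK.tendsto_gapRight (hK.rAcc_gapRight ht)

theorem gapLeft_map (F : ℝ ≃o ℝ) (hF : ∀ z, F z ∈ K ↔ z ∈ K) (t : ℝ) :
    gapLeft K (F t) = F (gapLeft K t) := by
  apply le_antisymm
  · rw [← F.symm_apply_le]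
    apply le_gapLeft
    · rw [← hF, F.apply_symm_apply]; exact hK.gapLeft_mem _
    · rw [F.symm_apply_le]; exact hK.gapLeft_le _
  · exact le_gapLeft ((hF _).2 (hK.gapLeft_mem t)) (F.monotone (hK.gapLeft_le t))

theorem gapRight_map (F : ℝ ≃o ℝ) (hF : ∀ z, F z ∈ K ↔ z ∈ K) (t : ℝ) :
    gapRight K (F t) = F (gapRight K t) := by
  apply le_antisymm
  · exact gapRight_le ((hF _).2 (hK.gapRight_mem t)) (F.monotone (hK.le_gapRight t))
  · rw [← F.le_symm_apply]
    apply gapRight_le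
    · rw [← hF, F.apply_symm_apply]; exact hK.gapRight_mem _
    · rw [F.le_symm_apply]; exact hK.le_gapRight _

end IsPerfectPeriodic

/-! ### Strips and weights -/

/-- The properties of the strip between a monotone map of degree one that is the identity on `K`
and its translate, that are symmetric under the exchange of the coordinates. -/
structure IsStrip (K : Set ℝ) (U : Set (ℝ × ℝ)) : Prop where
  isOpen : IsOpen U
  up : ∀ {s t s' t' : ℝ}, (s, t) ∈ U → s' ≤ s → t ≤ t' → t' < s' + 1 →
    (LAcc K s' ∨ RAcc K t') → (s', t') ∈ U
  down : ∀ {s t s' t' : ℝ}, (s, t) ∈ U → s ≤ s' → t' ≤ t → s' < t' →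
    (RAcc K s' ∨ LAcc K t') → (s', t') ∈ U
  lt : ∀ {s t z : ℝ}, (s, t) ∈ U → z ∈ K → z ≤ s → z < t
  lt_add : ∀ {s t z : ℝ}, (s, t) ∈ U → z ∈ K → s ≤ z → t < z + 1

/-- The strip with exchanged coordinates. -/
def swapStrip (U : Set (ℝ × ℝ)) : Set (ℝ × ℝ) := {q | (q.2 - 1, q.1) ∈ U}

/-- The exchange sends (s, t) to (t, s + 1), the shift keeping the second coordinate between the
first one and its translate over `K`. It interchanges `up` with `down` and `lt` with `lt_add`, so
that every statement about the first coordinate yields one about the second. -/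
theorem IsStrip.swap {K : Set ℝ} {U : Set (ℝ × ℝ)} (hK : IsPerfectPeriodic K) (hU : IsStrip K U) :
    IsStrip K (swapStrip U) where
  isOpen := hU.isOpen.preimage (by fun_prop : Continuous fun q : ℝ × ℝ => (q.2 - 1, q.1))
  up := by
    intro s t s' t' h h1 h2 h3 h4
    refine hU.down h (by linarith) h1 (by linarith) ?_
    rw [← hK.rAcc_add_one, sub_add_cancel]
    exact h4.symm
  down := by
    intro s t s' t' h h1 h2 h3 h4
    refine hU.up h (by linarith) h1 (by linarith) ?_
    rw [← hK.lAcc_add_one, sub_add_cancel]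
    exact h4.symm
  lt := by
    intro s t z h hz hzs
    by_contra! h'
    have := hU.lt_add h ((hK.sub_one z).2 hz) (by linarith)
    linarith
  lt_add := by
    intro s t z h hz hzs
    by_contra! h'
    have := hU.lt h hz (by linarith)
    linarith

/-- `φ` is, near each point over the gaps of the first coordinate, the weight of the right end of
the gap in an interpolation between the ends. The conditions only concern the gap of `p.1`. -/
structure IsGapWeight (K : Set ℝ) (U : Set (ℝ × ℝ)) (φ : ℝ × ℝ → ℝ) : Prop where
  nonneg : ∀ p, 0 ≤ φ p
  le_one : ∀ p, φ p ≤ 1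
  near_left : ∀ p ∈ U, p.1 ∈ K → ¬ RAcc K p.1 → ∀ᶠ q in 𝓝 p, p.1 < q.1 → φ q = 0
  near_right : ∀ p ∈ U, p.1 ∈ K → ¬ LAcc K p.1 → ∀ᶠ q in 𝓝 p, q.1 < p.1 → φ q = 1
  below : ∀ p ∈ U, p.1 ∉ K → p.2 ≤ gapRight K p.1 → ∀ᶠ q in 𝓝 p, φ q = 0
  above : ∀ p ∈ U, p.1 ∉ K → gapLeft K p.1 + 1 ≤ p.2 → ∀ᶠ q in 𝓝 p, φ q = 1
  continuousAt : ∀ p ∈ U, p.1 ∉ K → p.2 ∉ K → ContinuousAt φ p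

/-- A continuous function equal to `0` for `x ≤ 1 / 3` and to `1` for `x ≥ 2 / 3`. -/
def cutoff (x : ℝ) : ℝ := max 0 (min 1 (3 * x - 1))

theorem continuous_cutoff : Continuous cutoff := by unfold cutoff; fun_prop

theorem cutoff_nonneg (x : ℝ) : 0 ≤ cutoff x := le_max_left _ _

theorem cutoff_le_one (x : ℝ) : cutoff x ≤ 1 := max_le zero_le_one (min_le_left _ _)

theorem cutoff_eq_zero {x : ℝ} (h : x ≤ 1 / 3) : cutoff x = 0 :=
  max_eq_left ((min_le_right _ _).trans (by linarith))

theorem cutoff_eq_one {x : ℝ} (h : 2 / 3 ≤ x) : cutoff x = 1 := by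
  unfold cutoff
  rw [min_eq_left (by linarith)]
  norm_num

/-- The function `sin (π x)`. -/
def sinPi (x : ℝ) : ℝ := Real.sin (Real.pi * x)

theorem continuous_sinPi : Continuous sinPi := by unfold sinPi; fun_prop

theorem sinPi_pos {x : ℝ} (h0 : 0 < x) (h1 : x < 1) : 0 < sinPi x :=
  Real.sin_pos_of_pos_of_lt_pi (mul_pos Real.pi_pos h0) (by nlinarith [Real.pi_pos])

@[simp] theorem sinPi_zero : sinPi 0 = 0 := by simp [sinPi]

theorem sinPi_one_sub (x : ℝ) : sinPi (1 - x) = sinPi x := by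
  unfold sinPi
  rw [mul_sub, mul_one, Real.sin_pi_sub]

/-- A cross ratio of `a`, `b`, `s`, `y` on the projective line. -/
def crossRatio (a b s y : ℝ) : ℝ :=
  (sinPi (s - a) * sinPi (y - b)) / (sinPi (y - s) * sinPi (b - a))

theorem continuousAt_crossRatio {a b s y : ℝ} (hab : 0 < b - a) (hab' : b - a < 1)
    (h : 0 < y - s) (h' : y - s < 1) :
    ContinuousAt (fun q : ℝ × ℝ => crossRatio a b q.1 q.2) (s, y) := by
  unfold crossRatio
  have h1 : sinPi (y - s) * sinPi (b - a) ≠ 0 :=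
    (mul_pos (sinPi_pos h h') (sinPi_pos hab hab')).ne'
  have := continuous_sinPi
  exact ContinuousAt.div (by fun_prop) (by fun_prop) h1

/-- The position of `t`, rounded up to `K`, with respect to the gap of `s`. -/
def clampRight (K : Set ℝ) (q : ℝ × ℝ) : ℝ := min (gapRight K q.2) (gapLeft K q.1 + 1)

/-- The weight of the right end of the gap of the first coordinate, given by a cross ratio. -/
def crossWeight (K : Set ℝ) (q : ℝ × ℝ) : ℝ :=
  cutoff (crossRatio (gapLeft K q.1) (gapRight K q.1) q.1 (clampRight K q))

theorem IsPerfectPeriodic.tendsto_min_gapRight {K : Set ℝ} (hK : IsPerfectPeriodic K)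
    {a s₀ t₀ : ℝ} (h : a ≤ t₀) :
    Tendsto (fun q : ℝ × ℝ => min (gapRight K q.2) a) (𝓝 (s₀, t₀)) (𝓝 a) := by
  have h4 := (continuous_snd.tendsto (s₀, t₀)).min (tendsto_const_nhds (x := a))
  rw [min_eq_right h] at h4
  exact tendsto_of_tendsto_of_tendsto_of_le_of_le h4 tendsto_const_nhds
    (fun q => min_le_min_right _ (hK.le_gapRight _)) (fun q => min_le_right _ _)

/-- Over a gap (a, b), the rounded position y of t lies in [b, a + 1]. The cross ratio is 0 for s =
a or y = b, and 1 for s = b or y = a + 1; the cutoff turns these values into values on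
neighbourhoods. The indeterminate positions s = a, y = a + 1 and s = y = b are kept away by the
strip. Rounding makes y locally constant when t is off `K`. -/
theorem isGapWeight_crossWeight {K : Set ℝ} {U : Set (ℝ × ℝ)} (hK : IsPerfectPeriodic K)
    (hU : IsStrip K U) : IsGapWeight K U (crossWeight K) where
  nonneg _ := cutoff_nonneg _
  le_one _ := cutoff_le_one _
  near_left := by
    rintro ⟨a, t₀⟩ hp ha hacc
    simp only at ha hacc ⊢
    obtain ⟨hl, b, hb, hab, hab1, hgap, hbacc⟩ := hK.exists_gap_right ha hacc
    have h1 : a < t₀ := hU.lt hp ha le_rfl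
    have h2 : t₀ < a + 1 := hU.lt_add hp ha le_rfl
    -- The point `w + 1` of `K` lies between `t₀` and `a + 1`: it bounds the rounding of every `t`
    -- near `t₀`, so `y` stays in a compact interval on which the denominator does not vanish at `s
    -- = a`.
    obtain ⟨w, hw, hw1, hw2⟩ := hl (a + 1 - t₀) (by linarith)
    have key : ∀ᶠ s in 𝓝 a, ∀ y ∈ Icc b (w + 1), crossRatio a b s y < 1 / 3 := by
      apply isCompact_Icc.eventually_forall_of_forall_eventually
      intro y hy
      have hc := continuousAt_crossRatio (a := a) (b := b) (s := a) (y := y) (by linarith)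
        (by linarith) (by linarith [hy.1]) (by linarith [hy.2])
      refine hc.eventually_lt_const ?_
      simp [crossRatio]
    rw [nhds_prod_eq]
    filter_upwards [prod_mem_prod key (Ioo_mem_nhds h1 (by linarith : t₀ < w + 1)),
      prod_mem_prod (Iio_mem_nhds hab) univ_mem] with ⟨s, t⟩ hq hq' has
    have hs : s ∈ Ioo a b := ⟨has, hq'.1⟩
    have ht : t ∈ Ioo a (w + 1) := hq.2
    unfold crossWeight clampRight
    simp only
    rw [hK.gapLeft_eq_of_Ioo ha hgap hs, hK.gapRight_eq_of_Ioo hb hgap hs]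
    refine cutoff_eq_zero (hq.1 _ ⟨le_min ?_ hab1.le, ?_⟩).le
    · by_contra! h
      exact hgap _ ⟨ht.1.trans_le (hK.le_gapRight t), h⟩ (hK.gapRight_mem t)
    · exact (min_le_left _ _).trans (IsPerfectPeriodic.gapRight_le ((hK.add_one w).2 hw) ht.2.le)
  near_right := by
    rintro ⟨b, t₀⟩ hp hb hacc
    simp only at hb hacc ⊢
    obtain ⟨hr, a, ha, hab, hab1, hgap, haacc⟩ := hK.exists_gap_left hb hacc
    have h1 : b < t₀ := hU.lt hp hb le_rfl
    -- The lower bound `m > b` keeps `y` away from `s = b`, where the denominator would vanish.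
    obtain ⟨m, hbm, hm⟩ := exists_between (lt_min h1 hab1)
    rw [lt_min_iff] at hm
    have key : ∀ᶠ s in 𝓝 b, ∀ y ∈ Icc m (a + 1), 2 / 3 < crossRatio a b s y := by
      apply isCompact_Icc.eventually_forall_of_forall_eventually
      intro y hy
      have hc := continuousAt_crossRatio (a := a) (b := b) (s := b) (y := y) (by linarith)
        (by linarith) (by linarith [hy.1]) (by linarith [hy.2])
      refine hc.eventually_const_lt ?_
      have h3 : 0 < sinPi (b - a) := sinPi_pos (by linarith) (by linarith)
      have h4 : 0 < sinPi (y - b) := sinPi_pos (by linarith [hy.1]) (by linarith [hy.2])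
      simp only [crossRatio]
      rw [mul_comm, div_self (mul_pos h4 h3).ne']
      norm_num
    rw [nhds_prod_eq]
    filter_upwards [prod_mem_prod key (Ioi_mem_nhds hm.1),
      prod_mem_prod (Ioi_mem_nhds hab) univ_mem] with ⟨s, t⟩ hq hq' has
    have hs : s ∈ Ioo a b := ⟨hq'.1, has⟩
    have ht : m < t := hq.2
    unfold crossWeight clampRight
    simp only
    rw [hK.gapLeft_eq_of_Ioo ha hgap hs, hK.gapRight_eq_of_Ioo hb hgap hs]
    exact cutoff_eq_one (hq.1 _ ⟨le_min (ht.le.trans (hK.le_gapRight t)) hm.2.le,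
      min_le_right _ _⟩).le
  below := by
    rintro ⟨s₀, t₀⟩ hp hs hle
    simp only at hs hle
    have h0 : gapLeft K s₀ < t₀ := hU.lt hp (hK.gapLeft_mem _) (hK.gapLeft_le _)
    have h1 := hK.gapLeft_lt hs
    have h2 := hK.lt_gapRight hs
    have h3 := hK.gapRight_lt s₀
    have hr := hK.tendsto_gapRight_of_le hs h0 hle
    have hy : Tendsto (fun q : ℝ × ℝ => min (gapRight K q.2) (gapLeft K s₀ + 1)) (𝓝 (s₀, t₀))
        (𝓝 (gapRight K s₀)) := by
      have := (hr.comp (continuous_snd.tendsto (s₀, t₀))).min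
        (tendsto_const_nhds (x := gapLeft K s₀ + 1))
      rwa [min_eq_left h3.le] at this
    have hc := (continuousAt_crossRatio (a := gapLeft K s₀) (b := gapRight K s₀) (s := s₀)
      (y := gapRight K s₀) (by linarith) (by linarith) (by linarith) (by linarith)).tendsto.comp
      ((continuous_fst.tendsto (s₀, t₀)).prodMk_nhds hy)
    have h5 := hc.eventually_lt_const (u := 1 / 3) (by simp [crossRatio])
    filter_upwards [h5, (continuous_fst.tendsto (s₀, t₀)).eventually (hK.eventually_gap hs)]
      with q hq hq'
    unfold crossWeight clampRight
    rw [hq'.2.1, hq'.2.2]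
    exact cutoff_eq_zero hq.le
  above := by
    rintro ⟨s₀, t₀⟩ hp hs hle
    simp only at hs hle
    have h1 := hK.gapLeft_lt hs
    have h2 := hK.lt_gapRight hs
    have h3 := hK.gapRight_lt s₀
    have hy := hK.tendsto_min_gapRight (s₀ := s₀) hle
    have hc := (continuousAt_crossRatio (a := gapLeft K s₀) (b := gapRight K s₀) (s := s₀)
      (y := gapLeft K s₀ + 1) (by linarith) (by linarith) (by linarith)
      (by linarith)).tendsto.comp ((continuous_fst.tendsto (s₀, t₀)).prodMk_nhds hy)
    have h5 := hc.eventually_const_lt (u := 2 / 3) (by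
      have e1 : sinPi (gapLeft K s₀ + 1 - gapRight K s₀) = sinPi (gapRight K s₀ - gapLeft K s₀) := by
        rw [← sinPi_one_sub]; congr 1; ring
      have e2 : sinPi (gapLeft K s₀ + 1 - s₀) = sinPi (s₀ - gapLeft K s₀) := by
        rw [← sinPi_one_sub]; congr 1; ring
      have h6 : 0 < sinPi (gapRight K s₀ - gapLeft K s₀) := sinPi_pos (by linarith) (by linarith)
      have h7 : 0 < sinPi (s₀ - gapLeft K s₀) := sinPi_pos (by linarith) (by linarith)
      simp only [crossRatio, e1, e2]
      rw [div_self (mul_pos h7 h6).ne']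
      norm_num)
    filter_upwards [h5, (continuous_fst.tendsto (s₀, t₀)).eventually (hK.eventually_gap hs)]
      with q hq hq'
    unfold crossWeight clampRight
    rw [hq'.2.1, hq'.2.2]
    exact cutoff_eq_one hq.le
  continuousAt := by
    rintro ⟨s₀, t₀⟩ hp hs ht
    simp only at hs ht
    have h1 := hK.gapLeft_lt hs
    have h2 := hK.lt_gapRight hs
    have h3 := hK.gapRight_lt s₀
    have h4 : gapLeft K s₀ < t₀ := hU.lt hp (hK.gapLeft_mem _) (hK.gapLeft_le _)
    have h5 : gapRight K s₀ ≤ gapRight K t₀ := by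
      by_contra! h
      exact IsPerfectPeriodic.notMem_of_mem_gap (h4.trans_le (hK.le_gapRight _)) h (hK.gapRight_mem _)
    have h6 : gapRight K s₀ ≤ clampRight K (s₀, t₀) := le_min h5 h3.le
    have h7 : clampRight K (s₀, t₀) ≤ gapLeft K s₀ + 1 := min_le_right _ _
    have hc : ContinuousAt (fun q : ℝ × ℝ => cutoff (crossRatio (gapLeft K s₀) (gapRight K s₀) q.1
        (clampRight K (s₀, t₀)))) (s₀, t₀) := by
      refine continuous_cutoff.continuousAt.comp ?_
      have := continuousAt_crossRatio (a := gapLeft K s₀) (b := gapRight K s₀) (s := s₀)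
        (y := clampRight K (s₀, t₀)) (by linarith) (by linarith) (by linarith) (by linarith)
      exact ContinuousAt.comp (x := (s₀, t₀))
        (f := fun q : ℝ × ℝ => (q.1, clampRight K (s₀, t₀))) this (by fun_prop)
    refine hc.congr ?_
    filter_upwards [(continuous_fst.tendsto (s₀, t₀)).eventually (hK.eventually_gap hs),
      (continuous_snd.tendsto (s₀, t₀)).eventually (hK.eventually_gap ht)] with q hq hq'
    unfold crossWeight clampRight
    rw [hq.2.1, hq.2.2, hq'.2.2]

/-! ### Interpolation of a density between the ends of the gaps -/

/-- The right or left end of the gap of `t`. -/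
def gapEnd (K : Set ℝ) : Bool → ℝ → ℝ
  | true => gapRight K
  | false => gapLeft K

/-- The weight of an end, when `w` is the weight of the right end. -/
def endWeight : Bool → ℝ → ℝ
  | true, w => w
  | false, w => 1 - w

theorem gapEnd_mem {K : Set ℝ} (hK : IsPerfectPeriodic K) (b : Bool) (t : ℝ) :
    gapEnd K b t ∈ K := by
  cases b
  · exact hK.gapLeft_mem t
  · exact hK.gapRight_mem t

theorem gapEnd_eventuallyEq {K : Set ℝ} (hK : IsPerfectPeriodic K) (b : Bool) {t : ℝ}
    (ht : t ∉ K) : ∀ᶠ s in 𝓝 t, gapEnd K b s = gapEnd K b t := by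
  filter_upwards [hK.eventually_gap ht] with s hs
  cases b
  · exact hs.2.1
  · exact hs.2.2

theorem continuous_endWeight (b : Bool) : Continuous (endWeight b) := by
  cases b <;> unfold endWeight <;> fun_prop

/-- If `p.1` is in `K`, an end of the gap of `q.1` can jump only on a side where a gap starts, and
the weight of the far end is zero there. If `p.1` is off `K`, the ends are locally constant, and the
side point leaves the strip only in the situations where `below` or `above` kills the weight. -/
theorem IsGapWeight.anchor {K : Set ℝ} {U : Set (ℝ × ℝ)} {φ : ℝ × ℝ → ℝ}
    (hK : IsPerfectPeriodic K) (hU : IsStrip K U) (hφ : IsGapWeight K U φ) {p : ℝ × ℝ}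
    (hp : p ∈ U) (b : Bool) :
    (∀ᶠ q in 𝓝 p, endWeight b (φ q) = 0) ∨
      ∃ α, (α, p.2) ∈ U ∧ (p.1 ∈ K → α = p.1) ∧ (p.1 ∉ K → α = gapEnd K b p.1) ∧
        Tendsto (fun q : ℝ × ℝ => gapEnd K b q.1) (𝓝 p ⊓ 𝓟 {q | endWeight b (φ q) ≠ 0})
          (𝓝 α) := by
  have hfst : Tendsto Prod.fst (𝓝 p) (𝓝 p.1) := continuous_fst.tendsto p
  by_cases hs : p.1 ∈ K
  · refine Or.inr ⟨p.1, hp, fun _ => rfl, fun h => absurd hs h, ?_⟩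
    cases b
    · by_cases hacc : LAcc K p.1
      · exact ((hK.tendsto_gapLeft hacc).comp hfst).mono_left inf_le_left
      · refine (hK.tendsto_gapLeft_Ici hs).comp (tendsto_nhdsWithin_iff.2
          ⟨hfst.mono_left inf_le_left, ?_⟩)
        rw [eventually_inf_principal]
        filter_upwards [hφ.near_right p hp hs hacc] with q hq hne
        by_contra h
        exact hne (by simp [endWeight, hq (not_le.1 h)])
    · by_cases hacc : RAcc K p.1
      · exact ((hK.tendsto_gapRight hacc).comp hfst).mono_left inf_le_left
      · refine (hK.tendsto_gapRight_Iic hs).comp (tendsto_nhdsWithin_iff.2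
          ⟨hfst.mono_left inf_le_left, ?_⟩)
        rw [eventually_inf_principal]
        filter_upwards [hφ.near_left p hp hs hacc] with q hq hne
        by_contra h
        exact hne (by simp [endWeight, hq (not_le.1 h)])
  · have hconst : Tendsto (fun q : ℝ × ℝ => gapEnd K b q.1)
        (𝓝 p ⊓ 𝓟 {q | endWeight b (φ q) ≠ 0}) (𝓝 (gapEnd K b p.1)) := by
      refine (tendsto_const_nhds.congr' ?_).mono_left inf_le_left
      filter_upwards [hfst.eventually (gapEnd_eventuallyEq hK b hs)] with q hq using hq.symm
    cases b
    · by_cases hle : gapLeft K p.1 + 1 ≤ p.2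
      · left
        filter_upwards [hφ.above p hp hs hle] with q hq
        simp [endWeight, hq]
      · refine Or.inr ⟨_, ?_, fun h => absurd h hs, fun _ => rfl, hconst⟩
        exact hU.up (s := p.1) (t := p.2) hp (hK.gapLeft_le _) le_rfl (not_le.1 hle)
          (Or.inl (hK.lAcc_gapLeft hs))
    · by_cases hle : p.2 ≤ gapRight K p.1
      · left
        filter_upwards [hφ.below p hp hs hle] with q hq
        simp [endWeight, hq]
      · refine Or.inr ⟨_, ?_, fun h => absurd h hs, fun _ => rfl, hconst⟩
        exact hU.down (s := p.1) (t := p.2) hp (hK.le_gapRight _) le_rfl (not_le.1 hle)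
          (Or.inl (hK.rAcc_gapRight hs))

theorem IsGapWeight.anchor_swap {K : Set ℝ} {U : Set (ℝ × ℝ)} {θ : ℝ × ℝ → ℝ}
    (hK : IsPerfectPeriodic K) (hU : IsStrip K U) (hθ : IsGapWeight K (swapStrip U) θ)
    {p : ℝ × ℝ} (hp : p ∈ U) (b : Bool) :
    (∀ᶠ q in 𝓝 p, endWeight b (θ (q.2, q.1 + 1)) = 0) ∨
      ∃ β, (p.1, β) ∈ U ∧ (p.2 ∈ K → β = p.2) ∧ (p.2 ∉ K → β = gapEnd K b p.2) ∧
        Tendsto (fun q : ℝ × ℝ => gapEnd K b q.2)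
          (𝓝 p ⊓ 𝓟 {q | endWeight b (θ (q.2, q.1 + 1)) ≠ 0}) (𝓝 β) := by
  have hcont : Tendsto (fun q : ℝ × ℝ => (q.2, q.1 + 1)) (𝓝 p) (𝓝 (p.2, p.1 + 1)) :=
    (by fun_prop : Continuous fun q : ℝ × ℝ => (q.2, q.1 + 1)).tendsto p
  have hp' : (p.2, p.1 + 1) ∈ swapStrip U := by simpa [swapStrip] using hp
  rcases hθ.anchor hK (hU.swap hK) hp' b with h | ⟨β, h1, h2, h3, h4⟩
  · exact Or.inl (hcont.eventually h)
  · refine Or.inr ⟨β, by simpa [swapStrip] using h1, h2, h3, ?_⟩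
    refine h4.comp (tendsto_inf.2 ⟨hcont.mono_left inf_le_left, ?_⟩)
    rw [tendsto_principal, eventually_inf_principal]
    exact Eventually.of_forall fun q hq => hq

/-- The corner is reached from one of the two side points by moving up or down; accumulation of `K`
outside the gaps gives the side condition, and what remains is a strict inequality between the new
coordinates. -/
theorem IsStrip.corner_mem {K : Set ℝ} {U : Set (ℝ × ℝ)} (hK : IsPerfectPeriodic K)
    (hU : IsStrip K U) {s t : ℝ} (hs : s ∉ K) (ht : t ∉ K) {b b' : Bool}
    (hα : (gapEnd K b s, t) ∈ U) (hβ : (s, gapEnd K b' t) ∈ U) :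
    (gapEnd K b s, gapEnd K b' t) ∈ U := by
  have ha := hK.lAcc_gapLeft hs
  have hb := hK.rAcc_gapRight hs
  have hs1 := hK.gapLeft_lt hs
  have hs2 := hK.lt_gapRight hs
  have ht1 := hK.gapLeft_lt ht
  have ht2 := hK.lt_gapRight ht
  cases b <;> cases b' <;> simp only [gapEnd] at hα hβ ⊢
  · refine hU.up hβ hs1.le le_rfl ?_ (Or.inl ha)
    exact ht1.trans (hU.lt_add hα (hK.gapLeft_mem s) le_rfl)
  · refine hU.up hα le_rfl ht2.le ?_ (Or.inl ha)
    have h1 : t < gapLeft K s + 1 := hU.lt_add hα (hK.gapLeft_mem s) le_rfl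
    -- Equality would make the left end of the gap of `s`, translated by one, the right end of the
    -- gap of `t`; points of `K` would then accumulate on it from the right, inside the gap of `s`.
    -- The other mixed corner is symmetric.
    refine lt_of_le_of_ne
      (IsPerfectPeriodic.gapRight_le ((hK.add_one _).2 (hK.gapLeft_mem s)) h1.le) fun h => ?_
    have h2 := hK.rAcc_gapRight ht
    rw [h, hK.rAcc_add_one] at h2
    obtain ⟨w, hw, hw1, hw2⟩ := h2 (gapRight K s - gapLeft K s) (by linarith)
    exact IsPerfectPeriodic.notMem_of_mem_gap (t := s) hw1 (by linarith) hw
  · refine hU.down hα le_rfl ht1.le ?_ (Or.inl hb)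
    have h1 : gapRight K s < t := hU.lt hα (hK.gapRight_mem s) le_rfl
    refine lt_of_le_of_ne (IsPerfectPeriodic.le_gapLeft (hK.gapRight_mem s) h1.le) fun h => ?_
    have h2 := hK.lAcc_gapLeft ht
    rw [← h] at h2
    obtain ⟨w, hw, hw1, hw2⟩ := h2 (gapRight K s - gapLeft K s) (by linarith)
    exact IsPerfectPeriodic.notMem_of_mem_gap (t := s) (by linarith) hw2 hw
  · refine hU.down hβ hs2.le le_rfl ?_ (Or.inl hb)
    exact (hU.lt hα (hK.gapRight_mem s) le_rfl).trans ht2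

/-- The density at `p` deduced from the values of the density `W` at `(α, p.2)`, `(p.1, β)` and
`(α, β)`. -/
def cornerForm (W : ℝ × ℝ → ℝ) (p : ℝ × ℝ) (α β : ℝ) : ℝ := W (α, p.2) * W (p.1, β) / W (α, β)

/-- The total weight of a corner of the rectangle containing `p`. -/
def cornerWeight (φ θ : ℝ × ℝ → ℝ) (i : Bool × Bool) (p : ℝ × ℝ) : ℝ :=
  endWeight i.1 (φ p) * endWeight i.2 (θ (p.2, p.1 + 1))

/-- The interpolation of `W` between the sides of the rectangles whose sides are gaps. -/
def interp (K : Set ℝ) (W φ θ : ℝ × ℝ → ℝ) (p : ℝ × ℝ) : ℝ :=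
  ∑ i : Bool × Bool, cornerWeight φ θ i p *
    cornerForm W p (gapEnd K i.1 p.1) (gapEnd K i.2 p.2)

/-- In a convex combination a term of weight zero does not count, even if its value is meaningless
or unbounded. It is enough that each term approaches the common limit along the points where its
weight is nonzero. -/
theorem tendsto_sum_weights {ι X : Type*} [Fintype ι] {l : Filter X} {w F : ι → X → ℝ} {c : ℝ}
    (hw : ∀ i x, 0 ≤ w i x) (hsum : ∀ x, ∑ i, w i x = 1)
    (hF : ∀ i, Tendsto (F i) (l ⊓ 𝓟 {x | w i x ≠ 0}) (𝓝 c)) :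
    Tendsto (fun x => ∑ i, w i x * F i x) l (𝓝 c) := by
  rw [Metric.tendsto_nhds]
  intro ε hε
  have h1 : ∀ᶠ x in l, ∀ i, w i x ≠ 0 → |F i x - c| < ε / 2 := by
    rw [eventually_all]
    intro i
    have := (Metric.tendsto_nhds.1 (hF i)) (ε / 2) (by linarith)
    rw [eventually_inf_principal] at this
    exact this
  filter_upwards [h1] with x hx
  have h2 : ∑ i, w i x * F i x - c = ∑ i, w i x * (F i x - c) := by
    simp only [mul_sub, Finset.sum_sub_distrib, ← Finset.sum_mul, hsum, one_mul]
  rw [Real.dist_eq, h2]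
  calc |∑ i, w i x * (F i x - c)| ≤ ∑ i, |w i x * (F i x - c)| := Finset.abs_sum_le_sum_abs _ _
    _ ≤ ∑ i, w i x * (ε / 2) := by
        refine Finset.sum_le_sum fun i _ => ?_
        rw [abs_mul, abs_of_nonneg (hw i x)]
        by_cases h : w i x = 0
        · simp [h]
        · exact mul_le_mul_of_nonneg_left (hx i h).le (hw i x)
    _ = ε / 2 := by rw [← Finset.sum_mul, hsum, one_mul]
    _ < ε := by linarith

theorem endWeight_nonneg {w : ℝ} (h0 : 0 ≤ w) (h1 : w ≤ 1) (b : Bool) : 0 ≤ endWeight b w := by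
  cases b <;> simp [endWeight, h0, h1]

theorem sum_cornerWeight (φ θ : ℝ × ℝ → ℝ) (p : ℝ × ℝ) :
    ∑ i, cornerWeight φ θ i p = 1 := by
  rw [Fintype.sum_prod_type]
  simp only [cornerWeight, Fintype.sum_bool, endWeight]
  ring

theorem continuousAt_cornerForm {U : Set (ℝ × ℝ)} (hUo : IsOpen U) {W : ℝ × ℝ → ℝ}
    (hW : ContinuousOn W U) (hW0 : ∀ p ∈ U, W p ≠ 0) {p : ℝ × ℝ} {α β : ℝ} (h1 : (α, p.2) ∈ U)
    (h2 : (p.1, β) ∈ U) (h3 : (α, β) ∈ U) :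
    ContinuousAt (fun z : (ℝ × ℝ) × ℝ × ℝ => cornerForm W z.1 z.2.1 z.2.2) (p, α, β) := by
  have hc : ∀ q ∈ U, ContinuousAt W q := fun q hq => hW.continuousAt (hUo.mem_nhds hq)
  unfold cornerForm
  refine ContinuousAt.div (ContinuousAt.mul ?_ ?_) ?_ (hW0 _ h3)
  · exact ContinuousAt.comp (x := (p, α, β))
      (f := fun z : (ℝ × ℝ) × ℝ × ℝ => (z.2.1, z.1.2)) (hc _ h1) (by fun_prop)
  · exact ContinuousAt.comp (x := (p, α, β))
      (f := fun z : (ℝ × ℝ) × ℝ × ℝ => (z.1.1, z.2.2)) (hc _ h2) (by fun_prop)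
  · exact ContinuousAt.comp (x := (p, α, β))
      (f := fun z : (ℝ × ℝ) × ℝ × ℝ => (z.2.1, z.2.2)) (hc _ h3) (by fun_prop)

section Interp

variable {K : Set ℝ} {U : Set (ℝ × ℝ)} {W φ θ : ℝ × ℝ → ℝ}

theorem cornerWeight_nonneg (hφ : IsGapWeight K U φ) (hθ : IsGapWeight K (swapStrip U) θ)
    (i : Bool × Bool) (p : ℝ × ℝ) : 0 ≤ cornerWeight φ θ i p :=
  mul_nonneg (endWeight_nonneg (hφ.nonneg _) (hφ.le_one _) _)
    (endWeight_nonneg (hθ.nonneg _) (hθ.le_one _) _)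

/-- Either a corner has no weight near `p`, or it has a limit position. -/
theorem corner_anchor (hK : IsPerfectPeriodic K) (hU : IsStrip K U) (hφ : IsGapWeight K U φ)
    (hθ : IsGapWeight K (swapStrip U) θ) {p : ℝ × ℝ} (hp : p ∈ U) (i : Bool × Bool) :
    (∀ᶠ q in 𝓝 p, cornerWeight φ θ i q = 0) ∨
      ∃ α β, (α, p.2) ∈ U ∧ (p.1, β) ∈ U ∧ (α, β) ∈ U ∧ (p.1 ∈ K → α = p.1) ∧
        (p.2 ∈ K → β = p.2) ∧
        Tendsto (fun q : ℝ × ℝ => (gapEnd K i.1 q.1, gapEnd K i.2 q.2))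
          (𝓝 p ⊓ 𝓟 {q | cornerWeight φ θ i q ≠ 0}) (𝓝 (α, β)) := by
  rcases hφ.anchor hK hU hp i.1 with h | ⟨α, hα1, hα2, hα3, hα4⟩
  · left
    filter_upwards [h] with q hq
    simp [cornerWeight, hq]
  rcases hθ.anchor_swap hK hU hp i.2 with h | ⟨β, hβ1, hβ2, hβ3, hβ4⟩
  · left
    filter_upwards [h] with q hq
    simp [cornerWeight, hq]
  refine Or.inr ⟨α, β, hα1, hβ1, ?_, hα2, hβ2, ?_⟩
  · by_cases hs : p.1 ∈ K
    · rw [hα2 hs]; exact hβ1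
    by_cases ht : p.2 ∈ K
    · rw [hβ2 ht]; exact hα1
    rw [hα3 hs] at hα1 ⊢
    rw [hβ3 ht] at hβ1 ⊢
    exact hU.corner_mem hK hs ht hα1 hβ1
  · refine (hα4.mono_left ?_).prodMk_nhds (hβ4.mono_left ?_)
    · refine inf_le_inf_left _ (principal_mono.2 fun q hq => left_ne_zero_of_mul hq)
    · refine inf_le_inf_left _ (principal_mono.2 fun q hq => right_ne_zero_of_mul hq)

/-- A nonzero weight excludes the first alternative of `corner_anchor`, and evaluating the limit
along the principal filter at `p` identifies the anchor with the actual corner. -/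
theorem corner_mem_of_weight_ne_zero (hK : IsPerfectPeriodic K) (hU : IsStrip K U)
    (hφ : IsGapWeight K U φ) (hθ : IsGapWeight K (swapStrip U) θ) {p : ℝ × ℝ} (hp : p ∈ U)
    {i : Bool × Bool} (hi : cornerWeight φ θ i p ≠ 0) :
    (gapEnd K i.1 p.1, p.2) ∈ U ∧ (p.1, gapEnd K i.2 p.2) ∈ U ∧
      (gapEnd K i.1 p.1, gapEnd K i.2 p.2) ∈ U := by
  rcases corner_anchor hK hU hφ hθ hp i with h | ⟨α, β, h1, h2, h3, -, -, h4⟩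
  · exact absurd h.self_of_nhds hi
  · have h5 : pure p ≤ 𝓝 p ⊓ 𝓟 {q | cornerWeight φ θ i q ≠ 0} :=
      le_inf (pure_le_nhds p) (by simpa using hi)
    have h6 := tendsto_nhds_unique (h4.mono_left h5) (tendsto_pure_nhds _ _)
    simp only [Prod.mk.injEq] at h6
    rw [← h6.1, ← h6.2]
    exact ⟨h1, h2, h3⟩

/-- If a coordinate of `p` is in `K`, each anchored corner shares it, so one factor of the numerator
of `cornerForm` cancels the denominator and what is left is `W p`. All terms with nonzero weight
therefore have the same limit, even where infinitely many gaps accumulate. -/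
theorem tendsto_interp (hK : IsPerfectPeriodic K) (hU : IsStrip K U) (hφ : IsGapWeight K U φ)
    (hθ : IsGapWeight K (swapStrip U) θ) (hW : ContinuousOn W U) (hW0 : ∀ p ∈ U, W p ≠ 0)
    {p : ℝ × ℝ} (hp : p ∈ U) (hpK : p.1 ∈ K ∨ p.2 ∈ K) :
    Tendsto (interp K W φ θ) (𝓝 p) (𝓝 (W p)) := by
  refine tendsto_sum_weights (cornerWeight_nonneg hφ hθ) (sum_cornerWeight φ θ) fun i => ?_
  rcases corner_anchor hK hU hφ hθ hp i with h | ⟨α, β, h1, h2, h3, hα, hβ, h4⟩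
  · have : 𝓝 p ⊓ 𝓟 {x | cornerWeight φ θ i x ≠ 0} = ⊥ := by
      rw [inf_principal_eq_bot]
      filter_upwards [h] with q hq
      simpa using hq
    rw [this]
    exact tendsto_bot
  · have h5 := (continuousAt_cornerForm hU.isOpen hW hW0 h1 h2 h3).tendsto.comp
      ((tendsto_id.mono_left inf_le_left).prodMk_nhds h4)
    have h6 : cornerForm W p α β = W p := by
      unfold cornerForm
      rcases hpK with h | h
      · rw [hα h]
        exact mul_div_cancel_right₀ _ (hW0 _ h2)
      · rw [hβ h, mul_comm]
        exact mul_div_cancel_right₀ _ (hW0 _ h1)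
    simp only [h6] at h5
    exact h5

theorem interp_eq (hK : IsPerfectPeriodic K) (hU : IsStrip K U) (hφ : IsGapWeight K U φ)
    (hθ : IsGapWeight K (swapStrip U) θ) (hW : ContinuousOn W U) (hW0 : ∀ p ∈ U, W p ≠ 0)
    {p : ℝ × ℝ} (hp : p ∈ U) (hpK : p.1 ∈ K ∨ p.2 ∈ K) : interp K W φ θ p = W p :=
  eq_of_tendsto_nhds (tendsto_interp hK hU hφ hθ hW hW0 hp hpK)

theorem continuousAt_interp (hK : IsPerfectPeriodic K) (hU : IsStrip K U)
    (hφ : IsGapWeight K U φ) (hθ : IsGapWeight K (swapStrip U) θ) (hW : ContinuousOn W U)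
    (hW0 : ∀ p ∈ U, W p ≠ 0) {p : ℝ × ℝ} (hp : p ∈ U) : ContinuousAt (interp K W φ θ) p := by
  by_cases hpK : p.1 ∈ K ∨ p.2 ∈ K
  · have := tendsto_interp hK hU hφ hθ hW hW0 hp hpK
    rwa [← interp_eq hK hU hφ hθ hW hW0 hp hpK] at this
  push Not at hpK
  obtain ⟨hs, ht⟩ := hpK
  refine tendsto_finsetSum _ fun i _ => ?_
  by_cases hi : ∀ᶠ q in 𝓝 p, cornerWeight φ θ i q = 0
  · refine ContinuousAt.congr (continuousAt_const (y := (0 : ℝ))) ?_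
    filter_upwards [hi] with q hq
    simp [hq]
  have hmem : (gapEnd K i.1 p.1, p.2) ∈ U ∧ (p.1, gapEnd K i.2 p.2) ∈ U := by
    constructor
    · rcases hφ.anchor hK hU hp i.1 with h | ⟨α, hα1, hα2, hα3, hα4⟩
      · refine absurd ?_ hi
        filter_upwards [h] with q hq
        simp [cornerWeight, hq]
      · rw [← hα3 hs]; exact hα1
    · rcases hθ.anchor_swap hK hU hp i.2 with h | ⟨β, hβ1, hβ2, hβ3, hβ4⟩
      · refine absurd ?_ hi
        filter_upwards [h] with q hq
        simp [cornerWeight, hq]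
      · rw [← hβ3 ht]; exact hβ1
  have h3 := hU.corner_mem hK (s := p.1) (t := p.2) hs ht hmem.1 hmem.2
  refine ContinuousAt.mul ?_ ?_
  · refine ContinuousAt.mul ?_ ?_
    · exact (continuous_endWeight _).continuousAt.comp (hφ.continuousAt p hp hs ht)
    · refine (continuous_endWeight _).continuousAt.comp ?_
      have := hθ.continuousAt (p.2, p.1 + 1) (by simpa [swapStrip] using hp) ht
        (by rwa [hK.add_one])
      exact ContinuousAt.comp (x := p) (f := fun q : ℝ × ℝ => (q.2, q.1 + 1)) this (by fun_prop)
  · have h5 := continuousAt_cornerForm hU.isOpen hW hW0 hmem.1 hmem.2 h3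
    have h6 : ContinuousAt (fun q : ℝ × ℝ => cornerForm W q (gapEnd K i.1 p.1)
        (gapEnd K i.2 p.2)) p :=
      ContinuousAt.comp (x := p)
        (f := fun q : ℝ × ℝ => (q, gapEnd K i.1 p.1, gapEnd K i.2 p.2)) h5 (by fun_prop)
    refine h6.congr ?_
    filter_upwards [(continuous_fst.tendsto p).eventually (gapEnd_eventuallyEq hK i.1 hs),
      (continuous_snd.tendsto p).eventually (gapEnd_eventuallyEq hK i.2 ht)] with q h7 h8
    rw [h7, h8]

/-- A corner of nonzero weight has its three values of `W` inside the strip, hence of one sign,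
which is also the sign of the corner form; the weights are nonnegative with sum one. -/
theorem interp_ne_zero (hK : IsPerfectPeriodic K) (hU : IsStrip K U)
    (hφ : IsGapWeight K U φ) (hθ : IsGapWeight K (swapStrip U) θ)
    (hsign : ∀ p ∈ U, ∀ q ∈ U, 0 < W p * W q) {p : ℝ × ℝ} (hp : p ∈ U) :
    interp K W φ θ p ≠ 0 := by
  have hpos : ∀ i, cornerWeight φ θ i p ≠ 0 →
      0 < cornerForm W p (gapEnd K i.1 p.1) (gapEnd K i.2 p.2) * W p := by
    intro i hi
    obtain ⟨h1, h2, h3⟩ := corner_mem_of_weight_ne_zero hK hU hφ hθ hp hi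
    have h4 := mul_pos (hsign _ h1 _ hp) (hsign _ h2 _ h3)
    have h5 := hsign _ h3 _ h3
    have h6 := div_pos h4 h5
    have h7 : W (gapEnd K i.1 p.1, gapEnd K i.2 p.2) ≠ 0 := fun h => by simp [h] at h5
    refine h6.trans_eq ?_
    unfold cornerForm
    field_simp
  have hterm : ∀ i, 0 ≤ cornerWeight φ θ i p *
      (cornerForm W p (gapEnd K i.1 p.1) (gapEnd K i.2 p.2) * W p) := by
    intro i
    by_cases hi : cornerWeight φ θ i p = 0
    · simp [hi]
    · exact mul_nonneg (cornerWeight_nonneg hφ hθ i p) (hpos i hi).le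
  obtain ⟨i, hi⟩ : ∃ i, cornerWeight φ θ i p ≠ 0 := by
    by_contra! h
    have := sum_cornerWeight φ θ p
    simp [h] at this
  have h7 : 0 < interp K W φ θ p * W p := by
    unfold interp
    rw [Finset.sum_mul]
    simp only [mul_assoc]
    refine Finset.sum_pos' (fun i _ => hterm i) ⟨i, Finset.mem_univ _, ?_⟩
    exact mul_pos (lt_of_le_of_ne (cornerWeight_nonneg hφ hθ i p) hi.symm) (hpos i hi)
  exact left_ne_zero_of_mul h7.ne'

/-- The interpolation inherits the invariance of `W` over `K`. -/
theorem interp_map (hK : IsPerfectPeriodic K) (hU : IsStrip K U)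
    (hφ : IsGapWeight K U φ) (hθ : IsGapWeight K (swapStrip U) θ) (hW0 : ∀ p ∈ U, W p ≠ 0)
    {F₁ F₂ d₁ d₂ : ℝ → ℝ} {s t : ℝ} (hp : (s, t) ∈ U) (hφF : φ (F₁ s, F₂ t) = φ (s, t))
    (hθF : θ (F₂ t, F₁ s + 1) = θ (t, s + 1))
    (h₁ : ∀ b, gapEnd K b (F₁ s) = F₁ (gapEnd K b s))
    (h₂ : ∀ b, gapEnd K b (F₂ t) = F₂ (gapEnd K b t))
    (hW : ∀ x y, (x, y) ∈ U → (x ∈ K ∨ y ∈ K) → W (F₁ x, F₂ y) * (d₁ x * d₂ y) = W (x, y)) :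
    interp K W φ θ (F₁ s, F₂ t) * (d₁ s * d₂ t) = interp K W φ θ (s, t) := by
  unfold interp
  rw [Finset.sum_mul]
  refine Finset.sum_congr rfl fun i _ => ?_
  have hw : cornerWeight φ θ i (F₁ s, F₂ t) = cornerWeight φ θ i (s, t) := by
    simp only [cornerWeight, hφF, hθF]
  rw [hw, mul_assoc]
  by_cases hi : cornerWeight φ θ i (s, t) = 0
  · simp [hi]
  congr 1
  obtain ⟨m1, m2, m3⟩ := corner_mem_of_weight_ne_zero hK hU hφ hθ hp hi
  simp only [h₁, h₂, cornerForm] at m1 m2 m3 ⊢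
  -- In the quotient of the three invariance relations the factors of `d₁` and `d₂` at the gap ends
  -- cancel, leaving `d₁ s * d₂ t`. That they are nonzero follows from the third relation, whose
  -- right side does not vanish.
  have e1 := hW _ _ m1 (Or.inl (gapEnd_mem hK _ _))
  have e2 := hW _ _ m2 (Or.inr (gapEnd_mem hK _ _))
  have e3 := hW _ _ m3 (Or.inl (gapEnd_mem hK _ _))
  have n3 := hW0 _ m3
  rw [← e1, ← e2, ← e3]
  rw [← e3] at n3
  have n4 := left_ne_zero_of_mul n3
  have n5 := left_ne_zero_of_mul (right_ne_zero_of_mul n3)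
  have n6 := right_ne_zero_of_mul (right_ne_zero_of_mul n3)
  field_simp

end Interp

/-! ### Lifts of circle maps -/

theorem coe_eq_coe_iff {s t : ℝ} : (s : S1) = (t : S1) ↔ ∃ k : ℤ, s = t + k := by
  rw [← sub_eq_zero, ← AddCircle.coe_sub, AddCircle.coe_eq_zero_iff]
  constructor
  · rintro ⟨k, hk⟩
    exact ⟨k, by simp at hk; linarith⟩
  · rintro ⟨k, hk⟩
    exact ⟨k, by simp [hk]⟩

theorem coe_add_intCast (t : ℝ) (k : ℤ) : ((t + k : ℝ) : S1) = (t : S1) :=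
  coe_eq_coe_iff.2 ⟨k, rfl⟩

theorem coe_surjective (x : S1) : ∃ t : ℝ, (t : S1) = x :=
  QuotientAddGroup.mk_surjective x

theorem continuous_coe : Continuous (fun t : ℝ => (t : S1)) := AddCircle.continuous_mk' 1

theorem isOpenMap_coe : IsOpenMap (fun t : ℝ => (t : S1)) := QuotientAddGroup.isOpenMap_coe

/-- `F` is an increasing lift of `φ`. -/
def IsLift (F : ℝ ≃o ℝ) (φ : Equiv.Perm S1) : Prop :=
  (∀ t, F (t + 1) = F t + 1) ∧ ∀ t : ℝ, φ (t : S1) = (F t : S1)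

theorem map_add_int {F : ℝ → ℝ} (hF : ∀ t, F (t + 1) = F t + 1) (k : ℤ) (t : ℝ) :
    F (t + k) = F t + k := by
  induction k using Int.induction_on with
  | zero => simp
  | succ i ih =>
    have := hF (t + i)
    push_cast at ih ⊢
    rw [← add_assoc, this, ih]; ring
  | pred i ih =>
    have := hF (t + (-(i : ℤ) - 1 : ℤ))
    push_cast at ih this ⊢
    rw [show t + (-(i : ℝ) - 1) + 1 = t + -(i : ℝ) by ring, ih] at this
    linarith

theorem exists_orderIso_of_degree_one {F : ℝ → ℝ} (hc : Continuous F) (hm : StrictMono F)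
    (h1 : ∀ t, F (t + 1) = F t + 1) : ∃ G : ℝ ≃o ℝ, ∀ t, G t = F t := by
  have hsurj : Function.Surjective F := by
    intro y
    refine mem_range_of_exists_le_of_exists_ge hc ⟨0 + (⌊y - F 0⌋ : ℤ), ?_⟩
      ⟨0 + (⌈y - F 0⌉ : ℤ), ?_⟩
    · rw [map_add_int h1]; linarith [Int.floor_le (y - F 0)]
    · rw [map_add_int h1]; linarith [Int.le_ceil (y - F 0)]
  exact ⟨hm.orderIsoOfSurjective F hsurj, fun t => rfl⟩

theorem IsLift.mul {F G : ℝ ≃o ℝ} {φ ψ : Equiv.Perm S1} (hF : IsLift F φ) (hG : IsLift G ψ) :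
    IsLift (G.trans F) (φ * ψ) := by
  refine ⟨fun t => ?_, fun t => ?_⟩
  · simp [hG.1, hF.1]
  · rw [Equiv.Perm.mul_apply, hG.2, hF.2]; rfl

theorem IsLift.inv {F : ℝ ≃o ℝ} {φ : Equiv.Perm S1} (hF : IsLift F φ) :
    IsLift F.symm φ⁻¹ := by
  refine ⟨fun t => ?_, fun t => ?_⟩
  · rw [F.symm_apply_eq, hF.1, F.apply_symm_apply]
  · rw [Equiv.Perm.inv_eq_iff_eq, hF.2, F.apply_symm_apply]

theorem IsLift.one : IsLift (OrderIso.refl ℝ) 1 := ⟨fun _ => rfl, fun _ => rfl⟩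

/-- The lifts of a given map can be translated. -/
theorem IsLift.add_int {F : ℝ ≃o ℝ} {φ : Equiv.Perm S1} (hF : IsLift F φ) (k : ℤ) :
    ∃ G : ℝ ≃o ℝ, IsLift G φ ∧ ∀ t, G t = F t + k := by
  refine ⟨F.trans (OrderIso.addRight (k : ℝ)), ⟨fun t => ?_, fun t => ?_⟩, fun t => rfl⟩
  · simp [hF.1]; ring
  · rw [hF.2, ← coe_add_intCast (F t) k]; rfl

theorem circleDeriv_eq {φ : S1 → S1} {F : ℝ → ℝ} (hF : ∀ t : ℝ, φ (t : S1) = (F t : S1))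
    {t d : ℝ} (hd : HasDerivAt F d t) : circleDeriv φ (t : S1) = d := by
  have h1 : HasDerivAt (fun s : ℝ => F (t + s) - F t) d 0 := by
    have : HasDerivAt F d (t + 0) := by simpa using hd
    exact (this.comp_const_add t 0).sub_const _
  -- For small displacements the representative in the fundamental interval is the increment of the
  -- lift itself.
  have h2 : ∀ᶠ s in 𝓝 (0 : ℝ), F (t + s) - F t ∈ Ioo (-1 / 2 : ℝ) (-1 / 2 + 1) := by
    refine h1.continuousAt.eventually (Ioo_mem_nhds ?_ ?_) <;> norm_num
  unfold circleDeriv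
  rw [← h1.deriv]
  apply Filter.EventuallyEq.deriv_eq
  filter_upwards [h2] with s hs
  rw [← AddCircle.coe_add, hF, hF, ← AddCircle.coe_sub,
    AddCircle.equivIco_coe_of_mem (p := (1 : ℝ)) ⟨hs.1.le, hs.2⟩]

theorem mem_cIoo_iff {n s t : ℝ} (hns : n < s) (hs : s < n + 1) (ht : t ∈ Ico n (n + 1)) :
    ((t : S1) ∈ cIoo (n : S1) (s : S1)) ↔ n < t ∧ t < s := by
  rw [mem_cIoo, sbtw_iff_not_btw, btw_cyclic, btw_cyclic]
  have h1 : Btw.btw (n : S1) (s : S1) (t : S1) ↔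
      toIcoMod one_pos n s ≤ toIocMod one_pos n t :=
    QuotientAddGroup.btw_coe_iff (p := (1 : ℝ))
  have h2 : toIcoMod one_pos n s = s := (toIcoMod_eq_self _).2 ⟨hns.le, hs⟩
  have e2 : Btw.btw (t : S1) (n : S1) (s : S1) ↔ Btw.btw (n : S1) (s : S1) (t : S1) :=
    ⟨fun h => btw_cyclic_left h, fun h => btw_cyclic_left (btw_cyclic_left h)⟩
  simp only [e2, h1, h2, not_le]
  rcases eq_or_lt_of_le ht.1 with h | h
  · subst h
    rw [toIocMod_apply_left]
    constructor
    · intro h; linarith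
    · intro h; linarith [h.1]
  · rw [(toIocMod_eq_self _).2 ⟨h, ht.2.le⟩]
    exact ⟨fun h' => ⟨h, h'⟩, fun h' => h'.2⟩

/-! ### Lifts of projective maps -/

theorem circleEquiv_coe (t : ℝ) : circleEquiv (t : S1) = lineOfReal t := rfl

theorem circleAction_coe_of_mulVec (A : SL(2, ℝ)) {s t r : ℝ}
    (h : A.1.mulVec (dirVec t) = r • dirVec s) :
    circleAction (QuotientGroup.mk A) (t : S1) = (s : S1) := by
  apply circleEquiv.injective
  have h1 : circleEquiv (circleAction (QuotientGroup.mk A) (t : S1)) = A • lineOfReal t := by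
    change circleEquiv (circleEquiv.symm _) = _
    rw [Equiv.apply_symm_apply]
    rfl
  rw [h1, circleEquiv_coe]
  unfold lineOfReal
  rw [Projectivization.smul_mk, Projectivization.mk_eq_mk_iff']
  exact ⟨r, h.symm⟩

/-- Since the determinant is one, the image of `dirVec` sweeps area at the constant rate of `dirVec`
itself, so its angle moves with speed π / ρ². The angle is defined as the integral of this speed,
which gives a continuous choice without gluing branches of the argument. -/
theorem exists_continuous_angle (A : SL(2, ℝ)) : ∃ F ρ : ℝ → ℝ, (∀ t, 0 < ρ t) ∧
    (∀ t, A.1.mulVec (dirVec t) = ρ t • dirVec (F t)) ∧ ∀ t, HasDerivAt F (1 / ρ t ^ 2) t := by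
  obtain ⟨a, ha⟩ : ∃ a, a = A 0 0 := ⟨_, rfl⟩
  obtain ⟨b, hb⟩ : ∃ b, b = A 0 1 := ⟨_, rfl⟩
  obtain ⟨c, hc⟩ : ∃ c, c = A 1 0 := ⟨_, rfl⟩
  obtain ⟨d, hd⟩ : ∃ d, d = A 1 1 := ⟨_, rfl⟩
  have hdet : a * d - b * c = 1 := by
    rw [ha, hb, hc, hd, ← Matrix.det_fin_two]; exact A.2
  set X : ℝ → ℝ := fun t => a * Real.cos (Real.pi * t) + b * Real.sin (Real.pi * t) with hX
  set Y : ℝ → ℝ := fun t => c * Real.cos (Real.pi * t) + d * Real.sin (Real.pi * t) with hY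
  set X' : ℝ → ℝ := fun t =>
    Real.pi * (-a * Real.sin (Real.pi * t) + b * Real.cos (Real.pi * t)) with hX'
  set Y' : ℝ → ℝ := fun t =>
    Real.pi * (-c * Real.sin (Real.pi * t) + d * Real.cos (Real.pi * t)) with hY'
  have hcos : ∀ t, HasDerivAt (fun t : ℝ => Real.cos (Real.pi * t))
      (-Real.sin (Real.pi * t) * Real.pi) t := fun t =>
    (Real.hasDerivAt_cos _).comp t (by simpa using (hasDerivAt_id t).const_mul Real.pi)
  have hsin : ∀ t, HasDerivAt (fun t : ℝ => Real.sin (Real.pi * t))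
      (Real.cos (Real.pi * t) * Real.pi) t := fun t =>
    (Real.hasDerivAt_sin _).comp t (by simpa using (hasDerivAt_id t).const_mul Real.pi)
  have dX : ∀ t, HasDerivAt X (X' t) t := fun t => by
    have := ((hcos t).const_mul a).add ((hsin t).const_mul b)
    refine this.congr_deriv ?_
    simp only [hX']; ring
  have dY : ∀ t, HasDerivAt Y (Y' t) t := fun t => by
    have := ((hcos t).const_mul c).add ((hsin t).const_mul d)
    refine this.congr_deriv ?_
    simp only [hY']; ring
  have hcs : ∀ t : ℝ, Real.sin (Real.pi * t) ^ 2 + Real.cos (Real.pi * t) ^ 2 = 1 :=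
    fun t => Real.sin_sq_add_cos_sq _
  have hwr : ∀ t, X t * Y' t - Y t * X' t = Real.pi := by
    intro t
    have : X t * Y' t - Y t * X' t = Real.pi * ((a * d - b * c) *
        (Real.sin (Real.pi * t) ^ 2 + Real.cos (Real.pi * t) ^ 2)) := by
      simp only [hX, hY, hX', hY']; ring
    rw [this, hdet, hcs]; ring
  have hQ : ∀ t, 0 < X t ^ 2 + Y t ^ 2 := by
    intro t
    rcases (add_nonneg (sq_nonneg (X t)) (sq_nonneg (Y t))).lt_or_eq with h | h
    · exact h
    · have h1 : X t = 0 := by nlinarith [sq_nonneg (X t), sq_nonneg (Y t)]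
      have h2 : Y t = 0 := by nlinarith [sq_nonneg (X t), sq_nonneg (Y t)]
      have := hwr t
      rw [h1, h2] at this
      simp at this
      exact absurd this.symm Real.pi_ne_zero
  set ρ : ℝ → ℝ := fun t => Real.sqrt (X t ^ 2 + Y t ^ 2) with hρ
  have hρpos : ∀ t, 0 < ρ t := fun t => Real.sqrt_pos.2 (hQ t)
  have hρsq : ∀ t, ρ t ^ 2 = X t ^ 2 + Y t ^ 2 := fun t => Real.sq_sqrt (hQ t).le
  have dρ : ∀ t, HasDerivAt ρ ((X t * X' t + Y t * Y' t) / ρ t) t := by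
    intro t
    have := (((dX t).pow 2).add ((dY t).pow 2)).sqrt (hQ t).ne'
    refine this.congr_deriv ?_
    change _ / (2 * ρ t) = _
    have := (hρpos t).ne'
    field_simp
    simp
    ring
  have hXc : Continuous X := by simp only [hX]; fun_prop
  have hYc : Continuous Y := by simp only [hY]; fun_prop
  have hic : Continuous fun t => 1 / ρ t ^ 2 := by
    simp only [hρsq]
    exact continuous_const.div (by fun_prop) fun t => (hQ t).ne'
  set z : ℂ := ⟨X 0, Y 0⟩ with hz
  have hz0 : z ≠ 0 := by
    intro h
    have h1 : X 0 = 0 := congrArg Complex.re h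
    have h2 : Y 0 = 0 := congrArg Complex.im h
    have := hQ 0
    rw [h1, h2] at this
    norm_num at this
  have hzn : ‖z‖ = ρ 0 := by
    rw [Complex.norm_def, Complex.normSq_apply]
    simp only [hρ, hz]; congr 1; ring
  set F : ℝ → ℝ := fun t => Complex.arg z / Real.pi + ∫ u in (0 : ℝ)..t, 1 / ρ u ^ 2 with hF
  have dF : ∀ t, HasDerivAt F (1 / ρ t ^ 2) t := fun t =>
    ((hic.integral_hasStrictDerivAt 0 t).hasDerivAt).const_add _
  have hF0 : Real.pi * F 0 = Complex.arg z := by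
    simp only [hF, intervalIntegral.integral_same, add_zero]
    exact mul_div_cancel₀ _ Real.pi_ne_zero
  set C : ℝ → ℝ := fun t => Real.cos (Real.pi * F t) with hC
  set S : ℝ → ℝ := fun t => Real.sin (Real.pi * F t) with hS
  have dC : ∀ t, HasDerivAt C (-S t * (Real.pi * (1 / ρ t ^ 2))) t := fun t =>
    (Real.hasDerivAt_cos _).comp t ((dF t).const_mul Real.pi)
  have dS : ∀ t, HasDerivAt S (C t * (Real.pi * (1 / ρ t ^ 2))) t := fun t =>
    (Real.hasDerivAt_sin _).comp t ((dF t).const_mul Real.pi)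
  -- This is the inner product of the unit vector along the image with the unit vector of angle π F.
  -- It is constant and equals 1 at 0, so the two vectors coincide.
  have dα : ∀ t, HasDerivAt (fun t => (X t * C t + Y t * S t) / ρ t) 0 t := by
    intro t
    have h1 := ((((dX t).mul (dC t)).add ((dY t).mul (dS t))).div (dρ t) (hρpos t).ne')
    refine h1.congr_deriv ?_
    have hne := (hρpos t).ne'
    have hw := hwr t
    have hq := hρsq t
    simp only [Pi.add_apply, Pi.mul_apply]
    rw [div_eq_zero_iff]
    left
    have e : ρ t * ρ t = X t ^ 2 + Y t ^ 2 := by rw [← hq]; ring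
    have key : (X' t * C t + Y' t * S t) * (ρ t ^ 2) + Real.pi * (-X t * S t + Y t * C t)
        - (X t * C t + Y t * S t) * (X t * X' t + Y t * Y' t) = 0 := by
      rw [hq, ← hw]; ring
    field_simp
    linear_combination key
  have hconst : ∀ t, (X t * C t + Y t * S t) / ρ t = 1 := by
    intro t
    have h1 := is_const_of_deriv_eq_zero (fun t => (dα t).differentiableAt)
      (fun t => (dα t).deriv) t 0
    rw [h1]
    have h2 : C 0 = X 0 / ρ 0 := by
      simp only [hC]; rw [hF0, Complex.cos_arg hz0, hzn]
    have h3 : S 0 = Y 0 / ρ 0 := by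
      simp only [hS]; rw [hF0, Complex.sin_arg, hzn]
    have hne := (hρpos 0).ne'
    rw [h2, h3]
    have := hρsq 0
    field_simp
    linarith
  refine ⟨F, ρ, hρpos, fun t => ?_, dF⟩
  have h1 : X t * C t + Y t * S t = ρ t := by
    have := hconst t
    rwa [div_eq_one_iff_eq (hρpos t).ne'] at this
  have h2 : S t ^ 2 + C t ^ 2 = 1 := Real.sin_sq_add_cos_sq _
  have h3 : (X t - ρ t * C t) ^ 2 + (Y t - ρ t * S t) ^ 2 = 0 := by
    have := hρsq t
    linear_combination (ρ t ^ 2) * h2 - this - 2 * ρ t * h1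
  have h4 : X t = ρ t * C t := by nlinarith [sq_nonneg (X t - ρ t * C t), sq_nonneg (Y t - ρ t * S t)]
  have h5 : Y t = ρ t * S t := by nlinarith [sq_nonneg (X t - ρ t * C t), sq_nonneg (Y t - ρ t * S t)]
  ext i
  fin_cases i
  · simpa [Matrix.mulVec, dotProduct, Fin.sum_univ_two, dirVec, ← ha, ← hb] using h4
  · simpa [Matrix.mulVec, dotProduct, Fin.sum_univ_two, dirVec, ← hc, ← hd] using h5

/-- The projective maps have increasing lifts, with an explicit derivative. -/
theorem exists_projective_lift (A : SL(2, ℝ)) : ∃ (F : ℝ ≃o ℝ) (ρ : ℝ → ℝ), (∀ t, 0 < ρ t) ∧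
    (∀ t, A.1.mulVec (dirVec t) = ρ t • dirVec (F t)) ∧
    (∀ t, HasDerivAt F (1 / ρ t ^ 2) t) ∧ IsLift F (circleAction (QuotientGroup.mk A)) := by
  obtain ⟨F, ρ, hρ, hA, hF⟩ := exists_continuous_angle A
  have hact : ∀ t : ℝ, circleAction (QuotientGroup.mk A) (t : S1) = (F t : S1) := fun t =>
    circleAction_coe_of_mulVec A (hA t)
  have hc : Continuous F := continuous_iff_continuousAt.2 fun t => (hF t).continuousAt
  have hm : StrictMono F := strictMono_of_deriv_pos fun t => by
    rw [(hF t).deriv]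
    have := hρ t
    positivity
  have h1 : ∀ t, F (t + 1) = F t + 1 := by
    intro t
    have h2 : (F (t + 1) : S1) = (F t : S1) := by
      rw [← hact, ← hact]
      congr 1
      simp
    obtain ⟨k, hk⟩ := coe_eq_coe_iff.1 h2
    have h3 : F t < F (t + 1) := hm (by linarith)
    have h4 : 0 < k := by
      have : (0 : ℝ) < k := by linarith
      exact_mod_cast this
    by_cases h5 : k = 1
    · rw [hk, h5]; simp
    -- If the degree were at least two, the value `F t + 1` would be taken strictly between `t` and
    -- `t + 1`, so two points of the circle would have the same image.
    exfalso
    have h6 : (2 : ℝ) ≤ k := by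
      have : 2 ≤ k := by omega
      exact_mod_cast this
    have h7 : F t + 1 ∈ Icc (F t) (F (t + 1)) := ⟨by linarith, by linarith⟩
    obtain ⟨u, hu, hu'⟩ := intermediate_value_Icc (by linarith : t ≤ t + 1) hc.continuousOn h7
    have h8 : (u : S1) = (t : S1) := by
      apply (circleAction (QuotientGroup.mk A)).injective
      rw [hact, hact, hu']
      simp
    obtain ⟨j, hj⟩ := coe_eq_coe_iff.1 h8
    have hj0 : 0 < j := by
      have : t < u := hm.lt_iff_lt.1 (by linarith)
      have : (0 : ℝ) < j := by linarith
      exact_mod_cast this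
    have hj1 : j < 1 := by
      have : u < t + 1 := hm.lt_iff_lt.1 (by linarith)
      have : (j : ℝ) < 1 := by linarith
      exact_mod_cast this
    omega
  obtain ⟨G, hG⟩ := exists_orderIso_of_degree_one hc hm h1
  have hGF : (G : ℝ → ℝ) = F := funext hG
  refine ⟨G, ρ, hρ, fun t => by rw [hG]; exact hA t, fun t => ?_, fun t => ?_, fun t => ?_⟩
  · rw [hGF]; exact hF t
  · rw [hG, hG, h1]
  · rw [hG, hact]

/-- Projective maps multiply the sines of the angles by a product of local factors. -/
theorem sinPi_mul_of_mulVec (A : SL(2, ℝ)) {F ρ : ℝ → ℝ}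
    (hA : ∀ t, A.1.mulVec (dirVec t) = ρ t • dirVec (F t)) (s t : ℝ) :
    ρ s * ρ t * sinPi (F s - F t) = sinPi (s - t) := by
  have hs0 := congrFun (hA s) 0
  have hs1 := congrFun (hA s) 1
  have ht0 := congrFun (hA t) 0
  have ht1 := congrFun (hA t) 1
  simp only [Matrix.mulVec, dotProduct, Fin.sum_univ_two, dirVec, Pi.smul_apply, smul_eq_mul,
    Matrix.cons_val_zero, Matrix.cons_val_one] at hs0 hs1 ht0 ht1
  have hdet := A.2
  rw [Matrix.det_fin_two] at hdet
  unfold sinPi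
  rw [mul_sub, mul_sub, Real.sin_sub, Real.sin_sub]
  have : ρ s * ρ t * (Real.sin (Real.pi * F s) * Real.cos (Real.pi * F t) -
      Real.cos (Real.pi * F s) * Real.sin (Real.pi * F t)) =
      (ρ s * Real.sin (Real.pi * F s)) * (ρ t * Real.cos (Real.pi * F t)) -
      (ρ s * Real.cos (Real.pi * F s)) * (ρ t * Real.sin (Real.pi * F t)) := by ring
  rw [this, ← hs0, ← hs1, ← ht0, ← ht1]
  linear_combination (Real.sin (Real.pi * s) * Real.cos (Real.pi * t) -
      Real.cos (Real.pi * s) * Real.sin (Real.pi * t)) * hdet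

/-! ### Projective maps with two fixed points -/

theorem dirVec_add_int (t : ℝ) (k : ℤ) :
    dirVec (t + k) = Real.cos (Real.pi * k) • dirVec t := by
  have h : Real.sin (Real.pi * k) = 0 := by rw [mul_comm]; exact Real.sin_int_mul_pi k
  ext i
  fin_cases i <;>
    simp [dirVec, mul_add, Real.cos_add, Real.sin_add, h, mul_comm]

theorem matrix_eq_zero_of_dirVec {M : Matrix (Fin 2) (Fin 2) ℝ} {n s : ℝ} (hns : n < s)
    (hs : s < n + 1) (h1 : M.mulVec (dirVec n) = 0) (h2 : M.mulVec (dirVec s) = 0) : M = 0 := by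
  have hpos : 0 < sinPi (s - n) := sinPi_pos (by linarith) (by linarith)
  have hsin : sinPi (s - n) = Real.sin (Real.pi * s) * Real.cos (Real.pi * n) -
      Real.cos (Real.pi * s) * Real.sin (Real.pi * n) := by
    unfold sinPi; rw [mul_sub, Real.sin_sub]
  have key : ∀ i, M i 0 = 0 ∧ M i 1 = 0 := by
    intro i
    have e1 := congrFun h1 i
    have e2 := congrFun h2 i
    simp only [Matrix.mulVec, dotProduct, Fin.sum_univ_two, dirVec, Matrix.cons_val_zero,
      Matrix.cons_val_one, Pi.zero_apply] at e1 e2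
    constructor
    · have : M i 0 * sinPi (s - n) = 0 := by
        rw [hsin]
        linear_combination Real.sin (Real.pi * s) * e1 - Real.sin (Real.pi * n) * e2
      exact (mul_eq_zero.1 this).resolve_right hpos.ne'
    · have : M i 1 * sinPi (s - n) = 0 := by
        rw [hsin]
        linear_combination Real.cos (Real.pi * n) * e2 - Real.cos (Real.pi * s) * e1
      exact (mul_eq_zero.1 this).resolve_right hpos.ne'
  ext i j
  fin_cases j
  · exact (key i).1
  · exact (key i).2

theorem exists_eigenvalue {A : SL(2, ℝ)} {t : ℝ}
    (h : circleAction (QuotientGroup.mk A) (t : S1) = (t : S1)) :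
    ∃ r : ℝ, A.1.mulVec (dirVec t) = r • dirVec t := by
  obtain ⟨F, ρ, hρ, hA, hF, hl⟩ := exists_projective_lift A
  rw [hl.2] at h
  obtain ⟨k, hk⟩ := coe_eq_coe_iff.1 h
  refine ⟨ρ t * Real.cos (Real.pi * k), ?_⟩
  rw [hA, hk, dirVec_add_int, smul_smul]

/-- Both matrices are diagonal in the basis formed by the two fixed lines. -/
theorem commute_of_fixed {g g' : PSL(2, ℝ)} {n s : ℝ} (hns : n < s) (hs : s < n + 1)
    (h1 : circleAction g (n : S1) = (n : S1)) (h2 : circleAction g (s : S1) = (s : S1))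
    (h1' : circleAction g' (n : S1) = (n : S1)) (h2' : circleAction g' (s : S1) = (s : S1)) :
    g * g' = g' * g := by
  obtain ⟨A, rfl⟩ := QuotientGroup.mk_surjective g
  obtain ⟨B, rfl⟩ := QuotientGroup.mk_surjective g'
  obtain ⟨a, ha⟩ := exists_eigenvalue h1
  obtain ⟨a', ha'⟩ := exists_eigenvalue h2
  obtain ⟨b, hb⟩ := exists_eigenvalue h1'
  obtain ⟨b', hb'⟩ := exists_eigenvalue h2'
  have key : A.1 * B.1 - B.1 * A.1 = 0 := by
    apply matrix_eq_zero_of_dirVec hns hs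
    · rw [Matrix.sub_mulVec, ← Matrix.mulVec_mulVec, ← Matrix.mulVec_mulVec, hb, ha,
        Matrix.mulVec_smul, Matrix.mulVec_smul, ha, hb, smul_comm, sub_self]
    · rw [Matrix.sub_mulVec, ← Matrix.mulVec_mulVec, ← Matrix.mulVec_mulVec, hb', ha',
        Matrix.mulVec_smul, Matrix.mulVec_smul, ha', hb', smul_comm, sub_self]
  have hAB : A * B = B * A := by
    apply Subtype.ext
    exact sub_eq_zero.1 key
  rw [← QuotientGroup.mk_mul, hAB, QuotientGroup.mk_mul]

/-- The derivatives at the fixed points of a hyperbolic element. -/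
theorem circleDeriv_of_fixed {g : PSL(2, ℝ)} (hg : g ≠ 1) {n s : ℝ} (hns : n < s)
    (hs : s < n + 1) (h1 : circleAction g (n : S1) = (n : S1))
    (h2 : circleAction g (s : S1) = (s : S1)) :
    ∃ (F : ℝ ≃o ℝ) (μ : ℝ), IsLift F (circleAction g) ∧ F n = n ∧ F s = s ∧ 0 < μ ∧ μ ≠ 1 ∧
      HasDerivAt F μ n ∧ HasDerivAt F μ⁻¹ s := by
  obtain ⟨A, rfl⟩ := QuotientGroup.mk_surjective g
  obtain ⟨F, ρ, hρ, hA, hF, hl⟩ := exists_projective_lift A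
  have hn := h1
  have hs' := h2
  rw [hl.2] at hn hs'
  obtain ⟨k, hk⟩ := coe_eq_coe_iff.1 hn
  obtain ⟨j, hj⟩ := coe_eq_coe_iff.1 hs'
  have hjk : j = k := by
    have e1 : F n < F s := F.strictMono hns
    have e2 : F s < F n + 1 := by rw [← hl.1]; exact F.strictMono hs
    have e3 : (j : ℝ) < k + 1 := by linarith
    have e4 : (k : ℝ) < j + 1 := by linarith
    have e5 : j < k + 1 := by exact_mod_cast e3
    have e6 : k < j + 1 := by exact_mod_cast e4
    omega
  subst hjk
  have hpos : 0 < sinPi (s - n) := sinPi_pos (by linarith) (by linarith)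
  -- Both ends are translated by the same integer, so the sine identity leaves the product of the
  -- local factors equal to one. The derivatives 1 / ρ² at the two ends are thus inverse to each
  -- other.
  have hprod : ρ s * ρ n = 1 := by
    have := sinPi_mul_of_mulVec A hA s n
    rw [hj, hk, add_sub_add_right_eq_sub] at this
    have h3 : (ρ s * ρ n - 1) * sinPi (s - n) = 0 := by linarith
    linarith [(mul_eq_zero.1 h3).resolve_right hpos.ne']
  obtain ⟨G, hG, hGF⟩ := hl.add_int (-j)
  have hGd : ∀ t, HasDerivAt G (1 / ρ t ^ 2) t := by
    intro t
    have := (hF t).add_const ((-j : ℤ) : ℝ)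
    exact this.congr_of_eventuallyEq (Eventually.of_forall hGF)
  refine ⟨G, 1 / ρ n ^ 2, hG, by rw [hGF, hk]; push_cast; ring, by rw [hGF, hj]; push_cast; ring,
    by have := hρ n; positivity, ?_, hGd n, ?_⟩
  -- With multiplier one, `A` acts on two independent vectors by the same sign, so it is central and
  -- `g` is trivial.
  · intro h
    have hn1 : ρ n = 1 := by
      have := hρ n
      rw [div_eq_one_iff_eq (by positivity)] at h
      nlinarith
    have hs1 : ρ s = 1 := by rw [hn1, mul_one] at hprod; exact hprod
    apply hg
    rw [QuotientGroup.eq_one_iff, Matrix.SpecialLinearGroup.mem_center_iff]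
    have hsin : Real.sin (Real.pi * j) = 0 := by rw [mul_comm]; exact Real.sin_int_mul_pi j
    have hcs := Real.sin_sq_add_cos_sq (Real.pi * j)
    rw [hsin] at hcs
    refine ⟨Real.cos (Real.pi * j), by simp only [Fintype.card_fin]; linarith, ?_⟩
    have key : A.1 - Real.cos (Real.pi * j) • (1 : Matrix (Fin 2) (Fin 2) ℝ) = 0 := by
      apply matrix_eq_zero_of_dirVec hns hs
      · rw [Matrix.sub_mulVec, hA, hn1, hk, dirVec_add_int, Matrix.smul_mulVec,
          Matrix.one_mulVec, one_smul, sub_self]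
      · rw [Matrix.sub_mulVec, hA, hs1, hj, dirVec_add_int, Matrix.smul_mulVec,
          Matrix.one_mulVec, one_smul, sub_self]
    rw [sub_eq_zero.1 key, Matrix.scalar_apply, Matrix.smul_one_eq_diagonal]
  · have e : (1 / ρ n ^ 2)⁻¹ = 1 / ρ s ^ 2 := by
      have h3 : ρ s = 1 / ρ n := by
        rw [eq_div_iff (hρ n).ne']; exact hprod
      rw [h3]; field_simp
    rw [e]
    exact hGd s

/-! ### The limit set -/

section LimitSet

variable {Γ : Type*} [Group Γ] (r : Γ →* Equiv.Perm S1)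

theorem isClosed_limitSet : IsClosed (limitSet r) := isClosed_sInter fun _ hK => hK.1

theorem map_mem_limitSet (γ : Γ) {x : S1} : r γ x ∈ limitSet r ↔ x ∈ limitSet r := by
  have h : ∀ (γ : Γ) (x : S1), x ∈ limitSet r → r γ x ∈ limitSet r := by
    intro γ x hx K hK
    exact hK.2.2 γ x (hx K hK)
  refine ⟨fun hx => ?_, h γ x⟩
  have h1 : r γ⁻¹ (r γ x) = x := by
    rw [← Equiv.Perm.mul_apply, ← map_mul, inv_mul_cancel, map_one]; rfl
  rw [← h1]
  exact h γ⁻¹ _ hx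

theorem limitSet_subset {A : Set S1} (h1 : IsClosed A) (h2 : A.Nonempty)
    (h3 : ∀ γ : Γ, ∀ x ∈ A, r γ x ∈ A) : limitSet r ⊆ A :=
  fun _ hx => hx A ⟨h1, h2, h3⟩

end LimitSet

/-- The ends of the arc are in `L`: otherwise, `L` being closed, the arc could be prolonged past an
end to a larger connected subset of the complement. -/
theorem exists_lift_of_isGap {L : Set S1} (hL : IsClosed L) {N S : S1} (h : IsGap L N S) :
    ∃ n s : ℝ, (n : S1) = N ∧ (s : S1) = S ∧ n < s ∧ s < n + 1 ∧ (n : S1) ∈ L ∧ (s : S1) ∈ L ∧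
      ∀ t ∈ Ioo n s, (t : S1) ∉ L := by
  obtain ⟨x, hx, hc⟩ := h
  have hxc : x ∈ cIoo N S := by rw [hc]; exact mem_connectedComponentIn hx
  have hne : N ≠ S := by
    rintro rfl
    exact sbtw_irrefl_left_right (mem_cIoo.1 hxc)
  obtain ⟨n, rfl⟩ := coe_surjective N
  obtain ⟨s, ⟨hs1, hs2⟩, rfl⟩ : ∃ s ∈ Ioc n (n + 1), (s : S1) = S := by
    have := AddCircle.coe_image_Ioc_eq (1 : ℝ) n
    have h' : S ∈ ((↑) : ℝ → S1) '' Ioc n (n + 1) := by rw [this]; trivial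
    exact h'
  have hs3 : s < n + 1 := by
    refine lt_of_le_of_ne hs2 fun e => hne ?_
    rw [e]; simp
  obtain ⟨u, hu, rfl⟩ : ∃ u ∈ Ico n (n + 1), (u : S1) = x := by
    have := AddCircle.coe_image_Ico_eq (1 : ℝ) n
    have h' : x ∈ ((↑) : ℝ → S1) '' Ico n (n + 1) := by rw [this]; trivial
    exact h'
  have hu' := (mem_cIoo_iff hs1 hs3 hu).1 hxc
  have hgap : ∀ t ∈ Ioo n s, (t : S1) ∉ L := by
    intro t ht
    have h1 : (t : S1) ∈ cIoo (n : S1) (s : S1) :=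
      (mem_cIoo_iff hs1 hs3 ⟨ht.1.le, by linarith [ht.2]⟩).2 ht
    rw [hc] at h1
    exact connectedComponentIn_subset _ _ h1
  have himage : ∀ a b : ℝ, u ∈ Ioo a b → (∀ t ∈ Ioo a b, (t : S1) ∉ L) →
      ∀ t ∈ Ioo a b, (t : S1) ∈ cIoo (n : S1) (s : S1) := by
    intro a b hab hL' t ht
    rw [hc]
    have hpre : IsPreconnected ((fun t : ℝ => (t : S1)) '' Ioo a b) :=
      isPreconnected_Ioo.image _ continuous_coe.continuousOn
    refine hpre.subset_connectedComponentIn ⟨u, hab, rfl⟩ ?_ ⟨t, ht, rfl⟩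
    rintro _ ⟨v, hv, rfl⟩
    exact hL' v hv
  have hopen : IsOpen {t : ℝ | (t : S1) ∉ L} := hL.isOpen_compl.preimage continuous_coe
  refine ⟨n, s, rfl, rfl, hs1, hs3, ?_, ?_, hgap⟩
  · by_contra hn
    obtain ⟨ε, hε, hball⟩ := Metric.isOpen_iff.1 hopen n hn
    have h1 := himage (n - ε) s ⟨by linarith, hu'.2⟩ (fun t ht => by
      rcases lt_or_ge n t with h | h
      · exact hgap t ⟨h, ht.2⟩
      · apply hball
        rw [Metric.mem_ball, Real.dist_eq, abs_lt]
        constructor <;> linarith [ht.1]) n ⟨by linarith, hs1⟩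
    exact lt_irrefl _ ((mem_cIoo_iff hs1 hs3 ⟨le_rfl, by linarith⟩).1 h1).1
  · by_contra hn
    obtain ⟨ε, hε, hball⟩ := Metric.isOpen_iff.1 hopen s hn
    have h1 := himage n (s + ε) ⟨hu'.1, by linarith⟩ (fun t ht => by
      rcases lt_or_ge t s with h | h
      · exact hgap t ⟨ht.1, h⟩
      · apply hball
        rw [Metric.mem_ball, Real.dist_eq, abs_lt]
        constructor <;> linarith [ht.2]) s ⟨hs1, by linarith⟩
    exact lt_irrefl _ ((mem_cIoo_iff hs1 hs3 ⟨hs1.le, hs3⟩).1 h1).2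

theorem exists_lift_circleAction (g : PSL(2, ℝ)) : ∃ F : ℝ ≃o ℝ, IsLift F (circleAction g) := by
  obtain ⟨A, rfl⟩ := QuotientGroup.mk_surjective g
  obtain ⟨F, -, -, -, -, h⟩ := exists_projective_lift A
  exact ⟨F, h⟩

theorem IsLift.continuous {F : ℝ ≃o ℝ} {φ : Equiv.Perm S1} (h : IsLift F φ) : Continuous φ := by
  have hq : IsQuotientMap (fun t : ℝ => (t : S1)) :=
    isOpenMap_coe.isQuotientMap continuous_coe coe_surjective
  rw [hq.continuous_iff]
  have : (φ ∘ fun t : ℝ => (t : S1)) = fun t : ℝ => (F t : S1) := funext h.2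
  rw [this]
  exact continuous_coe.comp F.continuous

/-- Letting `a` act on ℚ by x + 1 and `b` by 2x, the two products send 0 to k and to 2 ^ l * k. -/
theorem freeGroup_pow_ne (k l : ℕ) (hk : 0 < k) (hl : 0 < l) :
    genA ^ k * genB ^ l ≠ genB ^ l * genA ^ k := by
  intro h
  set ψ : F3 →* Equiv.Perm ℚ :=
    FreeGroup.lift ![Equiv.addRight 1, Equiv.mulLeft₀ 2 two_ne_zero, 1] with hψ
  have hA : ψ genA = Equiv.addRight 1 := by simp [hψ, genA]
  have hB : ψ genB = Equiv.mulLeft₀ 2 two_ne_zero := by simp [hψ, genB]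
  have hAk : ∀ (k : ℕ) (x : ℚ), ((Equiv.addRight (1 : ℚ)) ^ k : Equiv.Perm ℚ) x = x + k := by
    intro k x
    induction k with
    | zero => simp
    | succ k ih => rw [pow_succ', Equiv.Perm.mul_apply, ih]; simp; ring
  have hBl : ∀ (l : ℕ) (x : ℚ),
      ((Equiv.mulLeft₀ (2 : ℚ) two_ne_zero) ^ l : Equiv.Perm ℚ) x = 2 ^ l * x := by
    intro l x
    induction l with
    | zero => simp
    | succ l ih => rw [pow_succ', Equiv.Perm.mul_apply, ih]; simp; ring
  have h1 := congrArg (fun γ => ψ γ 0) h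
  simp only [map_mul, map_pow, hA, hB, Equiv.Perm.mul_apply, hAk, hBl] at h1
  have hk' : (0 : ℚ) < k := by exact_mod_cast hk
  have h2 : (1 : ℚ) < 2 ^ l := one_lt_pow₀ one_lt_two hl.ne'
  simp at h1
  nlinarith

theorem exists_pow_fixed {L : Set S1} (hL : L.Finite) {φ : Equiv.Perm S1}
    (h : ∀ x, φ x ∈ L ↔ x ∈ L) : ∃ k : ℕ, 0 < k ∧ ∀ x ∈ L, (φ ^ k) x = x := by
  have := hL.to_subtype
  set e : Equiv.Perm L := φ.subtypePerm h with he
  refine ⟨orderOf e, orderOf_pos e, fun x hx => ?_⟩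
  have h1 : ((e ^ orderOf e) ⟨x, hx⟩ : S1) = x := by rw [pow_orderOf_eq_one]; rfl
  generalize orderOf e = k at h1 ⊢
  rw [he, Equiv.Perm.subtypePerm_pow] at h1
  exact h1

/-- The limit set of a faithful representation of the free group has no isolated points. -/
theorem isPerfectPeriodic_limitSet {ρ : F3 →* PSL(2, ℝ)} (hρ : Function.Injective ρ) {n s : ℝ}
    (hns : n < s) (hs : s < n + 1) (hn : (n : S1) ∈ limitSet (projRep ρ))
    (hs' : (s : S1) ∈ limitSet (projRep ρ)) :
    IsPerfectPeriodic {t : ℝ | (t : S1) ∈ limitSet (projRep ρ)} where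
  closed := (isClosed_limitSet _).preimage continuous_coe
  add_one z := by
    have : ((z + 1 : ℝ) : S1) = (z : S1) := by simp
    simp only [mem_ofPred_eq, this]
  nonempty := ⟨n, hn⟩
  acc := by
    set L := limitSet (projRep ρ) with hL
    -- If `L` were finite, powers of the images of `a` and `b` would fix both ends of the gap, hence
    -- commute; faithfulness would give commuting powers in the free group.
    have hinf : L.Infinite := by
      intro hfin
      obtain ⟨k, hk, hk'⟩ := exists_pow_fixed hfin (φ := projRep ρ genA)
        fun x => map_mem_limitSet _ _
      obtain ⟨l, hl, hl'⟩ := exists_pow_fixed hfin (φ := projRep ρ genB)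
        fun x => map_mem_limitSet _ _
      rw [← map_pow] at hk' hl'
      apply freeGroup_pow_ne k l hk hl
      apply hρ
      rw [map_mul, map_mul]
      exact commute_of_fixed hns hs (hk' _ hn) (hk' _ hs') (hl' _ hn) (hl' _ hs')
    obtain ⟨x₀, hx₀⟩ := hinf.exists_accPt_principal
    -- The derived set of `L` is closed, invariant and non-empty, so it contains the minimal set.
    have hsub : L ⊆ {x | AccPt x (𝓟 L)} := by
      refine limitSet_subset _ (isClosed_derivedSet L) ⟨x₀, hx₀⟩ fun γ x hx => ?_
      simp only [mem_ofPred_eq, accPt_iff_nhds] at hx ⊢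
      intro V hV
      obtain ⟨F, hF⟩ := exists_lift_circleAction (ρ γ)
      obtain ⟨y, ⟨hy1, hy2⟩, hy3⟩ := hx _ (hF.continuous.continuousAt.preimage_mem_nhds hV)
      exact ⟨_, ⟨hy1, (map_mem_limitSet _ γ).2 hy2⟩, fun h => hy3 ((projRep ρ γ).injective h)⟩
    intro z hz ε hε
    have h1 := accPt_iff_nhds.1 (hsub hz) _ (isOpenMap_coe.image_mem_nhds
      (Ioo_mem_nhds (show z - ε < z by linarith) (show z < z + ε by linarith)))
    obtain ⟨_, ⟨⟨w, hw, rfl⟩, hw2⟩, hw3⟩ := h1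
    refine ⟨w, hw2, fun h => hw3 (by rw [h]), ?_⟩
    rw [abs_lt]
    constructor <;> linarith [hw.1, hw.2]

theorem injective_of_isUniformization {ρ : F3 →* PSL(2, ℝ)} {q : ℍ → Torus} {p₁ p₂ : Torus}
    (h : IsUniformization ρ q p₁ p₂) : Function.Injective ρ := by
  rw [injective_iff_map_eq_one]
  intro γ hγ
  refine h.free γ UpperHalfPlane.I ?_
  rw [hγ, map_one]; rfl

/-! ### Monotone lifts and the strip they define -/

theorem eq_of_coe_eq {a b x y : ℝ} (hab : b < a + 1) (hx : x ∈ Icc a b) (hy : y ∈ Icc a b)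
    (h : (x : S1) = (y : S1)) : x = y := by
  obtain ⟨k, hk⟩ := coe_eq_coe_iff.1 h
  have h1 : (k : ℝ) < 1 := by linarith [hx.2, hy.1]
  have h2 : (-1 : ℝ) < k := by linarith [hx.1, hy.2]
  have h3 : k < 1 := by exact_mod_cast h1
  have h4 : -1 < k := by exact_mod_cast h2
  have h5 : k = 0 := by omega
  simpa [h5] using hk

/-- The points strictly between the graph of `H` and its translate. -/
def strip (H : ℝ → ℝ) : Set (ℝ × ℝ) :=
  {p | (∃ s' > p.1, H s' < p.2) ∧ ∃ s' < p.1, p.2 < H s' + 1}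

/-- The lift of `h` which is the identity on `K`. -/
structure IsNormalLift (K : Set ℝ) (h : S1 → S1) (H : ℝ → ℝ) : Prop where
  lift : IsMonotoneLift H h
  eq_self : ∀ z ∈ K, H z = z

/-- On `K` a lift differs from the identity by an integer. Monotonicity and degree one prevent this
integer from changing within a period, so a single translation normalizes the lift on all of `K`. -/
theorem exists_int_normalize {K : Set ℝ} (hK : IsPerfectPeriodic K) {h : S1 → S1}
    (hid : ∀ z ∈ K, h (z : S1) = (z : S1)) {H : ℝ → ℝ} (hH : IsMonotoneLift H h) :
    ∃ k : ℤ, IsNormalLift K h (fun t => H t - k) := by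
  obtain ⟨hm, h1, hl⟩ := hH
  obtain ⟨n, hn⟩ := hK.nonempty
  obtain ⟨k, hk⟩ := coe_eq_coe_iff.1 ((hl n).symm.trans (hid n hn))
  have hm' : Monotone fun t => H t - k := fun x y hxy => sub_le_sub_right (hm hxy) _
  have h1' : ∀ t, H (t + 1) - k = H t - k + 1 := fun t => by rw [h1]; ring
  have hn' : H n - k = n := by linarith
  have key : ∀ z ∈ K, n < z → z < n + 1 → H z - k = z := by
    intro z hz h2 h3
    have h4 := hm' h2.le
    have h5 := hm' h3.le
    have h6 := h1' n
    simp only at h4 h5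
    obtain ⟨j, hj⟩ := coe_eq_coe_iff.1 ((hl z).symm.trans (hid z hz))
    have e1 : ((j - k : ℤ) : ℝ) < 1 := by push_cast; linarith
    have e2 : (-1 : ℝ) < ((j - k : ℤ) : ℝ) := by push_cast; linarith
    have e3 : j - k < 1 := by exact_mod_cast e1
    have e4 : -1 < j - k := by exact_mod_cast e2
    have e5 : j = k := by omega
    rw [hj, e5]; ring
  refine ⟨k, ⟨hm', h1', fun t => ?_⟩, fun z hz => ?_⟩
  · have := coe_add_intCast (H t) (-k)
    push_cast at this
    rw [← sub_eq_add_neg] at this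
    rw [hl, this]
  · set m := ⌊z - n⌋ with hmdef
    have h2 := Int.floor_le (z - n)
    have h3 := Int.lt_floor_add_one (z - n)
    rw [← hmdef] at h2 h3
    have h4 : z = (z - m) + m := by ring
    have h5 : H ((z - m) + m) - k = H (z - m) - k + m := by rw [map_add_int h1]; ring
    have h6 : z - m ∈ K := by
      have := (hK.add_int (-m) z).2 hz
      push_cast at this
      rwa [← sub_eq_add_neg] at this
    have h7 : H (z - m) - k = z - m := by
      rcases (by linarith : n ≤ z - m).lt_or_eq with h | h
      · exact key _ h6 h (by linarith)
      · rw [← h]; exact hn'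
    rw [h4, h5, h7]

namespace IsNormalLift

variable {K : Set ℝ} {h : S1 → S1} {H : ℝ → ℝ}

theorem mem_Icc (hK : IsPerfectPeriodic K) (hH : IsNormalLift K h H) (t : ℝ) :
    H t ∈ Icc (gapLeft K t) (gapRight K t) := by
  constructor
  · rw [← hH.eq_self _ (hK.gapLeft_mem t)]
    exact hH.lift.1 (hK.gapLeft_le t)
  · rw [← hH.eq_self _ (hK.gapRight_mem t)]
    exact hH.lift.1 (hK.le_gapRight t)

theorem unique (hK : IsPerfectPeriodic K) (hH : IsNormalLift K h H) {H' : ℝ → ℝ}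
    (hH' : IsNormalLift K h H') : H' = H := by
  funext t
  refine eq_of_coe_eq (hK.gapRight_lt t) (hH'.mem_Icc hK t) (hH.mem_Icc hK t) ?_
  rw [← hH.lift.2.2, ← hH'.lift.2.2]

/-- For `up` and `down` one of the two witnesses is inherited, and the other is a nearby point of
`K` (possibly translated by one), at which `H` is the identity. -/
theorem isStrip (hK : IsPerfectPeriodic K) (hH : IsNormalLift K h H) : IsStrip K (strip H) where
  isOpen := by
    have : strip H = (⋃ s', {p : ℝ × ℝ | p.1 < s' ∧ H s' < p.2}) ∩
        ⋃ s', {p : ℝ × ℝ | s' < p.1 ∧ p.2 < H s' + 1} := by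
      ext p
      simp [strip]
    rw [this]
    refine (isOpen_iUnion fun s' => ?_).inter (isOpen_iUnion fun s' => ?_)
    · exact (isOpen_lt continuous_fst continuous_const).inter
        (isOpen_lt continuous_const continuous_snd)
    · exact (isOpen_lt continuous_const continuous_fst).inter
        (isOpen_lt continuous_snd continuous_const)
  up := by
    rintro s t s' t' ⟨⟨x, hx, hxt⟩, -⟩ h1 h2 h3 h4
    refine ⟨⟨x, lt_of_le_of_lt h1 hx, lt_of_lt_of_le hxt h2⟩, ?_⟩
    rcases h4 with h4 | h4
    · obtain ⟨w, hw, hw1, hw2⟩ := h4 (s' + 1 - t') (by linarith)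
      exact ⟨w, hw2, by simp only; rw [hH.eq_self w hw]; linarith⟩
    · obtain ⟨w, hw, hw1, hw2⟩ := h4 (s' + 1 - t') (by linarith)
      refine ⟨w - 1, by simp only; linarith, ?_⟩
      rw [hH.eq_self _ ((hK.sub_one w).2 hw)]
      simp only; linarith
  down := by
    rintro s t s' t' ⟨-, ⟨x, hx, hxt⟩⟩ h1 h2 h3 h4
    refine ⟨?_, ⟨x, lt_of_lt_of_le hx h1, lt_of_le_of_lt h2 hxt⟩⟩
    rcases h4 with h4 | h4
    · obtain ⟨w, hw, hw1, hw2⟩ := h4 (t' - s') (by linarith)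
      exact ⟨w, hw1, by simp only; rw [hH.eq_self w hw]; linarith⟩
    · obtain ⟨w, hw, hw1, hw2⟩ := h4 (t' - s') (by linarith)
      exact ⟨w, by simp only; linarith, by simp only; rw [hH.eq_self w hw]; linarith⟩
  lt := by
    rintro s t z ⟨⟨x, hx, hxt⟩, -⟩ hz hzs
    simp only at hx hxt
    have := hH.lift.1 (hzs.trans hx.le)
    rw [hH.eq_self z hz] at this
    linarith
  lt_add := by
    rintro s t z ⟨-, ⟨x, hx, hxt⟩⟩ hz hzs
    simp only at hx hxt
    have := hH.lift.1 (hx.le.trans hzs)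
    rw [hH.eq_self z hz] at this
    linarith

end IsNormalLift

theorem leftLim_le_iff {H : ℝ → ℝ} (hm : Monotone H) {t u : ℝ} :
    Function.leftLim H t ≤ u ↔ ∀ s < t, H s ≤ u := by
  constructor
  · intro h s hs
    exact (hm.le_leftLim hs).trans h
  · intro h
    refine le_of_tendsto (hm.tendsto_leftLim t) ?_
    filter_upwards [self_mem_nhdsWithin] with s hs using h s hs

theorem le_rightLim_iff {H : ℝ → ℝ} (hm : Monotone H) {t u : ℝ} :
    u ≤ Function.rightLim H t ↔ ∀ s > t, u ≤ H s := by
  constructor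
  · intro h s hs
    exact h.trans (hm.rightLim_le hs)
  · intro h
    refine ge_of_tendsto (hm.tendsto_rightLim t) ?_
    filter_upwards [self_mem_nhdsWithin] with s hs using h s hs

/-- All monotone lifts of `h` differ from `H` by an integer, so the completed graph is described by
this single lift. -/
theorem mem_filledGraph_iff {K : Set ℝ} {h : S1 → S1} {H : ℝ → ℝ} (hK : IsPerfectPeriodic K)
    (hH : IsNormalLift K h H) {s t : ℝ} :
    ((s : S1), (t : S1)) ∈ filledGraph h ↔
      ∃ k : ℤ, (∀ s' < s, H s' ≤ t + k) ∧ ∀ s' > s, t + k ≤ H s' := by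
  constructor
  · rintro ⟨H', hH', s₀, t₀, he, h1, h2⟩
    rw [leftLim_le_iff hH'.1] at h1
    rw [le_rightLim_iff hH'.1] at h2
    obtain ⟨k, hk⟩ := exists_int_normalize hK (fun z hz => by
      rw [hH.lift.2.2, hH.eq_self z hz]) hH'
    have hHH : ∀ t, H' t = H t + k := fun t => by
      have := congrFun (hH.unique hK hk) t
      linarith
    simp only [Prod.mk.injEq] at he
    obtain ⟨i, hi⟩ := coe_eq_coe_iff.1 he.1
    obtain ⟨j, hj⟩ := coe_eq_coe_iff.1 he.2
    have hsh : ∀ x, H' (x - i) = H x + k - i := by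
      intro x
      have := map_add_int hH.lift.2.1 (-i) x
      push_cast at this
      rw [hHH, sub_eq_add_neg, this]; ring
    refine ⟨i - k - j, fun s' hs' => ?_, fun s' hs' => ?_⟩
    · have := h1 (s' - i) (by linarith)
      rw [hsh] at this
      push_cast; linarith
    · have := h2 (s' - i) (by linarith)
      rw [hsh] at this
      push_cast; linarith
  · rintro ⟨k, h1, h2⟩
    refine ⟨H, hH.lift, s, t + k, ?_, ?_, ?_⟩
    · rw [coe_add_intCast]
    · rw [leftLim_le_iff hH.lift.1]; exact h1
    · rw [le_rightLim_iff hH.lift.1]; exact h2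

theorem mem_surfaceM_of_mem_strip {K : Set ℝ} {h : S1 → S1} {H : ℝ → ℝ}
    (hK : IsPerfectPeriodic K) (hH : IsNormalLift K h H) {s t : ℝ} (hp : (s, t) ∈ strip H) :
    ((s : S1), (t : S1)) ∈ surfaceM h := by
  obtain ⟨⟨x, hx, hxt⟩, y, hy, hyt⟩ := hp
  simp only at hx hxt hy hyt
  intro hg
  obtain ⟨k, h1, h2⟩ := (mem_filledGraph_iff hK hH).1 hg
  have e1 := h2 x hx
  have e2 := h1 y hy
  have e3 : (k : ℝ) < 0 := by linarith
  have e4 : (-1 : ℝ) < k := by linarith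
  have e5 : k < 0 := by exact_mod_cast e3
  have e6 : -1 < k := by exact_mod_cast e4
  omega

/-- Take the lowest translate of `t` above the right limit of `H` at `s`. The preceding translate is
not above it, and cannot be on the completed graph, so it is below the left limit: the chosen one is
below the translated graph. -/
theorem exists_mem_strip {K : Set ℝ} {h : S1 → S1} {H : ℝ → ℝ}
    (hK : IsPerfectPeriodic K) (hH : IsNormalLift K h H) {s t : ℝ}
    (hp : ((s : S1), (t : S1)) ∈ surfaceM h) : ∃ k : ℤ, (s, t + k) ∈ strip H := by
  have hg : ∀ k : ℤ, ¬ ((∀ s' < s, H s' ≤ t + k) ∧ ∀ s' > s, t + k ≤ H s') := by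
    intro k hk
    exact hp ((mem_filledGraph_iff hK hH).2 ⟨k, hk⟩)
  obtain ⟨k, ⟨x, hx, hxk⟩, hmin⟩ := Int.exists_least_of_bdd
    (P := fun k : ℤ => ∃ s' > s, H s' < t + k)
    ⟨⌊H s - t⌋, fun k ⟨x, hx, hxk⟩ => by
      have h1 := hH.lift.1 hx.le
      have h2 : ((⌊H s - t⌋ : ℤ) : ℝ) < k := (Int.floor_le (H s - t)).trans_lt (by linarith)
      exact_mod_cast h2.le⟩
    ⟨⌊H (s + 1) - t⌋ + 1, s + 1, by linarith, by
      push_cast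
      linarith [Int.lt_floor_add_one (H (s + 1) - t)]⟩
  refine ⟨k, ⟨x, hx, hxk⟩, ?_⟩
  have h1 : ∀ s' > s, t + (k - 1 : ℤ) ≤ H s' := by
    intro s' hs'
    by_contra! h2
    have := hmin (k - 1) ⟨s', hs', h2⟩
    omega
  have h2 : ¬ ∀ s' < s, H s' ≤ t + (k - 1 : ℤ) := fun h => hg (k - 1) ⟨h, h1⟩
  push Not at h2
  obtain ⟨y, hy, hyk⟩ := h2
  refine ⟨y, hy, ?_⟩
  push_cast at hyk
  simp only
  linarith

theorem strip_add_int {H : ℝ → ℝ} (h1 : ∀ t, H (t + 1) = H t + 1) (k : ℤ) {s t : ℝ}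
    (hp : (s, t) ∈ strip H) : (s + k, t + k) ∈ strip H := by
  obtain ⟨⟨x, hx, hxt⟩, y, hy, hyt⟩ := hp
  simp only at hx hxt hy hyt
  refine ⟨⟨x + k, by simpa using hx, ?_⟩, y + k, by simpa using hy, ?_⟩
  · rw [map_add_int h1]; simpa using hxt
  · rw [map_add_int h1]; simp only; linarith

/-- The vertical slices of the strip are open intervals of length at most one, so two points of a
slice cannot differ by a nonzero integer. -/
theorem strip_unique {H : ℝ → ℝ} (hm : Monotone H) (h1 : ∀ t, H (t + 1) = H t + 1)
    {p q : ℝ × ℝ} (hp : p ∈ strip H) (hq : q ∈ strip H) (hs : (p.1 : S1) = (q.1 : S1))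
    (ht : (p.2 : S1) = (q.2 : S1)) : ∃ k : ℤ, p = (q.1 + k, q.2 + k) := by
  obtain ⟨i, hi⟩ := coe_eq_coe_iff.1 hs
  obtain ⟨j, hj⟩ := coe_eq_coe_iff.1 ht
  have hq' := strip_add_int h1 i (s := q.1) (t := q.2) hq
  obtain ⟨⟨x, hx, hxt⟩, y, hy, hyt⟩ := hp
  obtain ⟨⟨x', hx', hxt'⟩, y', hy', hyt'⟩ := hq'
  simp only at hx' hxt' hy' hyt'
  have e1 : H y' ≤ H x := hm (by linarith)
  have e2 : H y ≤ H x' := hm (by linarith)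
  have e3 : ((j - i : ℤ) : ℝ) < 1 := by push_cast; linarith
  have e4 : (-1 : ℝ) < ((j - i : ℤ) : ℝ) := by push_cast; linarith
  have e5 : j - i < 1 := by exact_mod_cast e3
  have e6 : -1 < j - i := by exact_mod_cast e4
  have e7 : j = i := by omega
  exact ⟨i, Prod.ext hi (by rw [hj, e7])⟩

/-- Any `t` between `w` and `z + 1` gives a point `(s, t)` of the strip: this is how its vertical
slices are seen to be non-empty. -/
theorem IsPerfectPeriodic.exists_straddle {K : Set ℝ} (hK : IsPerfectPeriodic K) (s : ℝ) :
    ∃ z ∈ K, ∃ w ∈ K, z < s ∧ s < w ∧ w < z + 1 := by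
  by_cases hs : s ∈ K
  · by_cases hr : RAcc K s
    · obtain ⟨z, hz, hz1, hz2⟩ : ∃ z ∈ K, z < s ∧ s < z + 1 := by
        by_cases hl : LAcc K s
        · obtain ⟨z, hz, h1, h2⟩ := hl 1 one_pos
          exact ⟨z, hz, h2, by linarith⟩
        · obtain ⟨-, a, ha, h1, h2, -⟩ := hK.exists_gap_left hs hl
          exact ⟨a, ha, h1, h2⟩
      obtain ⟨w, hw, h1, h2⟩ := hr (z + 1 - s) (by linarith)
      exact ⟨z, hz, w, hw, hz1, h1, by linarith⟩
    · obtain ⟨hl, b, hb, h1, h2, -⟩ := hK.exists_gap_right hs hr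
      obtain ⟨z, hz, h3, h4⟩ := hl (s + 1 - b) (by linarith)
      exact ⟨z, hz, b, hb, h4, h1, by linarith⟩
  · exact ⟨_, hK.gapLeft_mem s, _, hK.gapRight_mem s, hK.gapLeft_lt hs, hK.lt_gapRight hs,
      hK.gapRight_lt s⟩

/-- A nowhere zero continuous function on the strip has constant sign. -/
theorem mul_pos_of_strip {K : Set ℝ} {h : S1 → S1} {H : ℝ → ℝ} (hK : IsPerfectPeriodic K)
    (hH : IsNormalLift K h H) {W : ℝ × ℝ → ℝ} (hW : ContinuousOn W (strip H))
    (hW0 : ∀ p ∈ strip H, W p ≠ 0) : ∀ p ∈ strip H, ∀ q ∈ strip H, 0 < W p * W q := by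
  have hUo := (hH.isStrip hK).isOpen
  -- The projections of the positive and negative parts are open and cover the line. They are
  -- disjoint because each slice is an interval, so one of them is empty by connectedness.
  set A : Set ℝ := Prod.fst '' (strip H ∩ W ⁻¹' Ioi 0) with hA
  set B : Set ℝ := Prod.fst '' (strip H ∩ W ⁻¹' Iio 0) with hB
  have hAo : IsOpen A := isOpenMap_fst _ (hW.isOpen_inter_preimage hUo isOpen_Ioi)
  have hBo : IsOpen B := isOpenMap_fst _ (hW.isOpen_inter_preimage hUo isOpen_Iio)
  have hslice : ∀ s t t', (s, t) ∈ strip H → (s, t') ∈ strip H → t ≤ t' →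
      0 < W (s, t) * W (s, t') := by
    intro s t t' h1 h2 hle
    have hsub : ∀ u ∈ Icc t t', (s, u) ∈ strip H := by
      intro u hu
      obtain ⟨⟨x, hx, hxt⟩, -⟩ := h1
      obtain ⟨-, y, hy, hyt⟩ := h2
      exact ⟨⟨x, hx, hxt.trans_le hu.1⟩, y, hy, lt_of_le_of_lt hu.2 hyt⟩
    have hc : ContinuousOn (fun u => W (s, u)) (Icc t t') :=
      hW.comp (by fun_prop) hsub
    by_contra! hneg
    have hz : (0 : ℝ) ∈ (fun u => W (s, u)) '' Icc t t' := by
      rcases le_total (W (s, t)) 0 with h3 | h3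
      · have h4 : 0 ≤ W (s, t') := by
          by_contra! h5
          have := mul_pos_of_neg_of_neg (lt_of_le_of_ne h3 (hW0 _ h1)) h5
          linarith
        exact intermediate_value_Icc hle hc ⟨h3, h4⟩
      · have h4 : W (s, t') ≤ 0 := by
          by_contra! h5
          have := mul_pos (lt_of_le_of_ne h3 (hW0 _ h1).symm) h5
          linarith
        exact intermediate_value_Icc' hle hc ⟨h4, h3⟩
    obtain ⟨u, hu, hu0⟩ := hz
    exact hW0 _ (hsub u hu) hu0
  have hdisj : ¬ (univ ∩ (A ∩ B)).Nonempty := by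
    rintro ⟨s, -, ⟨⟨_, t⟩, ⟨h1, h2⟩, rfl⟩, ⟨⟨_, t'⟩, ⟨h3, h4⟩, h5⟩⟩
    simp only at h5
    subst h5
    simp only [mem_preimage, mem_Ioi, mem_Iio] at h2 h4
    rcases le_total t t' with h | h
    · have := hslice _ _ _ h1 h3 h
      nlinarith
    · have := hslice _ _ _ h3 h1 h
      nlinarith
  have hcover : (univ : Set ℝ) ⊆ A ∪ B := by
    intro s _
    obtain ⟨z, hz, w, hw, h1, h2, h3⟩ := hK.exists_straddle s
    obtain ⟨t, ht1, ht2⟩ := exists_between h3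
    have hm : (s, t) ∈ strip H :=
      ⟨⟨w, h2, by rw [hH.eq_self w hw]; exact ht1⟩, z, h1, by rw [hH.eq_self z hz]; exact ht2⟩
    rcases lt_or_gt_of_ne (hW0 _ hm) with h | h
    · exact Or.inr ⟨_, ⟨hm, h⟩, rfl⟩
    · exact Or.inl ⟨_, ⟨hm, h⟩, rfl⟩
  have hpre := isPreconnected_univ (α := ℝ) A B hAo hBo hcover
  intro p hp q hq
  have hAB : ¬ (A.Nonempty ∧ B.Nonempty) := by
    rintro ⟨hAn, hBn⟩
    exact hdisj (hpre (by simpa using hAn) (by simpa using hBn))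
  rcases lt_or_gt_of_ne (hW0 _ hp) with h1 | h1 <;> rcases lt_or_gt_of_ne (hW0 _ hq) with h2 | h2
  · exact mul_pos_of_neg_of_neg h1 h2
  · exact absurd ⟨⟨_, q, ⟨hq, h2⟩, rfl⟩, ⟨_, p, ⟨hp, h1⟩, rfl⟩⟩ hAB
  · exact absurd ⟨⟨_, p, ⟨hp, h1⟩, rfl⟩, ⟨_, q, ⟨hq, h2⟩, rfl⟩⟩ hAB
  · exact mul_pos h1 h2

/-! ### Pairs of lifts -/

/-- Lifts of a pair of circle maps that agree on `K` and are semi conjugate by `H`. -/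
structure IsLiftPair (K : Set ℝ) (H : ℝ → ℝ) (φ₁ φ₂ : Equiv.Perm S1) (F₁ F₂ : ℝ ≃o ℝ) :
    Prop where
  lift₁ : IsLift F₁ φ₁
  lift₂ : IsLift F₂ φ₂
  eqOn : ∀ z ∈ K, F₂ z = F₁ z
  mem_iff : ∀ z, F₁ z ∈ K ↔ z ∈ K
  semiconj : ∀ t, F₂ (H t) = H (F₁ t)

namespace IsLiftPair

variable {K : Set ℝ} {h : S1 → S1} {H : ℝ → ℝ} {φ₁ φ₂ : Equiv.Perm S1} {F₁ F₂ : ℝ ≃o ℝ}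

theorem mem_iff₂ (hF : IsLiftPair K H φ₁ φ₂ F₁ F₂) (z : ℝ) : F₂ z ∈ K ↔ z ∈ K := by
  constructor
  · intro hz
    have h1 : F₁.symm (F₂ z) ∈ K := by rw [← hF.mem_iff, F₁.apply_symm_apply]; exact hz
    have h2 := hF.eqOn _ h1
    rw [F₁.apply_symm_apply] at h2
    rwa [← F₂.injective h2]
  · intro hz
    rw [hF.eqOn z hz, hF.mem_iff]; exact hz

theorem gapEnd_map₁ (hK : IsPerfectPeriodic K) (hF : IsLiftPair K H φ₁ φ₂ F₁ F₂) (b : Bool)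
    (t : ℝ) : gapEnd K b (F₁ t) = F₁ (gapEnd K b t) := by
  cases b
  · exact hK.gapLeft_map F₁ hF.mem_iff t
  · exact hK.gapRight_map F₁ hF.mem_iff t

theorem gapEnd_map₂ (hK : IsPerfectPeriodic K) (hF : IsLiftPair K H φ₁ φ₂ F₁ F₂) (b : Bool)
    (t : ℝ) : gapEnd K b (F₂ t) = F₂ (gapEnd K b t) := by
  cases b
  · exact hK.gapLeft_map F₂ hF.mem_iff₂ t
  · exact hK.gapRight_map F₂ hF.mem_iff₂ t

theorem mem_strip (hF : IsLiftPair K H φ₁ φ₂ F₁ F₂) {s t : ℝ} (hp : (s, t) ∈ strip H) :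
    (F₁ s, F₂ t) ∈ strip H := by
  obtain ⟨⟨x, hx, hxt⟩, y, hy, hyt⟩ := hp
  refine ⟨⟨F₁ x, F₁.strictMono hx, ?_⟩, F₁ y, F₁.strictMono hy, ?_⟩
  · rw [← hF.semiconj]; exact F₂.strictMono hxt
  · rw [← hF.semiconj, ← hF.lift₂.1]; exact F₂.strictMono hyt

theorem eq_of_coe (hK : IsPerfectPeriodic K) (hF : IsLiftPair K H φ₁ φ₂ F₁ F₂) {t : ℝ}
    (ht : φ₂ (t : S1) = φ₁ (t : S1)) : F₂ t = F₁ t := by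
  have ha := hK.gapLeft_mem t
  have hb := hK.gapRight_mem t
  refine eq_of_coe_eq (a := F₁ (gapLeft K t)) (b := F₁ (gapRight K t)) ?_ ⟨?_, ?_⟩ ⟨?_, ?_⟩ ?_
  · rw [← hF.lift₁.1]; exact F₁.strictMono (hK.gapRight_lt t)
  · rw [← hF.eqOn _ ha]; exact F₂.monotone (hK.gapLeft_le t)
  · rw [← hF.eqOn _ hb]; exact F₂.monotone (hK.le_gapRight t)
  · exact F₁.monotone (hK.gapLeft_le t)
  · exact F₁.monotone (hK.le_gapRight t)
  · rw [← hF.lift₁.2, ← hF.lift₂.2, ht]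

end IsLiftPair

/-- Adjust the second lift to agree with the first at one point of `K`; monotonicity propagates the
agreement to `K`. The semi conjugacy then lifts without an integer error, since both sides lie
between the images of the ends of a gap, which are less than one apart. -/
theorem exists_isLiftPair {K : Set ℝ} {h : S1 → S1} {H : ℝ → ℝ} (hK : IsPerfectPeriodic K)
    (hH : IsNormalLift K h H) {φ₁ φ₂ : Equiv.Perm S1} {F₁ : ℝ ≃o ℝ} (h₁ : IsLift F₁ φ₁)
    (h₂ : ∃ F, IsLift F φ₂) (heq : ∀ z ∈ K, φ₂ (z : S1) = φ₁ (z : S1))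
    (hmem : ∀ z, F₁ z ∈ K ↔ z ∈ K) (hconj : ∀ x, φ₂ (h x) = h (φ₁ x)) :
    ∃ F₂, IsLiftPair K H φ₁ φ₂ F₁ F₂ := by
  obtain ⟨F, hF⟩ := h₂
  obtain ⟨n, hn⟩ := hK.nonempty
  have e1 : (F n : S1) = (F₁ n : S1) := by rw [← hF.2, ← h₁.2, heq n hn]
  obtain ⟨k, hk⟩ := coe_eq_coe_iff.1 e1
  obtain ⟨G, hG, hGF⟩ := hF.add_int (-k)
  have hGn : G n = F₁ n := by rw [hGF, hk]; push_cast; ring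
  have heq' : ∀ z ∈ K, n ≤ z → z < n + 1 → G z = F₁ z := by
    intro z hz hz1 hz2
    have e2 : (G z : S1) = (F₁ z : S1) := by rw [← hG.2, ← h₁.2, heq z hz]
    obtain ⟨j, hj⟩ := coe_eq_coe_iff.1 e2
    have a1 := F₁.monotone hz1
    have a2 := F₁.strictMono hz2
    have b1 := G.monotone hz1
    have b2 := G.strictMono hz2
    rw [h₁.1] at a2
    rw [hG.1] at b2
    have e3 : (j : ℝ) < 1 := by linarith
    have e4 : (-1 : ℝ) < j := by linarith
    have e5 : j < 1 := by exact_mod_cast e3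
    have e6 : -1 < j := by exact_mod_cast e4
    have e7 : j = 0 := by omega
    simpa [e7] using hj
  have heq2 : ∀ z ∈ K, G z = F₁ z := by
    intro z hz
    set m := ⌊z - n⌋ with hmdef
    have h2 := Int.floor_le (z - n)
    have h3 := Int.lt_floor_add_one (z - n)
    rw [← hmdef] at h2 h3
    have h4 : z = (z - m) + m := by ring
    have h6 : z - m ∈ K := by
      have := (hK.add_int (-m) z).2 hz
      push_cast at this
      rwa [← sub_eq_add_neg] at this
    rw [h4, map_add_int hG.1, map_add_int h₁.1, heq' _ h6 (by linarith) (by linarith)]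
  refine ⟨G, h₁, hG, heq2, hmem, fun t => ?_⟩
  have ha := hK.gapLeft_mem t
  have hb := hK.gapRight_mem t
  have hHt := hH.mem_Icc hK t
  refine eq_of_coe_eq (a := F₁ (gapLeft K t)) (b := F₁ (gapRight K t)) ?_ ⟨?_, ?_⟩ ⟨?_, ?_⟩ ?_
  · rw [← h₁.1]; exact F₁.strictMono (hK.gapRight_lt t)
  · rw [← heq2 _ ha]; exact G.monotone hHt.1
  · rw [← heq2 _ hb]; exact G.monotone hHt.2
  · rw [← hH.eq_self _ ((hmem _).2 ha)]; exact hH.lift.1 (F₁.monotone (hK.gapLeft_le t))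
  · rw [← hH.eq_self _ ((hmem _).2 hb)]; exact hH.lift.1 (F₁.monotone (hK.le_gapRight t))
  · rw [← hG.2, ← hH.lift.2.2, hconj, h₁.2, hH.lift.2.2]

/-! ### The deformed representation -/

section Deformed

variable (r : F3 →* Equiv.Perm S1) (f : Equiv.Perm S1)

theorem deformedRep_induction {P : F3 → Prop} (one : P 1) (a : P genA) (b : P genB) (c : P genC)
    (inv : ∀ γ, P γ → P γ⁻¹) (mul : ∀ γ η, P γ → P η → P (γ * η)) (γ : F3) : P γ := by
  have hof : ∀ i : Fin 3, P (FreeGroup.of i) := by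
    intro i
    fin_cases i
    · exact a
    · exact b
    · exact c
  induction γ using FreeGroup.induction_on with
  | C1 => exact one
  | of i => exact hof i
  | inv_of i _ => exact inv _ (hof i)
  | mul x y hx hy => exact mul x y hx hy

theorem deformedRep_genC : deformedRep r f genC = (r genA * r genB)⁻¹ * f := by
  simp [deformedRep, genC]

theorem exists_lift_deformedRep (hr : ∀ γ, ∃ F, IsLift F (r γ)) (hf : ∃ F, IsLift F f) (γ : F3) :
    ∃ F, IsLift F (deformedRep r f γ) := by
  induction γ using deformedRep_induction with
  | one => exact ⟨_, by rw [map_one]; exact IsLift.one⟩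
  | a => rw [deformedRep_genA]; exact hr _
  | b => rw [deformedRep_genB]; exact hr _
  | c =>
    obtain ⟨F, hF⟩ := hr (genA * genB)
    obtain ⟨G, hG⟩ := hf
    rw [deformedRep_genC, ← map_mul]
    exact ⟨_, hF.inv.mul hG⟩
  | inv γ h =>
    obtain ⟨F, hF⟩ := h
    rw [map_inv]
    exact ⟨_, hF.inv⟩
  | mul γ η h h' =>
    obtain ⟨F, hF⟩ := h
    obtain ⟨G, hG⟩ := h'
    rw [map_mul]
    exact ⟨_, hF.mul hG⟩

/-- The union of the images of an arc. -/
def orbitArc (N S : S1) : Set S1 := {x | ∃ γ, r γ x ∈ cIoo N S}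

theorem map_mem_orbitArc {N S : S1} (γ : F3) {x : S1} :
    r γ x ∈ orbitArc r N S ↔ x ∈ orbitArc r N S := by
  constructor
  · rintro ⟨η, h⟩
    exact ⟨η * γ, by rw [map_mul]; exact h⟩
  · rintro ⟨η, h⟩
    refine ⟨η * γ⁻¹, ?_⟩
    rw [← Equiv.Perm.mul_apply, ← map_mul, inv_mul_cancel_right]
    exact h

/-- The generators have the same images off the arc, and the complement of its orbit is invariant,
so the agreement passes to words. -/
theorem deformedRep_eq {N S : S1} (hf : ∀ x ∈ cIcc S N, f x = r delta1 x) (γ : F3) :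
    ∀ x, x ∉ orbitArc r N S → deformedRep r f γ x = r γ x := by
  induction γ using deformedRep_induction with
  | one => intro x _; rw [map_one, map_one]
  | a => intro x _; rw [deformedRep_genA]
  | b => intro x _; rw [deformedRep_genB]
  | c =>
    intro x hx
    have h1 : x ∈ cIcc S N := by
      rw [← compl_cIoo]
      intro h
      exact hx ⟨1, by rw [map_one]; exact h⟩
    rw [deformedRep_genC, Equiv.Perm.mul_apply, hf x h1, Equiv.Perm.inv_eq_iff_eq, delta1,
      map_mul, map_mul]
    rfl
  | inv γ h =>
    intro x hx
    rw [map_inv, Equiv.Perm.inv_eq_iff_eq]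
    rw [h _ (by rwa [map_mem_orbitArc]), ← Equiv.Perm.mul_apply, ← map_mul, mul_inv_cancel,
      map_one]
    rfl
  | mul γ η h h' =>
    intro x hx
    rw [map_mul, map_mul, Equiv.Perm.mul_apply, Equiv.Perm.mul_apply, h' x hx,
      h _ (by rwa [map_mem_orbitArc])]

end Deformed

/-! ### Invariance of the cross ratio weight -/

/-- Each of the four local factors occurs once in the numerator and once in the denominator. -/
theorem crossRatio_map {F ρ : ℝ → ℝ} (hρ : ∀ t, 0 < ρ t)
    (hF : ∀ s t, ρ s * ρ t * sinPi (F s - F t) = sinPi (s - t)) (a b s y : ℝ) :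
    crossRatio (F a) (F b) (F s) (F y) = crossRatio a b s y := by
  unfold crossRatio
  rw [← hF s a, ← hF y b, ← hF y s, ← hF b a]
  have h1 := mul_pos (mul_pos (hρ a) (hρ b)) (mul_pos (hρ s) (hρ y))
  rw [show ρ s * ρ a * sinPi (F s - F a) * (ρ y * ρ b * sinPi (F y - F b)) =
      (ρ a * ρ b * (ρ s * ρ y)) * (sinPi (F s - F a) * sinPi (F y - F b)) by ring,
    show ρ y * ρ s * sinPi (F y - F s) * (ρ b * ρ a * sinPi (F b - F a)) =
      (ρ a * ρ b * (ρ s * ρ y)) * (sinPi (F y - F s) * sinPi (F b - F a)) by ring,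
    mul_div_mul_left _ _ h1.ne']

/-- Only `s` has to move by the projective map. Of `t'` nothing is asked but that its rounding to
`K` moves correctly, which allows `t` to be moved by the deformed action. -/
theorem crossWeight_map {K : Set ℝ} {F : ℝ ≃o ℝ} {ρ : ℝ → ℝ} (hρ : ∀ t, 0 < ρ t)
    (hF : ∀ s t, ρ s * ρ t * sinPi (F s - F t) = sinPi (s - t)) (h1 : ∀ t, F (t + 1) = F t + 1)
    {s t s' t' : ℝ} (hs : s' = F s) (hl : gapLeft K s' = F (gapLeft K s))
    (hr : gapRight K s' = F (gapRight K s)) (ht : gapRight K t' = F (gapRight K t)) :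
    crossWeight K (s', t') = crossWeight K (s, t) := by
  have hc : clampRight K (s', t') = F (clampRight K (s, t)) := by
    simp only [clampRight]
    rw [ht, hl, ← h1, F.monotone.map_min]
  unfold crossWeight
  simp only
  rw [hc, hl, hr, hs, crossRatio_map hρ hF]

/-! ### One dimensional dynamics -/

/-- The derivatives make `E` positive just inside both ends, and `E` cannot change sign on either
side of its only zero. -/
theorem pos_of_unique_zero {E : ℝ → ℝ} {n p s a b : ℝ} (hnp : n < p) (hps : p < s)
    (hc : Continuous E) (hn : E n = 0) (hs : E s = 0) (hz : ∀ t ∈ Ioo n s, E t = 0 → t = p)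
    (dn : HasDerivAt E a n) (ha : 0 < a) (ds : HasDerivAt E b s) (hb : b < 0) :
    ∀ t ∈ Ioo n s, t ≠ p → 0 < E t := by
  have h1 : ∃ u ∈ Ioo n p, 0 < E u := by
    have e1 := (hasDerivAt_iff_tendsto_slope.1 dn).mono_left
      (nhdsWithin_mono n (fun x (hx : x ∈ Ioi n) => (ne_of_gt hx : x ≠ n)))
    obtain ⟨u, hu, hu'⟩ := ((e1.eventually_const_lt ha).and (Ioo_mem_nhdsGT hnp)).exists
    refine ⟨u, hu', ?_⟩
    rw [slope_def_field, hn, sub_zero] at hu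
    exact (div_pos_iff_of_pos_right (by linarith [hu'.1])).1 hu
  have h2 : ∃ u ∈ Ioo p s, 0 < E u := by
    have e1 := (hasDerivAt_iff_tendsto_slope.1 ds).mono_left
      (nhdsWithin_mono s (fun x (hx : x ∈ Iio s) => (ne_of_lt hx : x ≠ s)))
    obtain ⟨u, hu, hu'⟩ := ((e1.eventually_lt_const hb).and (Ioo_mem_nhdsLT hps)).exists
    refine ⟨u, hu', ?_⟩
    rw [slope_def_field, hs, sub_zero, div_neg_iff] at hu
    rcases hu with h | h
    · exact h.1
    · linarith [h.2, hu'.2]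
  have key : ∀ u t : ℝ, 0 < E u → (∀ x ∈ uIcc u t, x ∈ Ioo n s ∧ x ≠ p) → 0 < E t := by
    intro u t hu hx
    by_contra! ht
    have hz0 : (0 : ℝ) ∈ E '' uIcc u t := by
      apply intermediate_value_uIcc hc.continuousOn
      rw [uIcc_of_ge (ht.trans hu.le)]
      exact ⟨ht, hu.le⟩
    obtain ⟨x, hx1, hx2⟩ := hz0
    exact (hx x hx1).2 (hz x (hx x hx1).1 hx2)
  intro t ht htp
  rcases lt_or_gt_of_ne htp with h | h
  · obtain ⟨u, hu, hu'⟩ := h1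
    refine key u t hu' fun x hx => ?_
    have e1 : x ∈ Ioo n p := (ordConnected_Ioo (a := n) (b := p)).uIcc_subset hu ⟨ht.1, h⟩ hx
    exact ⟨⟨e1.1, e1.2.trans hps⟩, e1.2.ne⟩
  · obtain ⟨u, hu, hu'⟩ := h2
    refine key u t hu' fun x hx => ?_
    have e1 : x ∈ Ioo p s := (ordConnected_Ioo (a := p) (b := s)).uIcc_subset hu ⟨h, ht.2⟩ hx
    exact ⟨⟨hnp.trans e1.1, e1.2⟩, e1.1.ne'⟩

/-- A positive density multiplied by a factor larger than `1` under a map that goes away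
from `p` is unbounded at `p`. -/
theorem tendsto_atTop_of_expanding {E : ℝ ≃o ℝ} {e w : ℝ → ℝ} {p s μ : ℝ} (hps : p < s)
    (hp : E p = p) (hs : E s = s) (hE : ∀ t ∈ Ioo p s, t < E t) (hw : ContinuousOn w (Ioo p s))
    (hw0 : ∀ t ∈ Ioo p s, 0 < w t) (he : Tendsto e (𝓝[>] p) (𝓝 μ)) (hμ : 1 < μ)
    (heq : ∀ t ∈ Ioo p s, w (E t) * e t = w t) : Tendsto w (𝓝[>] p) atTop := by
  -- Between `p` and a suitable `u` the factor `e` exceeds a fixed `l > 1`. An orbit leaving `p`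
  -- first passes `u` inside the compact fundamental domain `[u, E u]`, where `w` has a positive
  -- minimum. If it takes `j` steps, the initial value of `w` is at least `l ^ j` times this
  -- minimum.
  obtain ⟨l, hl1, hl2⟩ := exists_between hμ
  obtain ⟨v, hv, hv'⟩ := mem_nhdsGT_iff_exists_Ioo_subset.1
    ((he.eventually_const_lt hl2).and (Ioo_mem_nhdsGT hps))
  set u := min v ((p + s) / 2) with hu
  have hpu : p < u := lt_min hv (by linarith)
  have hus : u < s := (min_le_right _ _).trans_lt (by linarith)
  have hle : ∀ t ∈ Ioo p u, l < e t := fun t ht => (hv' ⟨ht.1, ht.2.trans_le (min_le_left _ _)⟩).1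
  have hiter : ∀ t ∈ Ioo p s, ∀ j : ℕ, E^[j] t ∈ Ioo p s := by
    intro t ht j
    induction j with
    | zero => exact ht
    | succ j ih =>
      rw [Function.iterate_succ_apply']
      exact ⟨by rw [← hp]; exact E.strictMono ih.1, by rw [← hs]; exact E.strictMono ih.2⟩
  have hmono : ∀ t ∈ Ioo p s, Monotone fun j : ℕ => E^[j] t := by
    intro t ht
    refine monotone_nat_of_le_succ fun j => ?_
    rw [Function.iterate_succ_apply']
    exact (hE _ (hiter t ht j)).le
  have hEu : E u ∈ Ioo p s := hiter u ⟨hpu, hus⟩ 1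
  have hsub : Icc u (E u) ⊆ Ioo p s := fun x hx => ⟨hpu.trans_le hx.1, hx.2.trans_lt hEu.2⟩
  obtain ⟨x₀, hx₀, hmin⟩ := isCompact_Icc.exists_isMinOn
    (nonempty_Icc.2 (hE u ⟨hpu, hus⟩).le) (hw.mono hsub)
  have hm : 0 < w x₀ := hw0 _ (hsub hx₀)
  have hgrow : ∀ j : ℕ, ∀ t ∈ Ioo p s, (∀ i < j, E^[i] t < u) → l ^ j * w (E^[j] t) ≤ w t := by
    intro j
    induction j with
    | zero => intro t _ _; simp
    | succ j ih =>
      intro t ht hi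
      have h1 := ih t ht fun i hij => hi i (hij.trans (Nat.lt_succ_self j))
      have h2 := hiter t ht j
      have h3 := heq _ h2
      have h4 := hle _ ⟨h2.1, hi j (Nat.lt_succ_self j)⟩
      have h5 := hw0 _ (hiter t ht (j + 1))
      rw [Function.iterate_succ_apply'] at h5 ⊢
      have h6 : l * w (E (E^[j] t)) ≤ w (E^[j] t) := by
        rw [← h3, mul_comm]
        exact mul_le_mul_of_nonneg_left h4.le h5.le
      calc l ^ (j + 1) * w (E (E^[j] t)) = l ^ j * (l * w (E (E^[j] t))) := by ring
        _ ≤ l ^ j * w (E^[j] t) := mul_le_mul_of_nonneg_left h6 (by positivity)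
        _ ≤ w t := h1
  -- An orbit remaining below `u` would increase to a fixed point in `(p, s)`, where `E` has none.
  have hexit : ∀ t ∈ Ioo p s, ∃ j : ℕ, u ≤ E^[j] t := by
    intro t ht
    by_contra! h
    have hbdd : BddAbove (range fun j : ℕ => E^[j] t) := ⟨u, by
      rintro _ ⟨j, rfl⟩
      exact (h j).le⟩
    have hlim := tendsto_atTop_ciSup (hmono t ht) hbdd
    have h1 : t ≤ ⨆ j : ℕ, E^[j] t := le_ciSup hbdd 0
    have h2 : ⨆ j : ℕ, E^[j] t ≤ u := ciSup_le fun j => (h j).le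
    have h3 := isFixedPt_of_tendsto_iterate hlim E.continuous.continuousAt
    have h4 := hE (⨆ j : ℕ, E^[j] t) ⟨ht.1.trans_le h1, h2.trans_lt hus⟩
    exact absurd h3 h4.ne'
  rw [tendsto_atTop]
  intro C
  obtain ⟨k, hk⟩ := ((tendsto_pow_atTop_atTop_of_one_lt hl1).eventually_ge_atTop
    (C / w x₀)).exists
  -- Points close enough to `p` are still below `u` after `k` steps, so their exit time is at least
  -- `k`.
  have hcont : Tendsto E^[k] (𝓝[>] p) (𝓝 p) := by
    have h1 := (E.continuous.iterate k).tendsto p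
    rw [Function.iterate_fixed hp] at h1
    exact h1.mono_left nhdsWithin_le_nhds
  filter_upwards [hcont.eventually_lt_const hpu, Ioo_mem_nhdsGT hpu] with t ht1 ht2
  have ht : t ∈ Ioo p s := ⟨ht2.1, ht2.2.trans hus⟩
  classical
  have hfind := Nat.find_spec (hexit t ht)
  set j := Nat.find (hexit t ht) with hj
  have hlt : ∀ i < j, E^[i] t < u := fun i hi => not_le.1 (Nat.find_min (hexit t ht) hi)
  have hkj : k ≤ j := by
    by_contra! h
    exact absurd (hfind.trans (hmono t ht h.le)) (not_le.2 ht1)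
  have hj0 : j ≠ 0 := by
    intro h0
    rw [h0] at hfind
    exact absurd ht2.2 (not_lt.2 hfind)
  obtain ⟨i, hi⟩ := Nat.exists_eq_succ_of_ne_zero hj0
  have hle2 : E^[j] t ≤ E u := by
    rw [hi, Function.iterate_succ_apply']
    exact E.monotone (hlt i (by omega)).le
  have h1 := hgrow j t ht hlt
  have h2 : w x₀ ≤ w (E^[j] t) := hmin ⟨hfind, hle2⟩
  have h3 : l ^ k ≤ l ^ j := pow_le_pow_right₀ hl1.le hkj
  calc C = C / w x₀ * w x₀ := by field_simp
    _ ≤ l ^ k * w x₀ := mul_le_mul_of_nonneg_right hk hm.le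
    _ ≤ l ^ j * w (E^[j] t) := mul_le_mul h3 h2 hm.le (by positivity)
    _ ≤ w t := h1

/-! ### The modified diffeomorphism on its arc -/

theorem _root_.HasDerivAt.eq_of_eqOn_Icc {F G : ℝ → ℝ} {a b x c d : ℝ} (hab : a < b)
    (hx : x ∈ Icc a b) (hF : HasDerivAt F c x) (hG : HasDerivAt G d x)
    (h : ∀ t ∈ Icc a b, F t = G t) : c = d := by
  have h1 := hF.hasDerivWithinAt (s := Icc a b)
  have h2 := (hG.hasDerivWithinAt (s := Icc a b)).congr h (h x hx)
  exact (uniqueDiffOn_Icc hab x hx).eq_deriv _ h1 h2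

/-- The lift of the modified diffeomorphism that fixes the ends of the arc, with its fixed point
and its derivatives. -/
theorem exists_modification_lift {g f : Equiv.Perm S1} {n s μ : ℝ} (hns : n < s)
    (hs : s < n + 1) {G : ℝ ≃o ℝ} (hG : IsLift G g) (hGn : G n = n) (hGs : G s = s)
    (dn : HasDerivAt G μ n) (ds : HasDerivAt G μ⁻¹ s) (hμ0 : 0 < μ) (hμ : μ ≠ 1)
    (hf : IsModificationOn (n : S1) (s : S1) g f) :
    ∃ (F : ℝ ≃o ℝ) (p : ℝ), IsLift F f ∧ p ∈ Ioo n s ∧ F n = n ∧ F p = p ∧ F s = s ∧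
      Continuous (deriv F) ∧ (∀ t, 0 < deriv F t) ∧ (∀ t, HasDerivAt F (deriv F t) t) ∧
      deriv F p = 1 ∧
      ((1 < μ ∧ ∀ t ∈ Ioo p s, t < F t) ∨ (μ < 1 ∧ ∀ t ∈ Ioo p s, F t < t)) := by
  obtain ⟨⟨F₀, hsm, hd0, hF1, hFl⟩, hfg, P, ⟨hP, hfP⟩, hPu⟩ := hf
  have hdiff : Differentiable ℝ F₀ := hsm.differentiable (by simp)
  obtain ⟨F', hF'⟩ := exists_orderIso_of_degree_one hdiff.continuous
    (strictMono_of_deriv_pos hd0) hF1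
  have hF'l : IsLift F' f := ⟨fun t => by rw [hF', hF', hF1], fun t => by rw [hF', hFl]⟩
  have hcIcc : ∀ t, t ∈ Icc s (n + 1) → (t : S1) ∈ cIcc (s : S1) (n : S1) := by
    intro t ht
    rw [← compl_cIoo]
    intro h
    rcases ht.2.lt_or_eq with h1 | h1
    · have := (mem_cIoo_iff hns hs ⟨hns.le.trans ht.1, h1⟩).1 h
      linarith [this.2, ht.1]
    · have e : (t : S1) = (n : S1) := by rw [h1]; simp
      rw [e] at h
      exact lt_irrefl _ ((mem_cIoo_iff hns hs ⟨le_rfl, by linarith⟩).1 h).1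
  have hfn : f (n : S1) = (n : S1) := by
    rw [hfg _ (right_mem_cIcc _ _), hG.2, hGn]
  rw [hF'l.2] at hfn
  obtain ⟨k, hk⟩ := coe_eq_coe_iff.1 hfn
  obtain ⟨F, hF, hFF⟩ := hF'l.add_int (-k)
  have hFn : F n = n := by rw [hFF, hk]; push_cast; ring
  have hFn1 : F (n + 1) = n + 1 := by rw [hF.1, hFn]
  have hGn1 : G (n + 1) = n + 1 := by rw [hG.1, hGn]
  have hIco : ∀ {x y : ℝ}, x ∈ Ico n (n + 1) → y ∈ Ico n (n + 1) → (x : S1) = (y : S1) → x = y :=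
    fun hx hy h => (AddCircle.coe_eq_coe_iff_of_mem_Ico (p := (1 : ℝ)) hx hy).1 h
  have hmem : ∀ {t : ℝ}, t ∈ Ico n (n + 1) → F t ∈ Ico n (n + 1) := fun {t} ht =>
    ⟨by rw [← hFn]; exact F.monotone ht.1, by rw [← hFn1]; exact F.strictMono ht.2⟩
  have hsI : s ∈ Ico n (n + 1) := ⟨hns.le, hs⟩
  have hFs : F s = s := by
    refine hIco (hmem hsI) hsI ?_
    rw [← hF.2, hfg _ (left_mem_cIcc _ _), hG.2, hGs]
  have hFG : ∀ t ∈ Icc s (n + 1), F t = G t := by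
    intro t ht
    refine eq_of_coe_eq (a := s) (b := n + 1) (by linarith) ⟨?_, ?_⟩ ⟨?_, ?_⟩ ?_
    · rw [← hFs]; exact F.monotone ht.1
    · rw [← hFn1]; exact F.monotone ht.2
    · rw [← hGs]; exact G.monotone ht.1
    · rw [← hGn1]; exact G.monotone ht.2
    · rw [← hF.2, ← hG.2, hfg _ (hcIcc t ht)]
  have hFG' : ∀ t ∈ Icc (s - 1) n, F t = G t := by
    intro t ht
    have := hFG (t + 1) ⟨by linarith [ht.1], by linarith [ht.2]⟩
    rw [hF.1, hG.1] at this
    linarith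
  have hd : ∀ t, HasDerivAt F (deriv F₀ t) t := by
    intro t
    have h1 : HasDerivAt (fun t => F₀ t + ((-k : ℤ) : ℝ)) (deriv F₀ t) t :=
      (hdiff t).hasDerivAt.add_const _
    exact h1.congr_of_eventuallyEq (Eventually.of_forall fun t => by rw [hFF, hF'])
  have hderiv : deriv F = deriv F₀ := funext fun t => (hd t).deriv
  obtain ⟨p, hpI, rfl⟩ : ∃ p ∈ Ico n (n + 1), (p : S1) = P := by
    have := AddCircle.coe_image_Ico_eq (1 : ℝ) n
    have h' : P ∈ ((↑) : ℝ → S1) '' Ico n (n + 1) := by rw [this]; trivial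
    exact h'
  have hp := (mem_cIoo_iff hns hs hpI).1 hP
  have hFp : F p = p := by
    refine hIco (hmem hpI) hpI ?_
    rw [← hF.2, hfP]
  have huniq : ∀ t ∈ Ioo n s, F t = t → t = p := by
    intro t ht hFt
    have htI : t ∈ Ico n (n + 1) := ⟨ht.1.le, ht.2.trans hs⟩
    refine hIco htI hpI (hPu _ ⟨(mem_cIoo_iff hns hs htI).2 ht, ?_⟩)
    rw [hF.2, hFt]
  -- The lifts agree only on one side of each end, but both are differentiable there, so one-sided
  -- agreement determines the derivative.
  have dFn : HasDerivAt F μ n := by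
    have := (hd n).eq_of_eqOn_Icc (show s - 1 < n by linarith) ⟨by linarith, le_rfl⟩ dn hFG'
    rw [← this]; exact hd n
  have dFs : HasDerivAt F μ⁻¹ s := by
    have := (hd s).eq_of_eqOn_Icc hs ⟨le_rfl, hs.le⟩ ds hFG
    rw [← this]; exact hd s
  refine ⟨F, p, hF, hp, hFn, hFp, hFs, ?_, fun t => by rw [hderiv]; exact hd0 t,
    fun t => by rw [hderiv]; exact hd t, ?_⟩
  · rw [hderiv]
    exact hsm.continuous_deriv (by simp)
  rw [hderiv]
  have hFc := F.continuous
  rcases lt_or_gt_of_ne hμ with h | h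
  -- The multipliers at the two ends are inverse, so the displacement has the same sign near both
  -- and throughout the arc except at `p`. Hence `p` is a local extremum of the displacement and the
  -- derivative of `F` there is 1.
  · have hpos := pos_of_unique_zero (E := fun t => t - F t) hp.1 hp.2 (by fun_prop)
      (by simp [hFn]) (by simp [hFs])
      (fun t ht h0 => huniq t ht (by linarith)) ((hasDerivAt_id n).sub dFn) (by linarith)
      ((hasDerivAt_id s).sub dFs) (by linarith [(one_lt_inv₀ hμ0).2 h])
    refine ⟨?_, Or.inr ⟨h, fun t ht => ?_⟩⟩
    · have hmin : IsLocalMin (fun t => t - F t) p := by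
        filter_upwards [Ioo_mem_nhds hp.1 hp.2] with t ht
        rw [hFp, sub_self]
        by_cases htp : t = p
        · simp [htp, hFp]
        · exact (hpos t ht htp).le
      have := hmin.hasDerivAt_eq_zero ((hasDerivAt_id p).sub (hd p))
      linarith
    · have := hpos t ⟨hp.1.trans ht.1, ht.2⟩ ht.1.ne'
      linarith
  · have hpos := pos_of_unique_zero (E := fun t => F t - t) hp.1 hp.2 (by fun_prop)
      (by simp [hFn]) (by simp [hFs])
      (fun t ht h0 => huniq t ht (by linarith)) (dFn.sub (hasDerivAt_id n)) (by linarith)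
      (dFs.sub (hasDerivAt_id s)) (by linarith [inv_lt_one_of_one_lt₀ h])
    refine ⟨?_, Or.inl ⟨h, fun t ht => ?_⟩⟩
    · have hmin : IsLocalMin (fun t => F t - t) p := by
        filter_upwards [Ioo_mem_nhds hp.1 hp.2] with t ht
        rw [hFp, sub_self]
        by_cases htp : t = p
        · simp [htp, hFp]
        · exact (hpos t ht htp).le
      have := hmin.hasDerivAt_eq_zero ((hd p).sub (hasDerivAt_id p))
      linarith
    · have := hpos t ⟨hp.1.trans ht.1, ht.2⟩ ht.1.ne'
      linarith

/-! ### Weights on the gaps where the monotone map is constant -/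

/-- The cross ratio of `c`, `x`, `d`, `t` with respect to the density `W`. -/
def densityRatio (W : ℝ × ℝ → ℝ) (c d x t : ℝ) : ℝ :=
  W (c, d) * W (x, t) / (W (c, t) * W (x, d))

/-- The map `H` is constant, equal to `P`, on the gap `(c, d)`, and the density ratio vanishes on
the right of `P`. -/
structure IsSplitGap (K : Set ℝ) (H : ℝ → ℝ) (W : ℝ × ℝ → ℝ) (c d P : ℝ) : Prop where
  left_lt : c < P
  lt_right : P < d
  const : ∀ t ∈ Ioo c d, H t = P
  tendsto : ∀ x ∈ K, d - 1 < x → x < c → Tendsto (densityRatio W c d x) (𝓝[>] P) (𝓝 0)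

/-- The weight of the right end of the gap of `q.1`, given by the density ratio. -/
def ratioWeight (K : Set ℝ) (H : ℝ → ℝ) (W : ℝ × ℝ → ℝ) (q : ℝ × ℝ) : ℝ :=
  if q.1 ≤ H q.1 then 0 else
    cutoff (densityRatio W (gapLeft K q.1) (gapRight K q.1) (clampRight K q - 1) q.1)

open Classical in
/-- The weight given by the density ratio over `O` and by the cross ratio elsewhere. -/
def mixedWeight (K O : Set ℝ) (H : ℝ → ℝ) (W : ℝ × ℝ → ℝ) (q : ℝ × ℝ) : ℝ :=
  if q.1 ∈ O then ratioWeight K H W q else crossWeight K q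

section Split

variable {K : Set ℝ} {h : S1 → S1} {H : ℝ → ℝ} {c d P : ℝ}

theorem mem_strip_of_lt (hK : IsPerfectPeriodic K) (hH : IsNormalLift K h H) (hc : c ∈ K)
    (hd : RAcc K d) {x t : ℝ} (hx : d - 1 < x) (hxc : x < c) (ht : c < t) (htd : t ≤ d) :
    (x, t) ∈ strip H := by
  refine ⟨⟨c, hxc, by rw [hH.eq_self c hc]; exact ht⟩, ?_⟩
  obtain ⟨w, hw, h1, h2⟩ := hd (x + 1 - d) (by linarith)
  refine ⟨w - 1, by simp only; linarith, ?_⟩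
  rw [hH.eq_self _ ((hK.sub_one w).2 hw)]
  simp only; linarith

theorem mem_strip_of_le (hK : IsPerfectPeriodic K) (hH : IsNormalLift K h H)
    (hd : RAcc K d) (hconst : ∀ t ∈ Ioo c d, H t = P) {x t : ℝ} (hcd : c < d) (hx : d - 1 < x)
    (hxc : x ≤ c) (ht : P < t) (htd : t ≤ d) : (x, t) ∈ strip H := by
  obtain ⟨y, hy⟩ := exists_between hcd
  refine ⟨⟨y, by simp only; linarith [hy.1], by rw [hconst y hy]; exact ht⟩, ?_⟩
  obtain ⟨w, hw, h1, h2⟩ := hd (x + 1 - d) (by linarith)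
  refine ⟨w - 1, by simp only; linarith, ?_⟩
  rw [hH.eq_self _ ((hK.sub_one w).2 hw)]
  simp only; linarith

theorem lt_of_mem_strip (hm : Monotone H) (h1 : ∀ t, H (t + 1) = H t + 1) (hcd : c < d)
    (hconst : ∀ t ∈ Ioo c d, H t = P) {s t : ℝ} (hp : (s, t) ∈ strip H) (hs : s ≤ d - 1) :
    t < P := by
  obtain ⟨-, y, hy, hyt⟩ := hp
  simp only at hy hyt
  obtain ⟨z, hz1, hz2⟩ := exists_between (max_lt hcd (show y + 1 < d by linarith))
  rw [max_lt_iff] at hz1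
  have h2 := hm hz1.2.le
  rw [h1, hconst z ⟨hz1.1, hz2⟩] at h2
  linarith

theorem gt_of_mem_strip (hm : Monotone H) (hcd : c < d)
    (hconst : ∀ t ∈ Ioo c d, H t = P) {s t : ℝ} (hp : (s, t) ∈ strip H) (hs : c ≤ s) :
    P < t := by
  obtain ⟨⟨y, hy, hyt⟩, -⟩ := hp
  simp only at hy hyt
  obtain ⟨z, hz1, hz2⟩ := exists_between (lt_min hcd (lt_of_le_of_lt hs hy))
  rw [lt_min_iff] at hz2
  have h2 := hm hz2.2.le
  rw [hconst z ⟨hz1, hz2.1⟩] at h2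
  linarith

theorem continuousAt_densityRatio {U : Set (ℝ × ℝ)} (hU : IsOpen U) {W : ℝ × ℝ → ℝ}
    (hW : ContinuousOn W U) (hW0 : ∀ p ∈ U, W p ≠ 0) {x t : ℝ}
    (h1 : (x, t) ∈ U) (h2 : (c, t) ∈ U) (h3 : (x, d) ∈ U) :
    ContinuousAt (fun z : ℝ × ℝ => densityRatio W c d z.1 z.2) (x, t) := by
  have hc : ∀ q ∈ U, ContinuousAt W q := fun q hq => hW.continuousAt (hU.mem_nhds hq)
  unfold densityRatio
  refine ContinuousAt.div (continuousAt_const.mul ?_) (ContinuousAt.mul ?_ ?_)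
    (mul_ne_zero (hW0 _ h2) (hW0 _ h3))
  · exact ContinuousAt.comp (x := (x, t)) (f := fun z : ℝ × ℝ => (z.1, z.2)) (hc _ h1)
      (by fun_prop)
  · exact ContinuousAt.comp (x := (x, t)) (f := fun z : ℝ × ℝ => (c, z.2)) (hc _ h2)
      (by fun_prop)
  · exact ContinuousAt.comp (x := (x, t)) (f := fun z : ℝ × ℝ => (z.1, d)) (hc _ h3)
      (by fun_prop)

/-- Each Jacobian factor at `c`, `x`, `d`, `t` occurs once above and once below. No projective
structure is needed, so this ratio can replace the cross ratio where `F₂` is not projective. -/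
theorem densityRatio_map {U : Set (ℝ × ℝ)} {W : ℝ × ℝ → ℝ} (hW0 : ∀ p ∈ U, W p ≠ 0)
    {F₁ F₂ d₁ d₂ : ℝ → ℝ}
    (hW : ∀ x y, (x, y) ∈ U → (x ∈ K ∨ y ∈ K) → W (F₁ x, F₂ y) * (d₁ x * d₂ y) = W (x, y))
    {x t : ℝ} (hc : c ∈ K) (hx : x ∈ K)
    (h1 : (x, t) ∈ U) (h2 : (c, t) ∈ U) (h3 : (x, d) ∈ U) (h4 : (c, d) ∈ U) :
    densityRatio W (F₁ c) (F₂ d) (F₁ x) (F₂ t) = densityRatio W c d x t := by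
  have e1 := hW _ _ h1 (Or.inl hx)
  have e2 := hW _ _ h2 (Or.inl hc)
  have e3 := hW _ _ h3 (Or.inl hx)
  have e4 := hW _ _ h4 (Or.inl hc)
  have n1 := hW0 _ h1
  have n2 := hW0 _ h2
  have n3 := hW0 _ h3
  have n4 := hW0 _ h4
  unfold densityRatio
  rw [← e1, ← e2, ← e3, ← e4]
  rw [← e1] at n1
  rw [← e2] at n2
  rw [← e3] at n3
  rw [← e4] at n4
  have m1 := left_ne_zero_of_mul (right_ne_zero_of_mul n1)
  have m2 := right_ne_zero_of_mul (right_ne_zero_of_mul n1)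
  have m3 := left_ne_zero_of_mul (right_ne_zero_of_mul n4)
  have m4 := right_ne_zero_of_mul (right_ne_zero_of_mul n4)
  have m5 := left_ne_zero_of_mul n2
  have m6 := left_ne_zero_of_mul n3
  field_simp

end Split

/-- The set `O` is a union of gaps over which `H` is constant. -/
structure IsSplitSet (K O : Set ℝ) (H : ℝ → ℝ) (W : ℝ × ℝ → ℝ) : Prop where
  notMem : ∀ t ∈ O, t ∉ K
  gap : ∀ t ∈ O, ∀ t' ∈ Ioo (gapLeft K t) (gapRight K t), t' ∈ O
  split : ∀ t ∈ O, ∃ P, IsSplitGap K H W (gapLeft K t) (gapRight K t) P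

theorem IsSplitSet.eventually_mem_iff {K O : Set ℝ} {H : ℝ → ℝ} {W : ℝ × ℝ → ℝ}
    (hK : IsPerfectPeriodic K) (hO : IsSplitSet K O H W) {t : ℝ} (ht : t ∉ K) :
    ∀ᶠ t' in 𝓝 t, t' ∈ O ↔ t ∈ O := by
  filter_upwards [Ioo_mem_nhds (hK.gapLeft_lt ht) (hK.lt_gapRight ht)] with t' ht'
  constructor
  · intro h
    refine hO.gap t' h t ?_
    rw [hK.gapLeft_eq_of_mem ht'.1 ht'.2, hK.gapRight_eq_of_mem ht'.1 ht'.2]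
    exact ⟨hK.gapLeft_lt ht, hK.lt_gapRight ht⟩
  · intro h
    exact hO.gap t h t' ht'

section Weight

variable {K O : Set ℝ} {h : S1 → S1} {H : ℝ → ℝ} {W : ℝ × ℝ → ℝ}

/-- In swapped coordinates the hypothesis places the original first coordinate at or before `d - 1`,
where the top of the strip is at most `P`; the weight is zero by definition to the left of `P`. -/
theorem ratioWeight_below (hK : IsPerfectPeriodic K) (hH : IsNormalLift K h H) {p : ℝ × ℝ}
    (hp : p ∈ swapStrip (strip H)) (ht : p.1 ∉ K) {P : ℝ}
    (hs : IsSplitGap K H W (gapLeft K p.1) (gapRight K p.1) P) (hle : p.2 ≤ gapRight K p.1) :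
    ∀ᶠ q in 𝓝 p, ratioWeight K H W q = 0 := by
  have hcd := hs.left_lt.trans hs.lt_right
  have h1 : p.1 < P := lt_of_mem_strip hH.lift.1 hH.lift.2.1 hcd hs.const hp (by linarith)
  filter_upwards [(continuous_fst.tendsto p).eventually
    (Ioo_mem_nhds (hK.gapLeft_lt ht) h1)] with q hq
  unfold ratioWeight
  rw [if_pos]
  rw [hs.const _ ⟨hq.1, hq.2.trans hs.lt_right⟩]
  exact hq.2.le

/-- Here the clamped point `x` is close to the left end `c` of the gap, and the density ratio is 1
when `x = c`. -/
theorem ratioWeight_above (hK : IsPerfectPeriodic K) (hH : IsNormalLift K h H)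
    (hW : ContinuousOn W (strip H)) (hW0 : ∀ p ∈ strip H, W p ≠ 0) {p : ℝ × ℝ}
    (hp : p ∈ swapStrip (strip H)) (ht : p.1 ∉ K) {P : ℝ}
    (hs : IsSplitGap K H W (gapLeft K p.1) (gapRight K p.1) P)
    (hle : gapLeft K p.1 + 1 ≤ p.2) : ∀ᶠ q in 𝓝 p, ratioWeight K H W q = 1 := by
  have hcd := hs.left_lt.trans hs.lt_right
  have h1 : P < p.1 := gt_of_mem_strip hH.lift.1 hcd hs.const hp (by linarith)
  have h2 := hK.lt_gapRight ht
  have h3 := hK.gapRight_lt p.1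
  have hacc := hK.rAcc_gapRight ht
  have m1 : (gapLeft K p.1, p.1) ∈ strip H :=
    mem_strip_of_le hK hH hacc hs.const hcd (by linarith) le_rfl h1 h2.le
  have m2 : (gapLeft K p.1, gapRight K p.1) ∈ strip H :=
    mem_strip_of_le hK hH hacc hs.const hcd (by linarith) le_rfl hs.lt_right le_rfl
  have hc := continuousAt_densityRatio (hH.isStrip hK).isOpen hW hW0 m1 m1 m2
  have hy : Tendsto (fun q : ℝ × ℝ => (min (gapRight K q.2) (gapLeft K p.1 + 1) - 1, q.1)) (𝓝 p)
      (𝓝 (gapLeft K p.1, p.1)) := by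
    refine Tendsto.prodMk_nhds ?_ (continuous_fst.tendsto p)
    have := (hK.tendsto_min_gapRight (s₀ := p.1) hle).sub_const 1
    rwa [add_sub_cancel_right] at this
  have hv : (2 : ℝ) / 3 < densityRatio W (gapLeft K p.1) (gapRight K p.1) (gapLeft K p.1) p.1 := by
    unfold densityRatio
    rw [mul_comm, div_self (mul_ne_zero (hW0 _ m1) (hW0 _ m2))]
    norm_num
  filter_upwards [(hc.tendsto.comp hy).eventually_const_lt hv,
    (continuous_fst.tendsto p).eventually (hK.eventually_gap ht),
    (continuous_fst.tendsto p).eventually (Ioo_mem_nhds h1 h2)] with q hq hq' hq''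
  unfold ratioWeight clampRight
  rw [if_neg, hq'.2.1, hq'.2.2]
  · exact cutoff_eq_one hq.le
  · rw [hs.const _ ⟨hs.left_lt.trans hq''.1, hq''.2⟩, not_le]
    exact hq''.1

theorem continuousAt_ratioWeight (hK : IsPerfectPeriodic K) (hH : IsNormalLift K h H)
    (hW : ContinuousOn W (strip H)) (hW0 : ∀ p ∈ strip H, W p ≠ 0) {p : ℝ × ℝ}
    (hp : p ∈ swapStrip (strip H)) (ht : p.1 ∉ K) (hu : p.2 ∉ K) {P : ℝ}
    (hs : IsSplitGap K H W (gapLeft K p.1) (gapRight K p.1) P) :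
    ContinuousAt (ratioWeight K H W) p := by
  rcases le_or_gt p.2 (gapRight K p.1) with hle | hlt
  · refine (continuousAt_const (y := (0 : ℝ))).congr ?_
    filter_upwards [ratioWeight_below hK hH hp ht hs hle] with q hq using hq.symm
  rcases le_or_gt (gapLeft K p.1 + 1) p.2 with hle | hlt'
  · refine (continuousAt_const (y := (1 : ℝ))).congr ?_
    filter_upwards [ratioWeight_above hK hH hW hW0 hp ht hs hle] with q hq using hq.symm
  have hcd := hs.left_lt.trans hs.lt_right
  have h1 := hK.gapLeft_lt ht
  have h2 := hK.lt_gapRight ht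
  have h3 := hK.gapRight_lt p.1
  have hacc := hK.rAcc_gapRight ht
  have hxK : clampRight K p - 1 ∈ K := by
    rw [hK.sub_one]
    unfold clampRight
    rcases min_choice (gapRight K p.2) (gapLeft K p.1 + 1) with e | e <;> rw [e]
    · exact hK.gapRight_mem _
    · exact (hK.add_one _).2 (hK.gapLeft_mem _)
  have hx1 : gapRight K p.1 - 1 < clampRight K p - 1 := by
    refine sub_lt_sub_right (lt_min (hlt.trans (hK.lt_gapRight hu)) h3) _
  have hx2 : clampRight K p - 1 < gapLeft K p.1 := by
    obtain ⟨w, hw, hw1, hw2⟩ := (hK.lAcc_add_one.2 (hK.lAcc_gapLeft ht))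
      (gapLeft K p.1 + 1 - p.2) (by linarith)
    have := IsPerfectPeriodic.gapRight_le hw (show p.2 ≤ w by linarith)
    have h4 := min_le_left (gapRight K p.2) (gapLeft K p.1 + 1)
    unfold clampRight
    linarith
  have hev : ∀ᶠ q in 𝓝 p, ratioWeight K H W q = if q.1 ≤ P then 0 else
      cutoff (densityRatio W (gapLeft K p.1) (gapRight K p.1) (clampRight K p - 1) q.1) := by
    filter_upwards [(continuous_fst.tendsto p).eventually (hK.eventually_gap ht),
      (continuous_snd.tendsto p).eventually (hK.eventually_gap hu),
      (continuous_fst.tendsto p).eventually (Ioo_mem_nhds h1 h2)] with q hq hq' hq''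
    unfold ratioWeight clampRight
    rw [hq.2.1, hq.2.2, hq'.2.2, hs.const _ hq'']
  have hlim := (hs.tendsto _ hxK hx1 hx2).eventually_lt_const (u := 1 / 3) (by norm_num)
  rw [eventually_nhdsWithin_iff] at hlim
  -- The formula changes at `P`. The weight is zero on the left, and on the right the ratio tends to
  -- 0, so the cutoff makes it zero on a whole neighbourhood of `P`.
  rcases lt_trichotomy p.1 P with hP | hP | hP
  · refine (continuousAt_const (y := (0 : ℝ))).congr ?_
    filter_upwards [hev, (continuous_fst.tendsto p).eventually (Iio_mem_nhds hP)] with q hq hq'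
    rw [hq, if_pos hq'.le]
  · refine (continuousAt_const (y := (0 : ℝ))).congr ?_
    rw [← hP] at hlim
    filter_upwards [hev, (continuous_fst.tendsto p).eventually hlim] with q hq hq'
    rw [hq]
    split_ifs with hle
    · rfl
    · rw [cutoff_eq_zero]
      exact (hq' (by rw [hP]; exact not_le.1 hle)).le
  · have m1 : (clampRight K p - 1, p.1) ∈ strip H :=
      mem_strip_of_le hK hH hacc hs.const hcd hx1 hx2.le hP h2.le
    have m2 : (gapLeft K p.1, p.1) ∈ strip H :=
      mem_strip_of_le hK hH hacc hs.const hcd (by linarith) le_rfl hP h2.le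
    have m3 : (clampRight K p - 1, gapRight K p.1) ∈ strip H :=
      mem_strip_of_le hK hH hacc hs.const hcd hx1 hx2.le hs.lt_right le_rfl
    have hc := continuousAt_densityRatio (hH.isStrip hK).isOpen hW hW0 m1 m2 m3
    have hc2 : ContinuousAt (fun q : ℝ × ℝ => cutoff (densityRatio W (gapLeft K p.1)
        (gapRight K p.1) (clampRight K p - 1) q.1)) p :=
      continuous_cutoff.continuousAt.comp (ContinuousAt.comp (x := p)
        (f := fun q : ℝ × ℝ => (clampRight K p - 1, q.1)) hc (by fun_prop))
    refine hc2.congr ?_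
    filter_upwards [hev, (continuous_fst.tendsto p).eventually (Ioi_mem_nhds hP)] with q hq hq'
    rw [hq, if_neg (not_le.2 hq')]

/-- At the right end of the gap the density ratio is 1 for every `x`; compactness of the range of
`x` makes the estimate uniform near that end. -/
theorem ratioWeight_near_right (hK : IsPerfectPeriodic K) (hH : IsNormalLift K h H)
    (hW : ContinuousOn W (strip H)) (hW0 : ∀ p ∈ strip H, W p ≠ 0) {p : ℝ × ℝ}
    (hp : p ∈ swapStrip (strip H)) {a P : ℝ} (ha : a ∈ K) (hb : p.1 ∈ K) (hab : p.1 < a + 1)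
    (hgap : ∀ x ∈ Ioo a p.1, x ∉ K) (hacc : RAcc K p.1) (hs : IsSplitGap K H W a p.1 P) :
    ∀ᶠ q in 𝓝 p, q.1 < p.1 → ratioWeight K H W q = 1 := by
  have hcd := hs.left_lt.trans hs.lt_right
  have hbu : p.1 < p.2 := ((hH.isStrip hK).swap hK).lt (s := p.1) (t := p.2) hp hb le_rfl
  obtain ⟨m, hm, hm'⟩ := exists_between (lt_min hbu hab)
  rw [lt_min_iff] at hm'
  have hmem : ∀ x ∈ Icc (m - 1) a, (x, p.1) ∈ strip H := fun x hx =>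
    mem_strip_of_le hK hH hacc hs.const hcd (by linarith [hx.1]) hx.2 hs.lt_right le_rfl
  have m2 : (a, p.1) ∈ strip H := hmem a ⟨by linarith, le_rfl⟩
  have key : ∀ᶠ t in 𝓝 p.1, ∀ x ∈ Icc (m - 1) a, 2 / 3 < densityRatio W a p.1 x t := by
    apply isCompact_Icc.eventually_forall_of_forall_eventually
    intro x hx
    have hc := continuousAt_densityRatio (hH.isStrip hK).isOpen hW hW0 (hmem x hx) m2 (hmem x hx)
    have hc' : ContinuousAt (fun z : ℝ × ℝ => densityRatio W a p.1 z.2 z.1) (p.1, x) :=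
      ContinuousAt.comp (x := (p.1, x)) (f := fun z : ℝ × ℝ => (z.2, z.1)) hc (by fun_prop)
    refine hc'.eventually_const_lt ?_
    simp only [densityRatio]
    rw [div_self (mul_ne_zero (hW0 _ m2) (hW0 _ (hmem x hx)))]
    norm_num
  filter_upwards [(continuous_fst.tendsto p).eventually key,
    (continuous_fst.tendsto p).eventually (Ioi_mem_nhds hs.lt_right),
    (continuous_snd.tendsto p).eventually (Ioi_mem_nhds hm'.1)] with q hq hq' hq'' hlt
  have hqI : q.1 ∈ Ioo a p.1 := ⟨hs.left_lt.trans hq', hlt⟩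
  unfold ratioWeight clampRight
  rw [if_neg, hK.gapLeft_eq_of_Ioo ha hgap hqI, hK.gapRight_eq_of_Ioo hb hgap hqI]
  · refine cutoff_eq_one (hq _ ⟨?_, ?_⟩).le
    · exact sub_le_sub_right (le_min ((le_of_lt hq'').trans (hK.le_gapRight _)) hm'.2.le) _
    · linarith [min_le_right (gapRight K q.2) (a + 1)]
  · rw [hs.const _ hqI, not_le]
    exact hq'

-- Membership in `O` is constant on each gap, so near each point, on the relevant side, the mixed
-- weight is entirely of one kind and inherits its properties.
open Classical in
theorem isGapWeight_mixedWeight (hK : IsPerfectPeriodic K) (hH : IsNormalLift K h H)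
    (hW : ContinuousOn W (strip H)) (hW0 : ∀ p ∈ strip H, W p ≠ 0) (hO : IsSplitSet K O H W) :
    IsGapWeight K (swapStrip (strip H)) (mixedWeight K O H W) := by
  have hcross := isGapWeight_crossWeight hK ((hH.isStrip hK).swap hK)
  have hev : ∀ {p : ℝ × ℝ}, p.1 ∉ K → ∀ᶠ q in 𝓝 p, mixedWeight K O H W q =
      (if p.1 ∈ O then ratioWeight K H W q else crossWeight K q) := by
    intro p ht
    filter_upwards [(continuous_fst.tendsto p).eventually (hO.eventually_mem_iff hK ht)] with q hq
    simp only [mixedWeight, hq]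
  have hgapO : ∀ {a b : ℝ}, a ∈ K → b ∈ K → (∀ x ∈ Ioo a b, x ∉ K) → ∀ x ∈ Ioo a b, x ∈ O →
      (∀ y ∈ Ioo a b, y ∈ O) ∧ ∃ P, IsSplitGap K H W a b P := by
    intro a b ha hb hg x hx hxO
    have e1 := hK.gapLeft_eq_of_Ioo ha hg hx
    have e2 := hK.gapRight_eq_of_Ioo hb hg hx
    have h1 := hO.gap x hxO
    have h2 := hO.split x hxO
    rw [e1, e2] at h1 h2
    exact ⟨h1, h2⟩
  refine ⟨?_, ?_, ?_, ?_, ?_, ?_, ?_⟩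
  · intro p
    unfold mixedWeight ratioWeight
    split_ifs
    · exact le_rfl
    · exact cutoff_nonneg _
    · exact cutoff_nonneg _
  · intro p
    unfold mixedWeight ratioWeight
    split_ifs
    · exact zero_le_one
    · exact cutoff_le_one _
    · exact cutoff_le_one _
  · intro p hp ha hacc
    obtain ⟨-, b, hb, hab, -, hgap, -⟩ := hK.exists_gap_right ha hacc
    by_cases hx : ∃ x ∈ Ioo p.1 b, x ∈ O
    · obtain ⟨x, hx, hxO⟩ := hx
      obtain ⟨h1, P, hs⟩ := hgapO ha hb hgap x hx hxO
      filter_upwards [(continuous_fst.tendsto p).eventually (Iio_mem_nhds hs.left_lt)] with q hq hq'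
      have hqI : q.1 ∈ Ioo p.1 b := ⟨hq', lt_trans hq hs.lt_right⟩
      unfold mixedWeight ratioWeight
      rw [if_pos (h1 _ hqI), if_pos]
      rw [hs.const _ hqI]
      exact le_of_lt hq
    · push Not at hx
      filter_upwards [hcross.near_left p hp ha hacc,
        (continuous_fst.tendsto p).eventually (Iio_mem_nhds hab)] with q hq hq' hq''
      unfold mixedWeight
      rw [if_neg (hx _ ⟨hq'', hq'⟩), hq hq'']
  · intro p hp hb hacc
    obtain ⟨hr, a, ha, hab, hab1, hgap, -⟩ := hK.exists_gap_left hb hacc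
    by_cases hx : ∃ x ∈ Ioo a p.1, x ∈ O
    · obtain ⟨x, hx, hxO⟩ := hx
      obtain ⟨h1, P, hs⟩ := hgapO ha hb hgap x hx hxO
      filter_upwards [ratioWeight_near_right hK hH hW hW0 hp ha hb hab1 hgap hr hs,
        (continuous_fst.tendsto p).eventually (Ioi_mem_nhds hab)] with q hq hq' hq''
      unfold mixedWeight
      rw [if_pos (h1 _ ⟨hq', hq''⟩), hq hq'']
    · push Not at hx
      filter_upwards [hcross.near_right p hp hb hacc,
        (continuous_fst.tendsto p).eventually (Ioi_mem_nhds hab)] with q hq hq' hq''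
      unfold mixedWeight
      rw [if_neg (hx _ ⟨hq', hq''⟩), hq hq'']
  · intro p hp ht hle
    by_cases hpO : p.1 ∈ O
    · obtain ⟨P, hs⟩ := hO.split _ hpO
      filter_upwards [hev ht, ratioWeight_below hK hH hp ht hs hle] with q hq hq'
      rw [hq, if_pos hpO, hq']
    · filter_upwards [hev ht, hcross.below p hp ht hle] with q hq hq'
      rw [hq, if_neg hpO, hq']
  · intro p hp ht hle
    by_cases hpO : p.1 ∈ O
    · obtain ⟨P, hs⟩ := hO.split _ hpO
      filter_upwards [hev ht, ratioWeight_above hK hH hW hW0 hp ht hs hle] with q hq hq'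
      rw [hq, if_pos hpO, hq']
    · filter_upwards [hev ht, hcross.above p hp ht hle] with q hq hq'
      rw [hq, if_neg hpO, hq']
  · intro p hp ht hu
    by_cases hpO : p.1 ∈ O
    · obtain ⟨P, hs⟩ := hO.split _ hpO
      refine (continuousAt_ratioWeight hK hH hW hW0 hp ht hu hs).congr ?_
      filter_upwards [hev ht] with q hq
      rw [hq, if_pos hpO]
    · refine (hcross.continuousAt p hp ht hu).congr ?_
      filter_upwards [hev ht] with q hq
      rw [hq, if_neg hpO]

/-- The weight given by the density ratio is equivariant. -/
theorem ratioWeight_map (hK : IsPerfectPeriodic K) (hH : IsNormalLift K h H)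
    (hW0 : ∀ p ∈ strip H, W p ≠ 0) {φ₁ φ₂ : Equiv.Perm S1} {F₁ F₂ : ℝ ≃o ℝ}
    (hF : IsLiftPair K H φ₁ φ₂ F₁ F₂) {d₁ d₂ : ℝ → ℝ}
    (hW : ∀ x y, (x, y) ∈ strip H → (x ∈ K ∨ y ∈ K) →
      W (F₁ x, F₂ y) * (d₁ x * d₂ y) = W (x, y))
    {s t P P' : ℝ} (hp : (s, t) ∈ strip H) (ht : t ∉ K)
    (hs : IsSplitGap K H W (gapLeft K t) (gapRight K t) P)
    (hs' : IsSplitGap K H W (gapLeft K (F₂ t)) (gapRight K (F₂ t)) P') :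
    ratioWeight K H W (F₂ t, F₁ s + 1) = ratioWeight K H W (t, s + 1) := by
  have hcd := hs.left_lt.trans hs.lt_right
  have h1 := hK.gapLeft_lt ht
  have h2 := hK.lt_gapRight ht
  have h3 := hK.gapRight_lt t
  have hacc := hK.rAcc_gapRight ht
  have hl : gapLeft K (F₂ t) = F₁ (gapLeft K t) := by
    rw [← hF.eqOn _ (hK.gapLeft_mem t)]; exact hF.gapEnd_map₂ hK false t
  have hr : gapRight K (F₂ t) = F₂ (gapRight K t) := hF.gapEnd_map₂ hK true t
  -- The semi conjugacy gives `H (F₁ t)` instead; but `F₁ t` and `F₂ t` are in the same gap, on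
  -- which `H` is constant.
  have hHt : H (F₂ t) = F₂ (H t) := by
    have e1 : F₁ t ∈ Ioo (gapLeft K (F₂ t)) (gapRight K (F₂ t)) := by
      rw [hl, hr, hF.eqOn _ (hK.gapRight_mem t)]
      exact ⟨F₁.strictMono h1, F₁.strictMono h2⟩
    have e2 : F₂ t ∈ Ioo (gapLeft K (F₂ t)) (gapRight K (F₂ t)) := by
      rw [← hF.mem_iff₂] at ht
      exact ⟨hK.gapLeft_lt ht, hK.lt_gapRight ht⟩
    rw [hs'.const _ e2, ← hs'.const _ e1, hF.semiconj]
  have hclamp : clampRight K (F₂ t, F₁ s + 1) - 1 = F₁ (clampRight K (t, s + 1) - 1) := by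
    have e1 : gapRight K (F₁ s + 1) = F₁ (gapRight K (s + 1)) := by
      rw [← hF.lift₁.1]; exact hF.gapEnd_map₁ hK true _
    have e2 : F₁ (clampRight K (t, s + 1)) = F₁ (clampRight K (t, s + 1) - 1) + 1 := by
      rw [← hF.lift₁.1, sub_add_cancel]
    rw [eq_comm, eq_sub_iff_add_eq, ← e2]
    simp only [clampRight]
    rw [F₁.monotone.map_min, e1, hl, hF.lift₁.1]
  unfold ratioWeight
  simp only
  simp only [hHt, OrderIso.le_iff_le]
  split_ifs with hle
  · rfl
  rw [hs.const t ⟨h1, h2⟩, not_le] at hle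
  rw [hclamp, hl, hr]
  have hxK : clampRight K (t, s + 1) - 1 ∈ K := by
    rw [hK.sub_one]
    unfold clampRight
    rcases min_choice (gapRight K (s + 1)) (gapLeft K t + 1) with e | e <;> simp only [e]
    · exact hK.gapRight_mem _
    · exact (hK.add_one _).2 (hK.gapLeft_mem _)
  have hs1 : gapRight K t - 1 < s := by
    by_contra! h4
    exact absurd (lt_of_mem_strip hH.lift.1 hH.lift.2.1 hcd hs.const hp h4) (not_lt.2 hle.le)
  have hx1 : gapRight K t - 1 < clampRight K (t, s + 1) - 1 := by
    refine sub_lt_sub_right (lt_min ?_ h3) _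
    have := hK.le_gapRight (s + 1)
    simp only
    linarith
  have hx2 : clampRight K (t, s + 1) - 1 ≤ gapLeft K t := by
    have := min_le_right (gapRight K (s + 1)) (gapLeft K t + 1)
    unfold clampRight
    simp only
    linarith
  congr 1
  refine densityRatio_map hW0 hW (hK.gapLeft_mem t) hxK ?_ ?_ ?_ ?_
  · exact mem_strip_of_le hK hH hacc hs.const hcd hx1 hx2 hle h2.le
  · exact mem_strip_of_le hK hH hacc hs.const hcd (by linarith) le_rfl hle h2.le
  · exact mem_strip_of_le hK hH hacc hs.const hcd hx1 hx2 hs.lt_right le_rfl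
  · exact mem_strip_of_le hK hH hacc hs.const hcd (by linarith) le_rfl hs.lt_right le_rfl

end Weight

/-! ### The gaps where the monotone map is constant -/

section SplitGap

variable {K : Set ℝ} {h : S1 → S1} {H : ℝ → ℝ} {W : ℝ × ℝ → ℝ} {φ₁ φ₂ : Equiv.Perm S1}
  {F₁ F₂ : ℝ ≃o ℝ} {d₁ d₂ : ℝ → ℝ}

/-- As `t` decreases to `p`, the factor `W (x, t)` stays bounded because `(x, p)` is in the strip,
while `W (n, t)` in the denominator blows up. -/
theorem tendsto_densityRatio (hU : IsOpen (strip H)) (hW : ContinuousOn W (strip H))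
    {n s p x : ℝ} (hx : (x, p) ∈ strip H)
    (h : Tendsto (fun t => |W (n, t)|) (𝓝[>] p) atTop) :
    Tendsto (densityRatio W n s x) (𝓝[>] p) (𝓝 0) := by
  rw [tendsto_zero_iff_abs_tendsto_zero]
  have h1 : Tendsto (fun t => W (x, t)) (𝓝[>] p) (𝓝 (W (x, p))) := by
    have : ContinuousAt (fun t => W (x, t)) p :=
      ContinuousAt.comp (x := p) (f := fun t => (x, t)) (hW.continuousAt (hU.mem_nhds hx))
        (by fun_prop)
    exact this.tendsto.mono_left nhdsWithin_le_nhds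
  have h2 := ((h1.abs.const_mul |W (n, s)|).div_const |W (x, s)|).mul
    (tendsto_inv_atTop_zero.comp h)
  rw [mul_zero] at h2
  refine h2.congr fun t => ?_
  simp only [Function.comp, densityRatio, abs_div, abs_mul]
  rw [div_mul_eq_mul_div, mul_comm |W (n, t)|, div_mul_eq_div_div, div_eq_mul_inv _ |W (n, t)|,
    div_mul_eq_mul_div]

/-- The gap between the fixed points of a hyperbolic map. -/
theorem isSplitGap_of_fixed (hK : IsPerfectPeriodic K) (hH : IsNormalLift K h H)
    (hW : ContinuousOn W (strip H)) (hW0 : ∀ p ∈ strip H, W p ≠ 0)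
    (hinv : ∀ x y, (x, y) ∈ strip H → (x ∈ K ∨ y ∈ K) →
      W (F₁ x, F₂ y) * (d₁ x * d₂ y) = W (x, y))
    {n s p μ : ℝ} (hsn : s < n + 1) (hn : n ∈ K) (hs : s ∈ K)
    (hgap : ∀ t ∈ Ioo n s, t ∉ K) (hp : p ∈ Ioo n s) (hF₂1 : ∀ t, F₂ (t + 1) = F₂ t + 1)
    (h1n : F₁ n = n) (h1s : F₁ s = s) (h2p : F₂ p = p) (h2s : F₂ s = s)
    (hdn : d₁ n = μ) (hds : d₁ s = μ⁻¹) (hdp : d₂ p = 1) (hd1 : ∀ t, d₂ (t + 1) = d₂ t)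
    (hdc : Continuous d₂) (hd0 : ∀ t, 0 < d₂ t) (hμ0 : 0 < μ)
    (hμ : (1 < μ ∧ ∀ t ∈ Ioo p s, t < F₂ t) ∨ (μ < 1 ∧ ∀ t ∈ Ioo p s, F₂ t < t)) :
    IsSplitGap K H W n s p := by
  have hns := hp.1.trans hp.2
  have hlacc : LAcc K n := by
    have := hK.lAcc_gapLeft (hgap p hp)
    rwa [hK.gapLeft_eq_of_Ioo hn hgap hp] at this
  have hracc : RAcc K s := by
    have := hK.rAcc_gapRight (hgap p hp)
    rwa [hK.gapRight_eq_of_Ioo hs hgap hp] at this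
  have hμ1 : μ ≠ 1 := by
    rcases hμ with h | h
    · exact h.1.ne'
    · exact h.1.ne
  -- The pair fixes `(n, p)` with Jacobian `μ ≠ 1`, which is incompatible with a nonzero invariant
  -- density. At `(s, p + 1)` the Jacobian is the inverse of `μ`.
  have hnp : (n, p) ∉ strip H := by
    intro hm
    have h1 := hinv n p hm (Or.inl hn)
    rw [h1n, h2p, hdn, hdp, mul_one] at h1
    exact hμ1 ((mul_eq_left₀ (hW0 _ hm)).1 h1)
  have hsp : (s, p + 1) ∉ strip H := by
    intro hm
    have h1 := hinv s (p + 1) hm (Or.inl hs)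
    rw [h1s, hF₂1, h2p, hds, hd1, hdp, mul_one] at h1
    exact hμ1 (inv_eq_one.1 ((mul_eq_left₀ (hW0 _ hm)).1 h1))
  -- A value of `H` above `p` on the gap would put `(s, p + 1)` in the strip, and a value below `p`
  -- would put `(n, p)` there.
  have hconst : ∀ t ∈ Ioo n s, H t = p := by
    intro t ht
    apply le_antisymm
    · by_contra! hlt
      obtain ⟨w, hw, h1, h2⟩ := hracc (p + 1 - s) (by linarith [hp.1])
      refine hsp ⟨⟨w, h1, ?_⟩, t, ht.2, ?_⟩
      · rw [hH.eq_self w hw]; simp only; linarith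
      · simp only; linarith
    · by_contra! hlt
      obtain ⟨w, hw, h1, h2⟩ := hlacc (n + 1 - p) (by linarith [hp.2])
      refine hnp ⟨⟨t, ht.1, hlt⟩, w, h2, ?_⟩
      rw [hH.eq_self w hw]; simp only; linarith
  have hmem : ∀ t ∈ Ioo p s, (n, t) ∈ strip H := fun t ht =>
    mem_strip_of_le hK hH hracc hconst hns (by linarith) le_rfl ht.1 ht.2.le
  have hwc : ContinuousOn (fun t => |W (n, t)|) (Ioo p s) :=
    (hW.comp (by fun_prop : ContinuousOn (fun t => (n, t)) (Ioo p s)) hmem).abs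
  have hw0 : ∀ t ∈ Ioo p s, 0 < |W (n, t)| := fun t ht => abs_pos.2 (hW0 _ (hmem t ht))
  have heq : ∀ t ∈ Ioo p s, |W (n, F₂ t)| * (μ * d₂ t) = |W (n, t)| := by
    intro t ht
    have h1 := hinv n t (hmem t ht) (Or.inl hn)
    rw [h1n, hdn] at h1
    rw [← h1, abs_mul, abs_of_pos (mul_pos hμ0 (hd0 t))]
  -- The factor along the vertical line tends to `μ` at `p`. If `μ > 1`, `F₂` moves points away from
  -- `p`; if `μ < 1`, its inverse does, with inverse factor. Both cases are expanding.
  have htop : Tendsto (fun t => |W (n, t)|) (𝓝[>] p) atTop := by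
    rcases hμ with ⟨h1, h2⟩ | ⟨h1, h2⟩
    · refine tendsto_atTop_of_expanding (E := F₂) (e := fun t => μ * d₂ t) hp.2 h2p h2s h2 hwc hw0
        ?_ h1 heq
      have := (hdc.tendsto p).const_mul μ
      rw [hdp, mul_one] at this
      exact this.mono_left nhdsWithin_le_nhds
    · have h2p' : F₂.symm p = p := by rw [OrderIso.symm_apply_eq, h2p]
      have h2s' : F₂.symm s = s := by rw [OrderIso.symm_apply_eq, h2s]
      have hI : ∀ t ∈ Ioo p s, F₂.symm t ∈ Ioo p s := by
        intro t ht
        have e1 := F₂.symm.strictMono ht.1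
        have e2 := F₂.symm.strictMono ht.2
        rw [h2p'] at e1
        rw [h2s'] at e2
        exact ⟨e1, e2⟩
      refine tendsto_atTop_of_expanding (E := F₂.symm) (e := fun t => (μ * d₂ (F₂.symm t))⁻¹)
        hp.2 h2p' h2s' ?_ hwc hw0 ?_ ((one_lt_inv₀ hμ0).2 h1) ?_
      · intro t ht
        have := h2 _ (hI t ht)
        rwa [F₂.apply_symm_apply] at this
      · have hc : ContinuousAt (fun t => (μ * d₂ (F₂.symm t))⁻¹) p := by
          refine ContinuousAt.inv₀ ?_ (mul_pos hμ0 (hd0 _)).ne'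
          exact (continuous_const.mul (hdc.comp F₂.symm.continuous)).continuousAt
        have := hc.tendsto
        rw [h2p', hdp, mul_one] at this
        exact this.mono_left nhdsWithin_le_nhds
      · intro t ht
        have := heq _ (hI t ht)
        rw [F₂.apply_symm_apply] at this
        rw [← this]
        exact mul_inv_cancel_right₀ (mul_pos hμ0 (hd0 _)).ne' _
  refine ⟨hp.1, hp.2, hconst, fun x _ h1 h2 => ?_⟩
  exact tendsto_densityRatio (hH.isStrip hK).isOpen hW
    (mem_strip_of_lt hK hH hn hracc h1 h2 hp.1 hp.2.le) htop

/-- The semi conjugacy pulls back constancy of `H`, and invariance of the density ratio pulls back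
its limit. One gap of each orbit is thus enough. -/
theorem IsSplitGap.of_map (hK : IsPerfectPeriodic K) (hH : IsNormalLift K h H)
    (hW0 : ∀ p ∈ strip H, W p ≠ 0) (hF : IsLiftPair K H φ₁ φ₂ F₁ F₂)
    (hinv : ∀ x y, (x, y) ∈ strip H → (x ∈ K ∨ y ∈ K) →
      W (F₁ x, F₂ y) * (d₁ x * d₂ y) = W (x, y))
    {c d P : ℝ} (hc : c ∈ K) (hd : d ∈ K) (hracc : RAcc K d)
    (hs : IsSplitGap K H W (F₁ c) (F₁ d) P) : IsSplitGap K H W c d (F₂.symm P) := by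
  have h1 : c < F₂.symm P := by rw [F₂.lt_symm_apply, hF.eqOn c hc]; exact hs.left_lt
  have h2 : F₂.symm P < d := by rw [F₂.symm_apply_lt, hF.eqOn d hd]; exact hs.lt_right
  have hconst : ∀ t ∈ Ioo c d, H t = F₂.symm P := by
    intro t ht
    rw [OrderIso.eq_symm_apply, hF.semiconj]
    exact hs.const _ ⟨F₁.strictMono ht.1, F₁.strictMono ht.2⟩
  refine ⟨h1, h2, hconst, fun x hx hdx hxc => ?_⟩
  have h3 : F₁ d - 1 < F₁ x := by
    have := F₁.strictMono (show d < x + 1 by linarith)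
    rw [hF.lift₁.1] at this
    linarith
  have h4 := hs.tendsto _ ((hF.mem_iff x).2 hx) h3 (F₁.strictMono hxc)
  have h5 : Tendsto F₂ (𝓝[>] (F₂.symm P)) (𝓝[>] P) := by
    refine tendsto_nhdsWithin_of_tendsto_nhds_of_eventually_within _ ?_ ?_
    · have := F₂.continuous.tendsto (F₂.symm P)
      rw [F₂.apply_symm_apply] at this
      exact this.mono_left nhdsWithin_le_nhds
    · filter_upwards [self_mem_nhdsWithin] with t ht
      rwa [mem_Ioi, ← F₂.symm_apply_lt]
  refine (h4.comp h5).congr' ?_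
  have hcd := h1.trans h2
  filter_upwards [Ioo_mem_nhdsGT h2] with t ht
  have key := densityRatio_map (c := c) (d := d) hW0 hinv hc hx
    (mem_strip_of_le hK hH hracc hconst hcd hdx hxc.le ht.1 ht.2.le)
    (mem_strip_of_le hK hH hracc hconst hcd (by linarith) le_rfl ht.1 ht.2.le)
    (mem_strip_of_le hK hH hracc hconst hcd hdx hxc.le h2 le_rfl)
    (mem_strip_of_le hK hH hracc hconst hcd (by linarith) le_rfl h2 le_rfl)
  rw [hF.eqOn d hd] at key
  exact key

end SplitGap

/-! ### The invariant density on the strip -/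

/-- The first weight is invariant because `F₁` is projective. For the second, either `t` is in `O`
and the density ratio is used, or `F₂ t = F₁ t` and the cross ratio applies again. -/
theorem interp_equivariant {K O : Set ℝ} {h : S1 → S1} {H : ℝ → ℝ} {W : ℝ × ℝ → ℝ}
    (hK : IsPerfectPeriodic K) (hH : IsNormalLift K h H)
    (hW : ContinuousOn W (strip H)) (hW0 : ∀ p ∈ strip H, W p ≠ 0) (hO : IsSplitSet K O H W)
    {φ₁ φ₂ : Equiv.Perm S1} {F₁ F₂ : ℝ ≃o ℝ} (hF : IsLiftPair K H φ₁ φ₂ F₁ F₂) {ρ : ℝ → ℝ}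
    (hρ : ∀ t, 0 < ρ t) (hsin : ∀ s t, ρ s * ρ t * sinPi (F₁ s - F₁ t) = sinPi (s - t))
    (hO1 : ∀ t, F₁ t ∈ O ↔ t ∈ O) (hO2 : ∀ t, t ∉ O → F₂ t = F₁ t) {d₁ d₂ : ℝ → ℝ}
    (hinv : ∀ x y, (x, y) ∈ strip H → (x ∈ K ∨ y ∈ K) →
      W (F₁ x, F₂ y) * (d₁ x * d₂ y) = W (x, y)) {s t : ℝ} (hp : (s, t) ∈ strip H) :
    interp K W (crossWeight K) (mixedWeight K O H W) (F₁ s, F₂ t) * (d₁ s * d₂ t) =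
      interp K W (crossWeight K) (mixedWeight K O H W) (s, t) := by
  have hU := hH.isStrip hK
  have hl₁ : ∀ t, gapLeft K (F₁ t) = F₁ (gapLeft K t) := hF.gapEnd_map₁ hK false
  have hr₁ : ∀ t, gapRight K (F₁ t) = F₁ (gapRight K t) := hF.gapEnd_map₁ hK true
  have hr₂ : ∀ t, gapRight K (F₂ t) = F₁ (gapRight K t) := fun t => by
    rw [← hF.eqOn _ (hK.gapRight_mem t)]; exact hF.gapEnd_map₂ hK true t
  have hOF : F₂ t ∈ O ↔ t ∈ O := by
    by_cases ht : t ∈ O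
    · refine iff_of_true (hO.gap _ ((hO1 t).2 ht) _ ?_) ht
      have htK := hO.notMem t ht
      rw [hl₁, hr₁, ← hF.eqOn _ (hK.gapLeft_mem t), ← hF.eqOn _ (hK.gapRight_mem t)]
      exact ⟨F₂.strictMono (hK.gapLeft_lt htK), F₂.strictMono (hK.lt_gapRight htK)⟩
    · rw [hO2 t ht, hO1]
  refine interp_map hK hU (isGapWeight_crossWeight hK hU)
    (isGapWeight_mixedWeight hK hH hW hW0 hO) hW0 hp ?_ ?_ (fun b => hF.gapEnd_map₁ hK b s)
    (fun b => hF.gapEnd_map₂ hK b t) hinv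
  · exact crossWeight_map hρ hsin hF.lift₁.1 rfl (hl₁ s) (hr₁ s) (hr₂ t)
  · unfold mixedWeight
    by_cases ht : t ∈ O
    · rw [if_pos ht, if_pos (hOF.2 ht)]
      obtain ⟨P, hP⟩ := hO.split t ht
      obtain ⟨P', hP'⟩ := hO.split _ (hOF.2 ht)
      exact ratioWeight_map hK hH hW0 hF hinv hp (hO.notMem t ht) hP hP'
    · rw [if_neg ht, if_neg (mt hOF.1 ht), hO2 t ht]
      refine crossWeight_map hρ hsin hF.lift₁.1 rfl (hl₁ t) (hr₁ t) ?_
      rw [← hF.lift₁.1, hr₁]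

theorem isLiftPair_translation {K : Set ℝ} {h : S1 → S1} {H : ℝ → ℝ} (hK : IsPerfectPeriodic K)
    (hH : IsNormalLift K h H) (k : ℤ) :
    IsLiftPair K H 1 1 (OrderIso.addRight (k : ℝ)) (OrderIso.addRight (k : ℝ)) := by
  have hl : IsLift (OrderIso.addRight (k : ℝ)) 1 :=
    ⟨fun t => by simp only [OrderIso.addRight_apply]; ring,
      fun t => by simp⟩
  refine ⟨hl, hl, fun _ _ => rfl, fun z => ?_, fun t => ?_⟩
  · exact hK.add_int k z
  · simp only [OrderIso.addRight_apply]
    rw [map_add_int hH.lift.2.1]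

/-- Integer translations are lifts of the identity, so periodicity is equivariance with all local
factors equal to one. -/
theorem interp_add_int {K O : Set ℝ} {h : S1 → S1} {H : ℝ → ℝ} {W : ℝ × ℝ → ℝ}
    (hK : IsPerfectPeriodic K) (hH : IsNormalLift K h H)
    (hW : ContinuousOn W (strip H)) (hW0 : ∀ p ∈ strip H, W p ≠ 0) (hO : IsSplitSet K O H W)
    (hO1 : ∀ (k : ℤ) (t : ℝ), t + k ∈ O ↔ t ∈ O) (hW1 : ∀ (k : ℤ) s t, W (s + k, t + k) = W (s, t))
    (k : ℤ) {s t : ℝ} (hp : (s, t) ∈ strip H) :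
    interp K W (crossWeight K) (mixedWeight K O H W) (s + k, t + k) =
      interp K W (crossWeight K) (mixedWeight K O H W) (s, t) := by
  have := interp_equivariant hK hH hW hW0 hO (isLiftPair_translation hK hH k) (ρ := fun _ => 1)
    (fun _ => one_pos) (fun s t => by simp) (hO1 k) (fun _ _ => rfl) (d₁ := fun _ => 1)
    (d₂ := fun _ => 1) (fun x y _ _ => by simp [hW1]) hp
  simpa using this

/-! ### Descent to the circle -/

theorem exists_descent {K : Set ℝ} {h : S1 → S1} {H : ℝ → ℝ} (hH : IsNormalLift K h H)
    {I : ℝ × ℝ → ℝ} (hI : ∀ (k : ℤ) s t, (s, t) ∈ strip H → I (s + k, t + k) = I (s, t)) :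
    ∃ ω : S1 × S1 → ℝ, ∀ s t : ℝ, (s, t) ∈ strip H → ω ((s : S1), (t : S1)) = I (s, t) := by
  classical
  refine ⟨fun q => if hq : ∃ p ∈ strip H, ((p.1 : S1), (p.2 : S1)) = q then I hq.choose else 0,
    fun s t hp => ?_⟩
  have hq : ∃ p ∈ strip H, ((p.1 : S1), (p.2 : S1)) = ((s : S1), (t : S1)) := ⟨(s, t), hp, rfl⟩
  simp only [dif_pos hq]
  obtain ⟨h1, h2⟩ := hq.choose_spec
  rw [Prod.mk.injEq] at h2
  obtain ⟨k, hk⟩ := strip_unique hH.lift.1 hH.lift.2.1 h1 hp h2.1 h2.2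
  rw [hk]
  exact hI k s t hp

theorem continuousAt_of_descent {ω : S1 × S1 → ℝ} {I : ℝ × ℝ → ℝ} {U : Set (ℝ × ℝ)}
    (hU : IsOpen U) (hω : ∀ s t : ℝ, (s, t) ∈ U → ω ((s : S1), (t : S1)) = I (s, t)) {s t : ℝ}
    (hp : (s, t) ∈ U) (hI : ContinuousAt I (s, t)) : ContinuousAt ω ((s : S1), (t : S1)) := by
  have hopen : IsOpenMap (Prod.map (fun t : ℝ => (t : S1)) (fun t : ℝ => (t : S1))) :=
    isOpenMap_coe.prodMap isOpenMap_coe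
  have h1 : Tendsto (ω ∘ Prod.map (fun t : ℝ => (t : S1)) (fun t : ℝ => (t : S1))) (𝓝 (s, t))
      (𝓝 (I (s, t))) := by
    refine hI.tendsto.congr' ?_
    filter_upwards [hU.mem_nhds hp] with q hq using (hω q.1 q.2 hq).symm
  have h2 := (tendsto_map'_iff.2 h1).mono_left (hopen.nhds_le (s, t))
  rw [← hω s t hp] at h2
  exact h2

theorem delta1_ne_one : delta1 ≠ 1 := by
  intro h
  have h1 := congrArg (FreeGroup.lift (fun _ : Fin 3 => Multiplicative.ofAdd (1 : ℤ))) h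
  simp only [delta1, genA, genB, genC, map_mul, FreeGroup.lift_apply_of, map_one] at h1
  revert h1
  decide

/-! ### The main construction -/

theorem IsLift.exists_Ico {F : ℝ ≃o ℝ} {φ : Equiv.Perm S1} (hF : IsLift F φ) (n t : ℝ) :
    ∃ G : ℝ ≃o ℝ, IsLift G φ ∧ G t ∈ Ico n (n + 1) := by
  obtain ⟨G, hG, hGF⟩ := hF.add_int (-⌊F t - n⌋)
  refine ⟨G, hG, ?_, ?_⟩ <;> rw [hGF] <;> push_cast
  · linarith [Int.floor_le (F t - n)]
  · linarith [Int.lt_floor_add_one (F t - n)]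

theorem notMem_orbitArc {ρ : F3 →* Equiv.Perm S1} {N S : S1} (h : IsGap (limitSet ρ) N S) {x : S1}
    (hx : x ∈ limitSet ρ) : x ∉ orbitArc ρ N S := by
  rintro ⟨γ, hγ⟩
  obtain ⟨y, -, hy⟩ := h
  rw [hy] at hγ
  exact connectedComponentIn_subset _ _ hγ ((map_mem_limitSet ρ γ).2 hx)

section Main

variable {ρ₁ : F3 →* PSL(2, ℝ)} {f : Equiv.Perm S1} {n s : ℝ} {h : S1 → S1} {H : ℝ → ℝ}

/-- Every element of the group has a projective lift, and a compatible lift of its deformation. -/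
theorem exists_pair_deformedRep
    (hK : IsPerfectPeriodic {t : ℝ | (t : S1) ∈ limitSet (projRep ρ₁)})
    (hgap : IsGap (limitSet (projRep ρ₁)) (n : S1) (s : S1)) (hfL : ∃ F, IsLift F f)
    (hfeq : ∀ x ∈ cIcc (s : S1) (n : S1), f x = projRep ρ₁ delta1 x)
    (hH : IsNormalLift {t : ℝ | (t : S1) ∈ limitSet (projRep ρ₁)} h H)
    (hconj : ∀ γ : F3, ∀ x, deformedRep (projRep ρ₁) f γ (h x) = h (projRep ρ₁ γ x)) (γ : F3)
    {F₁ : ℝ ≃o ℝ} (hF₁ : IsLift F₁ (projRep ρ₁ γ)) :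
    ∃ F₂ : ℝ ≃o ℝ, IsLiftPair {t : ℝ | (t : S1) ∈ limitSet (projRep ρ₁)} H (projRep ρ₁ γ)
      (deformedRep (projRep ρ₁) f γ) F₁ F₂ := by
  refine exists_isLiftPair hK hH hF₁ (exists_lift_deformedRep _ f
    (fun γ => exists_lift_circleAction (ρ₁ γ)) hfL γ) (fun z hz => ?_) (fun z => ?_) (hconj γ)
  · exact deformedRep_eq _ f hfeq γ _ (notMem_orbitArc hgap hz)
  · simp only [mem_ofPred_eq]
    rw [← hF₁.2, map_mem_limitSet]

/-- Every gap in the orbit is carried onto `(n, s)` by a suitable translate of a lift, along which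
the splitting is pulled back. -/
theorem isSplitSet_orbitArc {W : ℝ × ℝ → ℝ}
    (hK : IsPerfectPeriodic {t : ℝ | (t : S1) ∈ limitSet (projRep ρ₁)})
    (hns : n < s) (hsn : s < n + 1) (hgap : IsGap (limitSet (projRep ρ₁)) (n : S1) (s : S1))
    (hn : (n : S1) ∈ limitSet (projRep ρ₁)) (hs : (s : S1) ∈ limitSet (projRep ρ₁))
    (hfL : ∃ F, IsLift F f)
    (hfeq : ∀ x ∈ cIcc (s : S1) (n : S1), f x = projRep ρ₁ delta1 x)
    (hH : IsNormalLift {t : ℝ | (t : S1) ∈ limitSet (projRep ρ₁)} h H)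
    (hconj : ∀ γ : F3, ∀ x, deformedRep (projRep ρ₁) f γ (h x) = h (projRep ρ₁ γ x))
    (hW0 : ∀ p ∈ strip H, W p ≠ 0)
    (hinv : ∀ (γ : F3) (F₁ F₂ : ℝ ≃o ℝ), IsLift F₁ (projRep ρ₁ γ) →
      IsLift F₂ (deformedRep (projRep ρ₁) f γ) → ∀ x y : ℝ, (x, y) ∈ strip H →
      ((x : S1) ∈ limitSet (projRep ρ₁) ∨ (y : S1) ∈ limitSet (projRep ρ₁)) →
      W (F₁ x, F₂ y) * (circleDeriv (projRep ρ₁ γ) (x : S1) *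
        circleDeriv (deformedRep (projRep ρ₁) f γ) (y : S1)) = W (x, y)) {p : ℝ}
    (hsplit : IsSplitGap {t : ℝ | (t : S1) ∈ limitSet (projRep ρ₁)} H W n s p) :
    IsSplitSet {t : ℝ | (t : S1) ∈ limitSet (projRep ρ₁)}
      {t : ℝ | (t : S1) ∈ orbitArc (projRep ρ₁) (n : S1) (s : S1)} H W := by
  have hgapK : ∀ t ∈ Ioo n s, t ∉ {t : ℝ | (t : S1) ∈ limitSet (projRep ρ₁)} := by
    intro t ht htK
    refine notMem_orbitArc hgap htK ⟨1, ?_⟩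
    rw [map_one]
    exact (mem_cIoo_iff hns hsn ⟨ht.1.le, ht.2.trans hsn⟩).2 ht
  have key : ∀ t : ℝ, (t : S1) ∈ orbitArc (projRep ρ₁) (n : S1) (s : S1) →
      ∃ (γ : F3) (F₁ F₂ : ℝ ≃o ℝ), IsLiftPair {t : ℝ | (t : S1) ∈ limitSet (projRep ρ₁)} H
        (projRep ρ₁ γ) (deformedRep (projRep ρ₁) f γ) F₁ F₂ ∧ F₁ t ∈ Ioo n s := by
    rintro t ⟨γ, hγ⟩
    obtain ⟨F, hF⟩ := exists_lift_circleAction (ρ₁ γ)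
    obtain ⟨F₁, hF₁, ht⟩ := hF.exists_Ico n t
    change IsLift F₁ (projRep ρ₁ γ) at hF₁
    obtain ⟨F₂, hF₂⟩ := exists_pair_deformedRep hK hgap hfL hfeq hH hconj γ hF₁
    refine ⟨γ, F₁, F₂, hF₂, ?_⟩
    rw [hF₁.2] at hγ
    exact (mem_cIoo_iff hns hsn ht).1 hγ
  have ends : ∀ {γ : F3} {F₁ F₂ : ℝ ≃o ℝ} {t : ℝ},
      IsLiftPair {t : ℝ | (t : S1) ∈ limitSet (projRep ρ₁)} H
        (projRep ρ₁ γ) (deformedRep (projRep ρ₁) f γ) F₁ F₂ → F₁ t ∈ Ioo n s →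
      F₁ (gapLeft {t : ℝ | (t : S1) ∈ limitSet (projRep ρ₁)} t) = n ∧
        F₁ (gapRight {t : ℝ | (t : S1) ∈ limitSet (projRep ρ₁)} t) = s := by
    intro γ F₁ F₂ t hF ht
    exact ⟨(hF.gapEnd_map₁ hK false t).symm.trans (hK.gapLeft_eq_of_Ioo hn hgapK ht),
      (hF.gapEnd_map₁ hK true t).symm.trans (hK.gapRight_eq_of_Ioo hs hgapK ht)⟩
  refine ⟨fun t ht htK => notMem_orbitArc hgap htK ht, fun t ht t' ht' => ?_, fun t ht => ?_⟩
  · obtain ⟨γ, F₁, F₂, hF, h1⟩ := key t ht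
    obtain ⟨h2, h3⟩ := ends hF h1
    refine ⟨γ, ?_⟩
    have h4 := F₁.strictMono ht'.1
    have h5 := F₁.strictMono ht'.2
    rw [h2] at h4
    rw [h3] at h5
    rw [hF.lift₁.2]
    exact (mem_cIoo_iff hns hsn ⟨h4.le, h5.trans hsn⟩).2 ⟨h4, h5⟩
  · obtain ⟨γ, F₁, F₂, hF, h1⟩ := key t ht
    obtain ⟨h2, h3⟩ := ends hF h1
    refine ⟨F₂.symm p, IsSplitGap.of_map hK hH hW0 hF (hinv γ F₁ F₂ hF.lift₁ hF.lift₂)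
      (hK.gapLeft_mem t) (hK.gapRight_mem t)
      (hK.rAcc_gapRight fun htK => notMem_orbitArc hgap htK ht) ?_⟩
    rw [h2, h3]
    exact hsplit

/-- The density at the gap fixed by `δ₁`. -/
theorem exists_isSplitGap {W : ℝ × ℝ → ℝ} (hρ : Function.Injective ρ₁)
    (hK : IsPerfectPeriodic {t : ℝ | (t : S1) ∈ limitSet (projRep ρ₁)})
    (hns : n < s) (hsn : s < n + 1)
    (hn : (n : S1) ∈ limitSet (projRep ρ₁)) (hs : (s : S1) ∈ limitSet (projRep ρ₁))
    (hgapK : ∀ t ∈ Ioo n s, (t : S1) ∉ limitSet (projRep ρ₁))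
    (hN : projRep ρ₁ delta1 (n : S1) = (n : S1)) (hS : projRep ρ₁ delta1 (s : S1) = (s : S1))
    (hf : IsModificationOn (n : S1) (s : S1) (projRep ρ₁ delta1) f)
    (hH : IsNormalLift {t : ℝ | (t : S1) ∈ limitSet (projRep ρ₁)} h H)
    (hW : ContinuousOn W (strip H)) (hW0 : ∀ p ∈ strip H, W p ≠ 0)
    (hinv : ∀ (γ : F3) (F₁ F₂ : ℝ ≃o ℝ), IsLift F₁ (projRep ρ₁ γ) →
      IsLift F₂ (deformedRep (projRep ρ₁) f γ) → ∀ x y : ℝ, (x, y) ∈ strip H →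
      ((x : S1) ∈ limitSet (projRep ρ₁) ∨ (y : S1) ∈ limitSet (projRep ρ₁)) →
      W (F₁ x, F₂ y) * (circleDeriv (projRep ρ₁ γ) (x : S1) *
        circleDeriv (deformedRep (projRep ρ₁) f γ) (y : S1)) = W (x, y)) :
    (∃ F, IsLift F f) ∧
      ∃ p, IsSplitGap {t : ℝ | (t : S1) ∈ limitSet (projRep ρ₁)} H W n s p := by
  have hg : ρ₁ delta1 ≠ 1 := fun e => delta1_ne_one (hρ (by rw [e, map_one]))
  obtain ⟨G, μ, hG, hGn, hGs, hμ0, hμ1, dn, ds⟩ := circleDeriv_of_fixed hg hns hsn hN hS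
  obtain ⟨F, p, hF, hp, hFn, hFp, hFs, hFc, hF0, hFd, hFp1, hdich⟩ :=
    exists_modification_lift hns hsn hG hGn hGs dn ds hμ0 hμ1 hf
  have hder : ∀ t : ℝ, circleDeriv (deformedRep (projRep ρ₁) f delta1) (t : S1) = deriv F t := by
    intro t
    rw [deformedRep_delta1]
    exact circleDeriv_eq hF.2 (hFd t)
  have hF' : IsLift F (deformedRep (projRep ρ₁) f delta1) := by rwa [deformedRep_delta1]
  refine ⟨⟨F, hF⟩, p, ?_⟩
  refine isSplitGap_of_fixed hK hH hW hW0 (hinv delta1 G F hG hF') hsn hn hs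
    hgapK hp hF.1 hGn hGs hFp hFs (μ := μ) ?_ ?_ ?_ ?_ ?_ ?_ hμ0 hdich
  · exact circleDeriv_eq hG.2 dn
  · exact circleDeriv_eq hG.2 ds
  · rw [hder, hFp1]
  · intro t
    simp
  · simp only [hder]
    exact hFc
  · intro t
    rw [hder]
    exact hF0 t

end Main

end AreaPreserving

end

theorem proposition5
    (ρ₁ : F3 →* PSL(2, ℝ)) (hρ₁ : IsTwicePuncturedTorusHolonomy ρ₁)
    (N S : S1) (hN : projRep ρ₁ delta1 N = N) (hS : projRep ρ₁ delta1 S = S)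
    (hNS : IsGap (limitSet (projRep ρ₁)) N S)
    (f : Equiv.Perm S1) (hf : IsModificationOn N S (projRep ρ₁ delta1) f)
    (h : S1 → S1) (hid : ∀ x ∈ limitSet (projRep ρ₁), h x = x)
    (hconj : IsSemiConjugateTriple (projRep ρ₁) (deformedRep (projRep ρ₁) f) h)
    (ω₂ : S1 × S1 → ℝ) (hω₂ : IsContinuousVolumeForm (surfaceM h) ω₂)
    (hinv : IsPreservedAt (projRep ρ₁) (deformedRep (projRep ρ₁) f)
      {p ∈ surfaceM h | p.1 ∈ limitSet (projRep ρ₁) ∨ p.2 ∈ limitSet (projRep ρ₁)} ω₂) :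
    ∃ ω : S1 × S1 → ℝ,
      IsContinuousVolumeForm (surfaceM h) ω ∧
      IsPreservedAt (projRep ρ₁) (deformedRep (projRep ρ₁) f) (surfaceM h) ω ∧
      ∀ p ∈ surfaceM h,
        p.1 ∈ limitSet (projRep ρ₁) ∨ p.2 ∈ limitSet (projRep ρ₁) → ω p = ω₂ p := by
  obtain ⟨q, p₁, p₂, hq, -⟩ := hρ₁
  have hρ := injective_of_isUniformization hq
  obtain ⟨n, s, rfl, rfl, hns, hsn, hn, hs, hgapK⟩ := exists_lift_of_isGap (isClosed_limitSet _) hNS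
  have hK := isPerfectPeriodic_limitSet hρ hns hsn hn hs
  set K : Set ℝ := {t : ℝ | (t : S1) ∈ limitSet (projRep ρ₁)} with hKdef
  obtain ⟨H₀, hH₀⟩ := hconj.1.2
  obtain ⟨k₀, hH⟩ := exists_int_normalize hK (fun z hz => hid _ hz) hH₀
  set H : ℝ → ℝ := fun t => H₀ t - k₀
  set W : ℝ × ℝ → ℝ := fun p => ω₂ ((p.1 : S1), (p.2 : S1)) with hWdef
  have hmem : ∀ {x y : ℝ}, (x, y) ∈ strip H → ((x : S1), (y : S1)) ∈ surfaceM h :=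
    fun hp => mem_surfaceM_of_mem_strip hK hH hp
  have hW : ContinuousOn W (strip H) := by
    refine hω₂.1.comp (Continuous.continuousOn ?_) fun p hp => hmem hp
    exact (continuous_coe.comp continuous_fst).prodMk (continuous_coe.comp continuous_snd)
  have hW0 : ∀ p ∈ strip H, W p ≠ 0 := fun p hp => hω₂.2 _ (hmem hp)
  have hW1 : ∀ (k : ℤ) (x y : ℝ), W (x + k, y + k) = W (x, y) := by
    intro k x y
    simp only [hWdef, coe_add_intCast]
  have hWinv : ∀ (γ : F3) (F₁ F₂ : ℝ ≃o ℝ), IsLift F₁ (projRep ρ₁ γ) →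
      IsLift F₂ (deformedRep (projRep ρ₁) f γ) → ∀ x y : ℝ, (x, y) ∈ strip H →
      ((x : S1) ∈ limitSet (projRep ρ₁) ∨ (y : S1) ∈ limitSet (projRep ρ₁)) →
      W (F₁ x, F₂ y) * (circleDeriv (projRep ρ₁ γ) (x : S1) *
        circleDeriv (deformedRep (projRep ρ₁) f γ) (y : S1)) = W (x, y) := by
    intro γ F₁ F₂ h1 h2 x y hp hL
    have := hinv γ ((x : S1), (y : S1)) ⟨hmem hp, hL⟩
    simp only [h1.2, h2.2] at this
    exact this
  obtain ⟨hfL, p, hsplit⟩ := exists_isSplitGap hρ hK hns hsn hn hs hgapK hN hS hf hH hW hW0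
    hWinv
  have hO := isSplitSet_orbitArc hK hns hsn hNS hn hs hfL hf.2.1 hH hconj.2 hW0 hWinv hsplit
  set O : Set ℝ := {t : ℝ | (t : S1) ∈ orbitArc (projRep ρ₁) (n : S1) (s : S1)} with hOdef
  have hU := hH.isStrip hK
  have hφ := isGapWeight_crossWeight hK hU
  have hθ := isGapWeight_mixedWeight hK hH hW hW0 hO
  obtain ⟨ω, hω⟩ := exists_descent hH (I := interp K W (crossWeight K) (mixedWeight K O H W))
    fun k x y hp => interp_add_int hK hH hW hW0 hO
      (fun k t => by simp only [hOdef, mem_ofPred_eq, coe_add_intCast]) hW1 k hp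
  have hlift : ∀ q ∈ surfaceM h, ∃ x y : ℝ, (x, y) ∈ strip H ∧ q = ((x : S1), (y : S1)) := by
    rintro ⟨x, y⟩ hq
    obtain ⟨x, rfl⟩ := coe_surjective x
    obtain ⟨y, rfl⟩ := coe_surjective y
    obtain ⟨k, hk⟩ := exists_mem_strip hK hH hq
    exact ⟨x, y + k, hk, by rw [coe_add_intCast]⟩
  refine ⟨ω, ⟨fun q hq => ?_, fun q hq => ?_⟩, fun γ q hq => ?_, fun q hq hL => ?_⟩ <;>
    obtain ⟨x, y, hp, rfl⟩ := hlift q hq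
  · exact (continuousAt_of_descent hU.isOpen hω hp
      (continuousAt_interp hK hU hφ hθ hW hW0 hp)).continuousWithinAt
  · rw [hω x y hp]
    exact interp_ne_zero hK hU hφ hθ (mul_pos_of_strip hK hH hW hW0) hp
  -- A matrix representing `ρ₁ γ` supplies the local factors of the sine identity needed for the
  -- cross ratio weight; the lift of the deformed action is then adjusted to it.
  · obtain ⟨A, hA⟩ := QuotientGroup.mk_surjective (ρ₁ γ)
    obtain ⟨F₁, r, hr, hAr, -, hF₁⟩ := exists_projective_lift A
    rw [hA] at hF₁
    obtain ⟨F₂, hF⟩ := exists_pair_deformedRep hK hNS hfL hf.2.1 hH hconj.2 γ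
      (show IsLift F₁ (projRep ρ₁ γ) from hF₁)
    simp only [hF.lift₁.2, hF.lift₂.2]
    rw [hω x y hp, hω _ _ (hF.mem_strip hp)]
    refine interp_equivariant hK hH hW hW0 hO hF hr (sinPi_mul_of_mulVec A hAr) (fun t => ?_)
      (fun t ht => ?_) (d₁ := fun t : ℝ => circleDeriv (projRep ρ₁ γ) (t : S1))
      (d₂ := fun t : ℝ => circleDeriv (deformedRep (projRep ρ₁) f γ) (t : S1))
      (hWinv γ F₁ F₂ hF.lift₁ hF.lift₂) hp
    · simp only [hOdef, mem_ofPred_eq]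
      rw [← hF.lift₁.2, map_mem_orbitArc]
    · exact hF.eq_of_coe hK (deformedRep_eq _ f hf.2.1 γ _ ht)
  · rw [hω x y hp]
    exact interp_eq hK hU hφ hθ hW hW0 hp hL
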